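/- **Setting.** Let $\mathbb{R}^{4,2}$ be $\mathbb{R}^6$ with a scalar product $(\cdot,\cdot)$ of signature $(4,2)$. An *(oriented) sphere* is a null line of $\mathbb{R}^{4,2}$; two spheres *touch* if they are orthogonal; a *contact element* is a totally null $2$-plane. Let $M$ be a connected smooth surface. A *Legendre map* $F$ assigns smoothly to each $x\in M$ a contact element $F(x)$ such that $(d\sigma,\tau)=0$ for all local sections $\sigma,\tau$ of $F$ (contact condition), and such that $X\in T_xM$ vanishes whenever $d_X\sigma\in F(x)$ for all local sections $\sigma$ (immersion). A *curvature sphere* of $F$ at $x$ is a line $\langle c\rangle\subset F(x)$ such that, for some $X\neq0$ in $T_xM$, $d_X\sigma\in F(x)$ for all local sections $\sigma$ with $\sigma(x)=c$. $F$ is *umbilic-free* if it has two distinct curvature spheres at each point. An *isothermic sphere congruence* is a map $S$ from $M$ to the set of spheres such that around each point there are coordinates $(u,v)$ and a smooth lift $s\neq0$ of $S$ with $(s_u,s_v)=0$, $(s_u,s_u)>0$, $(s_v,s_v)>0$ and $s_{uv}\in\langle s\rangle$. We say that $F$ is an *$\Omega$-surface with pair of isothermic sphere congruences* $(S^+,S^-)$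 if $F$ is a Legendre map, $S^\pm$ are isothermic sphere congruences with $S^\pm(x)\subset F(x)$ for all $x$, and at each point $S^+,S^-$ separate two distinct curvature spheres of $F$ harmonically (cross ratio $-1$). A *hyperbolic space* $H=H(\mathfrak p,\mathfrak q)$ is given by $\mathfrak p,\mathfrak q\in\mathbb{R}^{4,2}$ with $|\mathfrak p|^2=-1$ ($\mathfrak p$ is the *point sphere complex*), $|\mathfrak q|^2=1$, $(\mathfrak p,\mathfrak q)=0$, together with the choice of one of the two sheets of $\{y\in\{\mathfrak p,\mathfrak q\}^\perp : |y|^2=-1\}$; this sheet is $H$. A sphere $Q$ is an orientation of the *infinity sphere* of $H$ if the null lines in $\mathfrak p^\perp$ that touch $Q$ are exactly the null lines of $\{\mathfrak p,\mathfrak q\}^\perp$. A *front* in $H$ is a smooth map $\mathfrak f:M\to H$ with a smooth unit normal field $\mathfrak t:M\to\{\mathfrak p,\mathfrak q\}^\perp$, that is, $|\mathfrak t|^2=1$, $(\mathfrak t,\mathfrak f)=(\mathfrak t,d\mathfrak f)=0$, such that $(\mathfrak f,\mathfrak t)$ is an immersion. Its parallel surface at distance $a\in\mathbb{R}$ is $\mathfrak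 f_a=\cosh a\,\mathfrak f+\sinh a\,\mathfrak t$, with unit normal field $\mathfrak t_a=\sinh a\,\mathfrak f+\cosh a\,\mathfrak t$. The front is *flat* if for each $x\in M$ there is $a$ such that near $x$ the map $\mathfrak f_a$ is an immersion whose induced metric has vanishing Gauss curvature. Its *Legendre lift* (with respect to $\mathfrak p,\mathfrak q$) is $x\mapsto\mathrm{span}\{\mathfrak q+\mathfrak f(x),\mathfrak p+\mathfrak t(x)\}$. **Theorem.** 1. A map $F$ from $M$ to the set of linear subspaces of $\mathbb{R}^{4,2}$ is umbilic-free and the Legendre lift of a flat front in some hyperbolic space if and only if $F$ is an $\Omega$-surface with a pair of isothermic sphere congruences $(S^+,S^-)$ for which there are fixed spheres $Q^+,Q^-$ such that $S^+$ touches $Q^+$ everywhere, $S^-$ touches $Q^-$ everywhere, and $Q^\pm$ do not span a contact element, that is, $Q^+\not\perp Q^-$. 2. More precisely, if $(\mathfrak f,\mathfrak t)$ is a flat front in $H(\mathfrak p,\mathfrak q)$ with umbilic-free Legendre lift, then the lift satisfies the condition of 1 with $S^\pm=\langle(\mathfrak p\pm\mathfrak q)+(\mathfrak t\pm\mathfrak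 f)\rangle$ and $Q^\pm=\langle\mathfrak p\pm\mathfrak q\rangle$, and $Q^+\neq Q^-$ are exactly the two orientations of the infinity sphere of $H(\mathfrak p,\mathfrak q)$. 3. Conversely, let $F,S^\pm,Q^\pm$ satisfy the condition of 1. Then $F$ is the Legendre lift of a flat front $(\mathfrak f,\mathfrak t)$ in a hyperbolic space $H(\mathfrak p,\mathfrak q)$ with $Q^\pm=\langle\mathfrak p\pm\mathfrak q\rangle$ and $S^\pm=\langle(\mathfrak p\pm\mathfrak q)+(\mathfrak t\pm\mathfrak f)\rangle$, and $Q^+\ne Q^-$ are exactly the two orientations of the infinity sphere of $H(\mathfrak p,\mathfrak q)$. This determines the point sphere complex, and the flat front, up to parallel transformation: with $\mathfrak p_a=\cosh a\,\mathfrak p+\sinh a\,\mathfrak q$ and $\mathfrak q_a=\sinh a\,\mathfrak p+\cosh a\,\mathfrak q$, (a) for every $a\in\mathbb{R}$, $(\mathfrak p_a,\mathfrak q_a)$ with the same sheet gives the same hyperbolic space and the same two orientations $Q^\pm$ of the infinity sphere, and $(\mathfrak f_a,\mathfrak t_a)$ is a flat front whose Legendre lift with respect to $(\mathfrak p_a,\mathfrak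 q_a)$ is $F$; (b) if $F$ is the Legendre lift of a flat front $(\mathfrak f',\mathfrak t')$ in a hyperbolic space $H'$ given by $(\mathfrak p',\mathfrak q')$ such that $Q^+,Q^-$ are exactly the two orientations of its infinity sphere, then $\mathfrak p'=\varepsilon\,\mathfrak p_a$, $\mathfrak q'=\delta\,\mathfrak q_a$, $\mathfrak f'=\delta\,\mathfrak f_a$ and $\mathfrak t'=\varepsilon\,\mathfrak t_a$ for some $a\in\mathbb{R}$ and $\varepsilon,\delta\in\{1,-1\}$, where $\delta=1$ if $H'=H(\mathfrak p,\mathfrak q)$ (as sets). -/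

import Mathlib

open Set Filter Topology
open scoped Manifold ContDiff

noncomputable section

namespace LieSphere

/-! ### The space `ℝ^{4,2}` and elementary Lie sphere geometry -/

/-- The parameter plane on which surfaces are modelled. -/
abbrev Plane : Type := EuclideanSpace ℝ (Fin 2)

/-- The vector space underlying `ℝ^{4,2}`. -/
abbrev R42 : Type := Fin 6 → ℝ

/-- The scalar product of signature `(4,2)`. -/
def form (x y : R42) : ℝ :=
  x 0 * y 0 + x 1 * y 1 + x 2 * y 2 + x 3 * y 3 - x 4 * y 4 - x 5 * y 5

/-- An oriented sphere (possibly a point sphere): a point of the Lie quadric,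
i.e. a null line of `ℝ^{4,2}`. -/
def IsSphere (P : Submodule ℝ R42) : Prop :=
  ∃ v : R42, v ≠ 0 ∧ form v v = 0 ∧ P = Submodule.span ℝ {v}

/-- Oriented contact of spheres: orthogonality in `ℝ^{4,2}`. Two distinct spheres
span a contact element if and only if they touch. -/
def Touch (P Q : Submodule ℝ R42) : Prop :=
  ∀ a ∈ P, ∀ b ∈ Q, form a b = 0

/-- A contact element: a null 2-plane, i.e. a line in the Lie quadric. -/
def IsContactElement (P : Submodule ℝ R42) : Prop :=
  Module.finrank ℝ P = 2 ∧ ∀ a ∈ P, ∀ b ∈ P, form a b = 0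

/-! ### Calculus on a surface `M` -/

section Surface

variable {M : Type*} [TopologicalSpace M] [ChartedSpace Plane M]

/-- The derivative `d_X g` at `x` of a vector-valued map `g` on the surface. -/
def deriv1 (g : M → R42) (x : M) : TangentSpace 𝓘(ℝ, Plane) x →L[ℝ] R42 :=
  mfderiv 𝓘(ℝ, Plane) 𝓘(ℝ, R42) g x

/-- Partial derivative with respect to the `i`-th coordinate of the plane. -/
def pd {W : Type*} [NormedAddCommGroup W] [NormedSpace ℝ W]
    (i : Fin 2) (g : Plane → W) (y : Plane) : W :=
  fderiv ℝ g y (EuclideanSpace.single i 1)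

/-- Gauss curvature at `y` of the metric `E du² + 2 F du dv + G dv²`, by Brioschi's formula. -/
def brioschi (E F G : Plane → ℝ) (y : Plane) : ℝ :=
  (Matrix.det
      !![-(1 / 2) * pd 1 (pd 1 E) y + pd 0 (pd 1 F) y - (1 / 2) * pd 0 (pd 0 G) y,
           (1 / 2) * pd 0 E y, pd 0 F y - (1 / 2) * pd 1 E y;
         pd 1 F y - (1 / 2) * pd 0 G y, E y, F y;
         (1 / 2) * pd 1 G y, F y, G y]
    - Matrix.det
      !![0, (1 / 2) * pd 1 E y, (1 / 2) * pd 0 G y;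
         (1 / 2) * pd 1 E y, E y, F y;
         (1 / 2) * pd 0 G y, F y, G y])
    / (E y * G y - F y ^ 2) ^ 2

/-- Gauss curvature at `x` of the metric that `g` induces from the scalar product of `ℝ^{4,2}`,
computed in a chart around `x`; it is only used at points where `g` immerses into a
hyperbolic space. -/
def gaussCurvature (g : M → R42) (x : M) : ℝ :=
  let c : Plane → R42 := g ∘ (chartAt Plane x).symm
  brioschi (fun y => form (pd 0 c y) (pd 0 c y)) (fun y => form (pd 0 c y) (pd 1 c y))
    (fun y => form (pd 1 c y) (pd 1 c y)) (chartAt Plane x x)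

/-! ### Legendre maps -/

/-- `σ` is a smooth section of the plane field `F` over `U`. -/
def IsSection (F : M → Submodule ℝ R42) (U : Set M) (σ : M → R42) : Prop :=
  ContMDiffOn 𝓘(ℝ, Plane) 𝓘(ℝ, R42) ∞ σ U ∧ ∀ x ∈ U, σ x ∈ F x

/-- A (regular) Legendre map: a smooth map into the space of contact elements which satisfies
the contact condition and is an immersion. -/
structure IsLegendre (F : M → Submodule ℝ R42) : Prop where
  contactElement : ∀ x, IsContactElement (F x)
  smooth : ∀ x₀, ∃ U : Set M, IsOpen U ∧ x₀ ∈ U ∧ ∃ σ τ : M → R42,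
    IsSection F U σ ∧ IsSection F U τ ∧ ∀ x ∈ U, F x = Submodule.span ℝ {σ x, τ x}
  contact : ∀ U : Set M, IsOpen U → ∀ σ τ : M → R42, IsSection F U σ → IsSection F U τ →
    ∀ x ∈ U, ∀ X : TangentSpace 𝓘(ℝ, Plane) x, form (deriv1 σ x X) (τ x) = 0
  immersion : ∀ (x : M) (X : TangentSpace 𝓘(ℝ, Plane) x),
    (∀ U : Set M, IsOpen U → x ∈ U → ∀ σ : M → R42, IsSection F U σ → deriv1 σ x X ∈ F x) →
      X = 0

/-- `c` spans a curvature sphere of the Legendre map `F` at `x`: there is a tangent direction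
(a curvature direction) in which the derivative of sections through `c` stays in `F x`. -/
def IsCurvatureSphere (F : M → Submodule ℝ R42) (x : M) (c : R42) : Prop :=
  c ≠ 0 ∧ c ∈ F x ∧ ∃ X : TangentSpace 𝓘(ℝ, Plane) x, X ≠ 0 ∧
    ∀ U : Set M, IsOpen U → x ∈ U → ∀ σ : M → R42, IsSection F U σ → σ x = c →
      deriv1 σ x X ∈ F x

/-- The Legendre map `F` has two distinct curvature spheres at every point. -/
def UmbilicFree (F : M → Submodule ℝ R42) : Prop :=
  ∀ x, ∃ c₁ c₂ : R42, LinearIndependent ℝ ![c₁, c₂] ∧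
    IsCurvatureSphere F x c₁ ∧ IsCurvatureSphere F x c₂

/-- The spheres `Sp x` and `Sm x` separate the curvature spheres of `F` at `x` harmonically,
i.e. with cross ratio `-1` on the projective line `F x`. -/
def SeparateHarmonically (F Sp Sm : M → Submodule ℝ R42) : Prop :=
  ∀ x, ∃ c₁ c₂ : R42, LinearIndependent ℝ ![c₁, c₂] ∧
    IsCurvatureSphere F x c₁ ∧ IsCurvatureSphere F x c₂ ∧
    Sp x = Submodule.span ℝ {c₁ + c₂} ∧ Sm x = Submodule.span ℝ {c₁ - c₂}

/-- An isothermic sphere congruence: around each point there are coordinates `(u,v)` and a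
(Moutard) lift `s` into the light cone such that `(s_u, s_v) = 0`, the induced metric is
positive definite and `s_{uv}` is a multiple of `s`. -/
def IsIsothermic (S : M → Submodule ℝ R42) : Prop :=
  ∀ x₀ : M, ∃ ψ ∈ IsManifold.maximalAtlas 𝓘(ℝ, Plane) ∞ M, x₀ ∈ ψ.source ∧
    ∃ s : Plane → R42, ContDiffOn ℝ ∞ s ψ.target ∧ ∀ y ∈ ψ.target,
      s y ≠ 0 ∧ form (s y) (s y) = 0 ∧ S (ψ.symm y) = Submodule.span ℝ {s y} ∧
      form (pd 0 s y) (pd 1 s y) = 0 ∧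
      0 < form (pd 0 s y) (pd 0 s y) ∧ 0 < form (pd 1 s y) (pd 1 s y) ∧
      pd 0 (pd 1 s) y ∈ Submodule.span ℝ {s y}

/-- `F` is an Ω-surface with `Sp`, `Sm` as its pair of isothermic sphere congruences: `F` is a
Legendre map, it envelops the isothermic sphere congruences `Sp` and `Sm`, and these separate
its curvature spheres harmonically. -/
structure IsOmegaSurface (F Sp Sm : M → Submodule ℝ R42) : Prop where
  legendre : IsLegendre F
  enveloped_p : ∀ x, Sp x ≤ F x
  enveloped_m : ∀ x, Sm x ≤ F x
  isothermic_p : IsIsothermic Sp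
  isothermic_m : IsIsothermic Sm
  harmonic : SeparateHarmonically F Sp Sm

/-- `F` is an Ω-surface with pair of isothermic sphere congruences `Sp`, `Sm`, where `Sp` touches
the fixed sphere `Qp`, `Sm` touches the fixed sphere `Qm`, and `Qp`, `Qm` do not span a
contact element. -/
structure IsOmegaTouching (F Sp Sm : M → Submodule ℝ R42) (Qp Qm : Submodule ℝ R42) : Prop where
  omega : IsOmegaSurface F Sp Sm
  sphere_p : IsSphere Qp
  sphere_m : IsSphere Qm
  touch_p : ∀ x, Touch (Sp x) Qp
  touch_m : ∀ x, Touch (Sm x) Qm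
  not_touch : ¬ Touch Qp Qm

end Surface

/-! ### Hyperbolic spaces in Lie sphere geometry -/

/-- A hyperbolic space as a subgeometry of Lie sphere geometry: an orthonormal basis `(p, q)` of
a plane `ℝ^{1,1}` in `ℝ^{4,2}`, where `p` is the point sphere complex, `|p|² = -1`, together with
a unit timelike vector `o` of `ℝ^{3,1} = {p, q}^⊥` which singles out one of the two sheets of
`{y ∈ ℝ^{3,1} | |y|² = -1}`. -/
@[ext]
structure HyperbolicModel where
  p : R42
  q : R42
  o : R42
  pp : form p p = -1
  qq : form q q = 1
  pq : form p q = 0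
  op : form o p = 0
  oq : form o q = 0
  oo : form o o = -1

namespace HyperbolicModel

/-- The hyperbolic space `{y ∈ {p, q}^⊥ | |y|² = -1, y₀ > 0}`, where `y₀ = -(y, o)`. -/
def space (H : HyperbolicModel) : Set R42 :=
  {y | form y H.p = 0 ∧ form y H.q = 0 ∧ form y y = -1 ∧ form y H.o < 0}

/-- `Q` is the infinity sphere of the hyperbolic space, with one of its orientations: the point
spheres (spheres in `p^⊥`) on `Q` are exactly the points of the ideal boundary, i.e. the null
lines of `{p, q}^⊥`. -/
def IsInfinitySphere (H : HyperbolicModel) (Q : Submodule ℝ R42) : Prop :=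
  IsSphere Q ∧ ∀ v : R42, v ≠ 0 → form v v = 0 → form v H.p = 0 →
    (Touch (Submodule.span ℝ {v}) Q ↔ form v H.q = 0)

/-- `Qp` and `Qm` are the two orientations of the infinity sphere of the hyperbolic space. -/
def AreInfinitySpheres (H : HyperbolicModel) (Qp Qm : Submodule ℝ R42) : Prop :=
  Qp ≠ Qm ∧ ∀ Q, H.IsInfinitySphere Q ↔ Q = Qp ∨ Q = Qm

/-- Change of the point sphere complex which corresponds to passing to a parallel surface at
distance `a`: the null vectors `p ± q` are multiplied by `e^{± a}`. The hyperbolic space itself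
does not change. -/
def parallel (H : HyperbolicModel) (a : ℝ) : HyperbolicModel where
  p := Real.cosh a • H.p + Real.sinh a • H.q
  q := Real.sinh a • H.p + Real.cosh a • H.q
  o := H.o
  pp := by
    have h1 := H.pp; have h2 := H.qq; have h3 := H.pq; have h4 := Real.cosh_sq a
    simp only [form, Pi.add_apply, Pi.smul_apply, smul_eq_mul] at *
    linear_combination Real.cosh a ^ 2 * h1 + Real.sinh a ^ 2 * h2
      + 2 * Real.cosh a * Real.sinh a * h3 - h4
  qq := by
    have h1 := H.pp; have h2 := H.qq; have h3 := H.pq; have h4 := Real.cosh_sq a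
    simp only [form, Pi.add_apply, Pi.smul_apply, smul_eq_mul] at *
    linear_combination Real.sinh a ^ 2 * h1 + Real.cosh a ^ 2 * h2
      + 2 * Real.cosh a * Real.sinh a * h3 + h4
  pq := by
    have h1 := H.pp; have h2 := H.qq; have h3 := H.pq
    simp only [form, Pi.add_apply, Pi.smul_apply, smul_eq_mul] at *
    linear_combination Real.cosh a * Real.sinh a * h1 + Real.cosh a * Real.sinh a * h2
      + (Real.cosh a ^ 2 + Real.sinh a ^ 2) * h3
  op := by
    have h1 := H.op; have h2 := H.oq
    simp only [form, Pi.add_apply, Pi.smul_apply, smul_eq_mul] at *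
    linear_combination Real.cosh a * h1 + Real.sinh a * h2
  oq := by
    have h1 := H.op; have h2 := H.oq
    simp only [form, Pi.add_apply, Pi.smul_apply, smul_eq_mul] at *
    linear_combination Real.sinh a * h1 + Real.cosh a * h2
  oo := H.oo

end HyperbolicModel

/-! ### Flat fronts -/

section Fronts

variable {M : Type*} [TopologicalSpace M] [ChartedSpace Plane M]

/-- The parallel surface `cosh a f + sinh a t` at distance `a` of a surface `f` with unit normal
field `t` in a hyperbolic space. -/
def parallelFront (f t : M → R42) (a : ℝ) : M → R42 :=
  fun x => Real.cosh a • f x + Real.sinh a • t x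

/-- The unit normal field `sinh a f + cosh a t` of the parallel surface at distance `a`. -/
def parallelNormal (f t : M → R42) (a : ℝ) : M → R42 :=
  fun x => Real.sinh a • f x + Real.cosh a • t x

/-- `f` is a front in the hyperbolic space `H` with unit normal field `t`, that is, `(f, t)` is a
Legendre immersion into the unit tangent bundle of the hyperbolic space. -/
structure IsFront (H : HyperbolicModel) (f t : M → R42) : Prop where
  smooth_f : ContMDiff 𝓘(ℝ, Plane) 𝓘(ℝ, R42) ∞ f
  smooth_t : ContMDiff 𝓘(ℝ, Plane) 𝓘(ℝ, R42) ∞ t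
  mem_space : ∀ x, f x ∈ H.space
  t_p : ∀ x, form (t x) H.p = 0
  t_q : ∀ x, form (t x) H.q = 0
  t_t : ∀ x, form (t x) (t x) = 1
  t_f : ∀ x, form (t x) (f x) = 0
  normal : ∀ (x : M) (X : TangentSpace 𝓘(ℝ, Plane) x), form (deriv1 f x X) (t x) = 0
  immersion : ∀ (x : M) (X : TangentSpace 𝓘(ℝ, Plane) x),
    deriv1 f x X = 0 → deriv1 t x X = 0 → X = 0

/-- A flat front: a front such that around every point one of its parallel surfaces
is an immersion with vanishing Gauss curvature. -/
structure IsFlatFront (H : HyperbolicModel) (f t : M → R42) : Prop where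
  front : IsFront H f t
  flat : ∀ x, ∃ a : ℝ, ∀ᶠ y in 𝓝 x,
    Function.Injective (deriv1 (parallelFront f t a) y) ∧
      gaussCurvature (parallelFront f t a) y = 0

/-- The Legendre lift `span {q + f, p + t}` of a front. -/
def legendreLift (H : HyperbolicModel) (f t : M → R42) : M → Submodule ℝ R42 :=
  fun x => Submodule.span ℝ {H.q + f x, H.p + t x}

end Fronts

end LieSphere

end

open LieSphere

namespace LieSphere

/-! ### Linear algebra of the scalar product -/

/-! For a front put σ = (p+q)+(t+f) and ρ = (p-q)+(t-f). These null vectors span the contact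
element, σ ⟂ p+q, ρ ⟂ p-q, and (σ, p-q) = (ρ, p+q) = -2. The differentials of f and t take values in
the plane orthogonal to p, q, f, t. This plane is positive definite, so everything reduces to
two-dimensional linear algebra for dσ = dt + df and dρ = dt - df.

Flatness. By the Gauss equation K = -1 + det II / det I, so an immersed front is flat exactly when
df ∧ df = dt ∧ dt (`FlatAt`, `brioschi_eq_zero_iff`). This condition is invariant under passage to
parallel surfaces and makes sense where f is singular. A curvature sphere mσ + nρ belongs to a
direction X with m dσ(X) + n dρ(X) = 0. For two curvature spheres `FlatAt` becomes mn' + nm' = 0,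
which is the harmonic position with respect to σ and ρ (`exists_principal`, `flatAt_of_harmonic`).

From flat fronts to isothermic congruences. In an orthonormal principal frame dσ = k(α e₁ + β e₂)
and dρ = k⁻¹(-α e₁ + β e₂) with a single function k > 0. Then k⁻¹dσ - k dρ = 2α e₁ and k⁻¹dσ + k dρ
= 2β e₂, and a short computation shows that α and β are closed (`exists_closed_form`). Hence α = du
and β = dv for local coordinates (u,v). In these, s = k⁻¹σ and r = kρ have orthonormal partial
derivatives modulo s and r respectively, and s_uv is orthogonal to s, r, s_u, s_v and p+q, which
leaves only multiples of s (`moutard_of_orthonormal`). The same holds for r with p-q.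

From touching spheres to flat fronts. Normalize Q⁺ = ⟨a⟩ and Q⁻ = ⟨b⟩ with (a,b) = -2, and lifts σ,
ρ of S⁺, S⁻ with (σ,b) = (ρ,a) = -2. Then p, q, t, f are solved from a = p+q, b = p-q and the
formulas for σ and ρ; Legendre maps give fronts and harmonic separation gives flatness. The
difficulty is that (σ,b) must not vanish (`IsMoutardChart.form_ne_zero`). With respect to Moutard
coordinates of S⁺ the derivatives of the lifts satisfy r_i ≡ β_i s_i modulo F with β_v = -β_u ≠ 0.
As (r,b) = 0 identically, (s,b) satisfies a homogeneous first order equation in each coordinate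
direction, so a zero is a zero of the pure second derivatives as well. At such a zero r = λs + μb,
whence β_u = λ = β_v, a contradiction.

Uniqueness. The lines ⟨p±q⟩ determine p±q up to factors of product 1, that is, up to a hyperbolic
rotation and signs, and p, q and F determine f and t. -/

lemma form_comm (x y : R42) : form x y = form y x := by simp only [form]; ring

lemma form_add_left (x y z : R42) : form (x + y) z = form x z + form y z := by
  simp only [form, Pi.add_apply]; ring

lemma form_add_right (x y z : R42) : form x (y + z) = form x y + form x z := by
  simp only [form, Pi.add_apply]; ring

lemma form_smul_left (a : ℝ) (x y : R42) : form (a • x) y = a * form x y := by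
  simp only [form, Pi.smul_apply, smul_eq_mul]; ring

lemma form_smul_right (a : ℝ) (x y : R42) : form x (a • y) = a * form x y := by
  simp only [form, Pi.smul_apply, smul_eq_mul]; ring

lemma form_neg_left (x y : R42) : form (-x) y = -form x y := by
  simp only [form, Pi.neg_apply]; ring

lemma form_neg_right (x y : R42) : form x (-y) = -form x y := by
  simp only [form, Pi.neg_apply]; ring

lemma form_sub_left (x y z : R42) : form (x - y) z = form x z - form y z := by
  simp only [form, Pi.sub_apply]; ring

lemma form_sub_right (x y z : R42) : form x (y - z) = form x y - form x z := by
  simp only [form, Pi.sub_apply]; ring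

lemma form_zero_left (x : R42) : form 0 x = 0 := by simp [form]

lemma form_zero_right (x : R42) : form x 0 = 0 := by simp [form]

/-- Rules which expand the scalar product of linear combinations. -/
lemma form_expand :
    (∀ x y z, form (x + y) z = form x z + form y z) ∧
    (∀ x y z, form x (y + z) = form x y + form x z) ∧
    (∀ a x y, form (a • x) y = a * form x y) ∧ (∀ a x y, form x (a • y) = a * form x y) ∧
    (∀ x y, form (-x) y = -form x y) ∧ (∀ x y, form x (-y) = -form x y) ∧
    (∀ x y z, form (x - y) z = form x z - form y z) ∧
    (∀ x y z, form x (y - z) = form x y - form x z) ∧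
    (∀ x, form 0 x = 0) ∧ (∀ x, form x 0 = 0) :=
  ⟨form_add_left, form_add_right, form_smul_left, form_smul_right, form_neg_left,
    form_neg_right, form_sub_left, form_sub_right, form_zero_left, form_zero_right⟩

/-- The scalar product with a fixed vector as a linear form. -/
noncomputable def formCLM (y : R42) : R42 →L[ℝ] ℝ :=
  LinearMap.toContinuousLinearMap
    { toFun := fun x => form x y
      map_add' := fun a b => form_add_left a b y
      map_smul' := fun a b => form_smul_left a b y }

@[simp] lemma formCLM_apply (x y : R42) : formCLM y x = form x y := rfl

lemma eq_zero_of_form_eq_zero {x : R42} (h : ∀ y, form x y = 0) : x = 0 := by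
  funext i
  have hi := h (Pi.single i 1)
  fin_cases i <;> simpa [form, Pi.single_apply] using hi

/-- Three mutually orthogonal vectors of nonpositive norm are linearly dependent. -/
lemma exists_dependent_of_nonpos {x y z : R42} (hx : form x x ≤ 0) (hy : form y y ≤ 0)
    (hz : form z z ≤ 0) (hxy : form x y = 0) (hxz : form x z = 0) (hyz : form y z = 0) :
    ∃ a b c : ℝ, (a, b, c) ≠ 0 ∧ a • x + b • y + c • z = 0 := by
  -- Three vectors face only two negative coordinates, so a nontrivial combination has vanishing
  -- coordinates 4 and 5. Its norm is then a sum of squares, while orthogonality makes it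
  -- nonpositive, so the combination is zero.
  let T : (ℝ × ℝ × ℝ) →ₗ[ℝ] (ℝ × ℝ) :=
    { toFun := fun w => (w.1 * x 4 + w.2.1 * y 4 + w.2.2 * z 4,
        w.1 * x 5 + w.2.1 * y 5 + w.2.2 * z 5)
      map_add' := fun u v => by ext <;> simp <;> ring
      map_smul' := fun u v => by ext <;> simp <;> ring }
  have hT : LinearMap.ker T ≠ ⊥ := by
    apply LinearMap.ker_ne_bot_of_finrank_lt
    simp
  obtain ⟨⟨a, b, c⟩, hk, h0⟩ := (Submodule.ne_bot_iff _).1 hT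
  refine ⟨a, b, c, h0, ?_⟩
  have hk' : (a * x 4 + b * y 4 + c * z 4 = 0) ∧ (a * x 5 + b * y 5 + c * z 5 = 0) := by
    simpa [T] using hk
  set w : R42 := a • x + b • y + c • z with hw
  have h4 : w 4 = 0 := by simpa [hw] using hk'.1
  have h5 : w 5 = 0 := by simpa [hw] using hk'.2
  have hn : form w w ≤ 0 := by
    have : form w w = a ^ 2 * form x x + b ^ 2 * form y y + c ^ 2 * form z z := by
      have h1 := form_comm y x; have h2 := form_comm z x; have h3 := form_comm z y
      simp only [hw, form_expand, hxy, hxz, hyz, h1, h2, h3]; ring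
    rw [this]
    have := mul_nonpos_of_nonneg_of_nonpos (sq_nonneg a) hx
    have := mul_nonpos_of_nonneg_of_nonpos (sq_nonneg b) hy
    have := mul_nonpos_of_nonneg_of_nonpos (sq_nonneg c) hz
    linarith
  simp only [form, h4, h5] at hn
  have e0 : w 0 = 0 := by nlinarith [sq_nonneg (w 0), sq_nonneg (w 1), sq_nonneg (w 2), sq_nonneg (w 3)]
  have e1 : w 1 = 0 := by nlinarith [sq_nonneg (w 0), sq_nonneg (w 1), sq_nonneg (w 2), sq_nonneg (w 3)]
  have e2 : w 2 = 0 := by nlinarith [sq_nonneg (w 0), sq_nonneg (w 1), sq_nonneg (w 2), sq_nonneg (w 3)]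
  have e3 : w 3 = 0 := by nlinarith [sq_nonneg (w 0), sq_nonneg (w 1), sq_nonneg (w 2), sq_nonneg (w 3)]
  funext i
  fin_cases i <;> assumption

/-- The orthogonal complement of two orthogonal timelike unit vectors is positive definite. -/
lemma form_pos_of_orthogonal {p o w : R42} (hp : form p p = -1) (ho : form o o = -1)
    (hpo : form p o = 0) (hwp : form w p = 0) (hwo : form w o = 0) (hw : w ≠ 0) :
    0 < form w w := by
  by_contra! h
  obtain ⟨a, b, c, h0, hd⟩ := exists_dependent_of_nonpos (by rw [hp]; norm_num)
    (by rw [ho]; norm_num) h hpo (by rw [form_comm, hwp]) (by rw [form_comm, hwo])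
  have ha : a = 0 := by
    have := congrArg (form · p) hd
    simp only [form_expand, hp, hwp, form_comm o p, hpo] at this
    linarith
  have hb : b = 0 := by
    have := congrArg (form · o) hd
    simp only [form_expand, ho, hwo, hpo] at this
    linarith
  subst ha hb
  have hc : c ≠ 0 := by rintro rfl; exact h0 rfl
  simp [hc, hw] at hd

/-- Orthogonal null vectors in the orthogonal complement of a timelike unit vector
are proportional. -/
lemma exists_smul_eq_of_null {p s z : R42} (hp : form p p = -1) (hs : form s s = 0)
    (hz : form z z = 0) (hsz : form s z = 0) (hsp : form s p = 0) (hzp : form z p = 0)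
    (h0 : s ≠ 0) : ∃ a : ℝ, z = a • s := by
  obtain ⟨a, b, c, hn, hd⟩ := exists_dependent_of_nonpos (x := p) (by rw [hp]; norm_num)
    hs.le hz.le (by rw [form_comm, hsp]) (by rw [form_comm, hzp]) hsz
  have ha : a = 0 := by
    have := congrArg (form · p) hd
    simp only [form_expand, hp, hsp, hzp] at this
    linarith
  subst ha
  have hc : c ≠ 0 := by
    rintro rfl
    have hb : b ≠ 0 := by rintro rfl; exact hn rfl
    simp [hb, h0] at hd
  refine ⟨-b / c, ?_⟩
  have : c • z = -(b • s) := by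
    rw [eq_neg_iff_add_eq_zero, add_comm]; simpa using hd
  calc z = c⁻¹ • (c • z) := by rw [smul_smul, inv_mul_cancel₀ hc, one_smul]
    _ = (-b / c) • s := by rw [this, smul_neg, smul_smul, ← neg_smul]; congr 1; ring

lemma exists_ne_zero_orthogonal {n : ℕ} (hn : n < 6) (b : Fin n → R42) :
    ∃ w : R42, w ≠ 0 ∧ ∀ i, form w (b i) = 0 := by
  let T : R42 →ₗ[ℝ] (Fin n → ℝ) := LinearMap.pi fun i => (formCLM (b i) : R42 →ₗ[ℝ] ℝ)
  have hT : LinearMap.ker T ≠ ⊥ := by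
    apply LinearMap.ker_ne_bot_of_finrank_lt
    simpa using hn
  obtain ⟨w, hk, h0⟩ := (Submodule.ne_bot_iff _).1 hT
  exact ⟨w, h0, fun i => congrFun (show T w = 0 from hk) i⟩

lemma form_inv_sqrt_smul {w : R42} (h : 0 < form w w) :
    form ((√(form w w))⁻¹ • w) ((√(form w w))⁻¹ • w) = 1 := by
  rw [form_smul_left, form_smul_right, ← mul_assoc, ← mul_inv, Real.mul_self_sqrt h.le,
    inv_mul_cancel₀ h.ne']

/-! ### Orthonormal tetrads and frames of their normal plane -/

/-- `p, q, f, t` are orthonormal of signature `(-,+,-,+)`. -/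
structure IsTetrad (p q f t : R42) : Prop where
  pp : form p p = -1
  qq : form q q = 1
  ff : form f f = -1
  tt : form t t = 1
  pq : form p q = 0
  fp : form f p = 0
  fq : form f q = 0
  tp : form t p = 0
  tq : form t q = 0
  tf : form t f = 0

/-- `w` is orthogonal to `p, q, f, t`. -/
structure IsNormalTo (p q f t w : R42) : Prop where
  p : form w p = 0
  q : form w q = 0
  f : form w f = 0
  t : form w t = 0

namespace IsNormalTo

variable {p q f t w w' : R42}

lemma add (h : IsNormalTo p q f t w) (h' : IsNormalTo p q f t w') :
    IsNormalTo p q f t (w + w') := by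
  constructor <;> simp [form_expand, h.p, h.q, h.f, h.t, h'.p, h'.q, h'.f, h'.t]

lemma smul (h : IsNormalTo p q f t w) (a : ℝ) : IsNormalTo p q f t (a • w) := by
  constructor <;> simp [form_expand, h.p, h.q, h.f, h.t]

lemma neg (h : IsNormalTo p q f t w) : IsNormalTo p q f t (-w) := by
  constructor <;> simp [form_expand, h.p, h.q, h.f, h.t]

lemma sub (h : IsNormalTo p q f t w) (h' : IsNormalTo p q f t w') :
    IsNormalTo p q f t (w - w') := by
  constructor <;> simp [form_expand, h.p, h.q, h.f, h.t, h'.p, h'.q, h'.f, h'.t]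

lemma pos (h : IsNormalTo p q f t w) (hT : IsTetrad p q f t) (hw : w ≠ 0) : 0 < form w w :=
  form_pos_of_orthogonal hT.pp hT.ff (by rw [form_comm, hT.fp]) h.p h.f hw

end IsNormalTo

/-- `e₁, e₂` are orthonormal vectors in the orthogonal complement of `p, q, f, t`. -/
structure IsFrame (p q f t e₁ e₂ : R42) : Prop where
  normal₁ : IsNormalTo p q f t e₁
  normal₂ : IsNormalTo p q f t e₂
  norm₁ : form e₁ e₁ = 1
  norm₂ : form e₂ e₂ = 1
  orth : form e₁ e₂ = 0

lemma IsTetrad.exists_frame {p q f t : R42} (h : IsTetrad p q f t) :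
    ∃ e₁ e₂, IsFrame p q f t e₁ e₂ := by
  obtain ⟨v, hv, hv'⟩ := exists_ne_zero_orthogonal (by norm_num) ![p, q, f, t]
  have nv : IsNormalTo p q f t v := ⟨hv' 0, hv' 1, hv' 2, hv' 3⟩
  obtain ⟨w, hw, hw'⟩ := exists_ne_zero_orthogonal (by norm_num) ![p, q, f, t, v]
  have nw : IsNormalTo p q f t w := ⟨hw' 0, hw' 1, hw' 2, hw' 3⟩
  have hwv : form w v = 0 := hw' 4
  refine ⟨_, _, nv.smul (√(form v v))⁻¹, nw.smul (√(form w w))⁻¹,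
    form_inv_sqrt_smul (nv.pos h hv), form_inv_sqrt_smul (nw.pos h hw), ?_⟩
  simp [form_expand, form_comm v w, hwv]

/-- Vectors orthogonal to an orthonormal basis vanish. -/
lemma IsFrame.eq_zero {p q f t e₁ e₂ w : R42} (he : IsFrame p q f t e₁ e₂)
    (h : IsTetrad p q f t) (hw : IsNormalTo p q f t w) (h1 : form w e₁ = 0)
    (h2 : form w e₂ = 0) : w = 0 := by
  let b : Fin 6 → R42 := ![p, q, f, t, e₁, e₂]
  have hb : LinearIndependent ℝ b := by
    rw [Fintype.linearIndependent_iff]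
    intro g hg
    have key : ∀ z, ∑ i, g i * form (b i) z = 0 := by
      intro z
      have := congrArg (fun u => formCLM z u) hg
      simpa [form_zero_left] using this
    have n1 := he.normal₁; have n2 := he.normal₂
    have e0 := key p; have e1 := key q; have e2 := key f; have e3 := key t
    have e4 := key e₁; have e5 := key e₂
    simp only [Fin.sum_univ_six, b, Matrix.cons_val, h.pp, h.qq, h.ff, h.tt, h.pq, h.fp, h.fq,
      h.tp, h.tq, h.tf, n1.p, n1.q, n1.f, n1.t, n2.p, n2.q, n2.f, n2.t, he.norm₁, he.norm₂,
      he.orth, form_comm q p, form_comm p f, form_comm q f, form_comm p t, form_comm q t,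
      form_comm f t, form_comm p e₁, form_comm q e₁, form_comm f e₁, form_comm t e₁,
      form_comm p e₂, form_comm q e₂, form_comm f e₂, form_comm t e₂, form_comm e₂ e₁]
      at e0 e1 e2 e3 e4 e5
    intro i
    fin_cases i <;> simp only [Fin.zero_eta, Fin.mk_one, Fin.reduceFinMk] <;> linarith
  have htop := hb.span_eq_top_of_card_eq_finrank (by simp)
  have hle : Submodule.span ℝ (Set.range b) ≤ LinearMap.ker (formCLM w : R42 →ₗ[ℝ] ℝ) := by
    rw [Submodule.span_le]
    rintro _ ⟨i, rfl⟩
    have n1 := hw.p; have n2 := hw.q; have n3 := hw.f; have n4 := hw.t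
    rw [form_comm] at n1 n2 n3 n4 h1 h2
    fin_cases i <;> simp [b, *]
  apply eq_zero_of_form_eq_zero
  intro y
  have : y ∈ LinearMap.ker (formCLM w : R42 →ₗ[ℝ] ℝ) := hle (htop ▸ Submodule.mem_top)
  rw [form_comm]; simpa using this

lemma IsFrame.expand {p q f t e₁ e₂ w : R42} (he : IsFrame p q f t e₁ e₂)
    (h : IsTetrad p q f t) (hw : IsNormalTo p q f t w) :
    w = form w e₁ • e₁ + form w e₂ • e₂ := by
  rw [← sub_eq_zero]
  apply he.eq_zero h (hw.sub ((he.normal₁.smul _).add (he.normal₂.smul _)))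
  · simp [form_expand, he.norm₁, form_comm e₂ e₁, he.orth]
  · simp [form_expand, he.norm₂, he.orth]

lemma IsFrame.expand_full {p q f t e₁ e₂ : R42} (he : IsFrame p q f t e₁ e₂)
    (h : IsTetrad p q f t) (w : R42) :
    w = (-form w p) • p + form w q • q + (-form w f) • f + form w t • t
      + form w e₁ • e₁ + form w e₂ • e₂ := by
  rw [← sub_eq_zero]
  have n1 := he.normal₁; have n2 := he.normal₂
  refine he.eq_zero h ⟨?_, ?_, ?_, ?_⟩ ?_ ?_ <;>
  simp only [form_expand, h.pp, h.qq, h.ff, h.tt, h.pq, h.fp, h.fq,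
      h.tp, h.tq, h.tf, n1.p, n1.q, n1.f, n1.t, n2.p, n2.q, n2.f, n2.t, he.norm₁, he.norm₂,
      he.orth, form_comm q p, form_comm p f, form_comm q f, form_comm p t, form_comm q t,
      form_comm f t, form_comm p e₁, form_comm q e₁, form_comm f e₁, form_comm t e₁,
      form_comm p e₂, form_comm q e₂, form_comm f e₂, form_comm t e₂, form_comm e₂ e₁] <;> ring

/-- Pairing of the bivector `a ∧ b` with `z ∧ w`. -/
noncomputable def wedge (a b z w : R42) : ℝ := form a z * form b w - form a w * form b z

lemma IsFrame.form_eq {p q f t e₁ e₂ a b : R42} (he : IsFrame p q f t e₁ e₂)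
    (h : IsTetrad p q f t) (ha : IsNormalTo p q f t a) :
    form a b = form a e₁ * form b e₁ + form a e₂ * form b e₂ := by
  conv_lhs => rw [he.expand h ha]
  simp only [form_expand, form_comm e₁ b, form_comm e₂ b]

/-- The normal space of a tetrad is a plane, so its bivectors form a line spanned by e₁ ∧ e₂.
Equality of normal bivectors thereby becomes equality of two numbers. -/
lemma IsFrame.wedge_eq {p q f t e₁ e₂ a b : R42} (he : IsFrame p q f t e₁ e₂)
    (h : IsTetrad p q f t) (ha : IsNormalTo p q f t a) (hb : IsNormalTo p q f t b) (z w : R42) :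
    wedge a b z w = wedge a b e₁ e₂ * wedge e₁ e₂ z w := by
  simp only [wedge, he.form_eq h ha (b := z), he.form_eq h ha (b := w), he.form_eq h hb (b := z),
    he.form_eq h hb (b := w), form_comm z e₁, form_comm z e₂, form_comm w e₁, form_comm w e₂]
  ring


/-! ### Partial derivatives in the plane -/

section PartialDerivatives

variable {W : Type*} [NormedAddCommGroup W] [NormedSpace ℝ W]

lemma fderiv_eq_pd (g : Plane → W) (y e : Plane) :
    fderiv ℝ g y e = e 0 • pd 0 g y + e 1 • pd 1 g y := by
  have he : e = e 0 • EuclideanSpace.single (0 : Fin 2) (1 : ℝ)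
      + e 1 • EuclideanSpace.single (1 : Fin 2) (1 : ℝ) := by
    ext i; fin_cases i <;> simp
  conv_lhs => rw [he, map_add, map_smul, map_smul]
  rfl

lemma pd_congr {g h : Plane → W} {y : Plane} (hgh : g =ᶠ[𝓝 y] h) (i : Fin 2) :
    pd i g y = pd i h y := by
  rw [pd, pd, hgh.fderiv_eq]

lemma pd_congr_of_eqOn {g h : Plane → W} {U : Set Plane} (hU : IsOpen U) (hgh : EqOn g h U)
    {y : Plane} (hy : y ∈ U) (i : Fin 2) : pd i g y = pd i h y :=
  pd_congr (hgh.eventuallyEq_of_mem (hU.mem_nhds hy)) i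

lemma pd_eq_zero_of_const {g : Plane → W} {c : W} {U : Set Plane} (hU : IsOpen U)
    (hg : ∀ z ∈ U, g z = c) {y : Plane} (hy : y ∈ U) (i : Fin 2) : pd i g y = 0 := by
  rw [pd_congr_of_eqOn (h := fun _ => c) hU hg hy]; simp [pd]

lemma contDiffOn_pd {g : Plane → W} {U : Set Plane} (hU : IsOpen U) (hg : ContDiffOn ℝ ∞ g U)
    (i : Fin 2) : ContDiffOn ℝ ∞ (pd i g) U :=
  (hg.fderiv_of_isOpen hU (m := ∞) (by simp)).clm_apply contDiffOn_const

lemma pd_comm {g : Plane → W} {y : Plane} (hg : ContDiffAt ℝ ∞ g y) (i j : Fin 2) :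
    pd i (pd j g) y = pd j (pd i g) y := by
  have hs : IsSymmSndFDerivAt ℝ g y := hg.isSymmSndFDerivAt (by simpa using (ENat.LEInfty.out : (2 : WithTop ℕ∞) ≤ ∞))
  have hd : DifferentiableAt ℝ (fderiv ℝ g) y :=
    (hg.fderiv_right (m := 1) (by norm_cast)).differentiableAt (by simp)
  have key : ∀ i j : Fin 2, pd i (pd j g) y
      = fderiv ℝ (fderiv ℝ g) y (EuclideanSpace.single i 1) (EuclideanSpace.single j 1) := by
    intro i j
    unfold pd
    rw [fderiv_clm_apply hd (differentiableAt_const _)]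
    simp
  rw [key, key, hs.eq]

lemma pd_add {g h : Plane → W} {y : Plane} (hg : DifferentiableAt ℝ g y)
    (hh : DifferentiableAt ℝ h y) (i : Fin 2) :
    pd i (fun z => g z + h z) y = pd i g y + pd i h y := by
  rw [pd, fderiv_fun_add hg hh]; rfl

lemma pd_sub {g h : Plane → W} {y : Plane} (hg : DifferentiableAt ℝ g y)
    (hh : DifferentiableAt ℝ h y) (i : Fin 2) :
    pd i (fun z => g z - h z) y = pd i g y - pd i h y := by
  rw [pd, fderiv_fun_sub hg hh]; rfl

lemma pd_smul {k : Plane → ℝ} {g : Plane → W} {y : Plane} (hk : DifferentiableAt ℝ k y)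
    (hg : DifferentiableAt ℝ g y) (i : Fin 2) :
    pd i (fun z => k z • g z) y = pd i k y • g y + k y • pd i g y := by
  rw [pd, fderiv_fun_smul hk hg]; simp [pd, add_comm]

lemma pd_mul {k l : Plane → ℝ} {y : Plane} (hk : DifferentiableAt ℝ k y)
    (hl : DifferentiableAt ℝ l y) (i : Fin 2) :
    pd i (fun z => k z * l z) y = pd i k y * l y + k y * pd i l y :=
  pd_smul hk hl i

end PartialDerivatives

/-! ### Differentiating scalar products -/

/-- The scalar product as a continuous bilinear map. -/
noncomputable def formBilin : R42 →L[ℝ] R42 →L[ℝ] ℝ :=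
  LinearMap.toContinuousLinearMap
    { toFun := fun x => formCLM x
      map_add' := fun a b => by ext z : 1; simp [form_add_right]
      map_smul' := fun a b => by ext z : 1; simp [form_smul_right] }

@[simp] lemma formBilin_apply (x y : R42) : formBilin x y = form y x := rfl

lemma contDiffOn_form {E : Type*} [NormedAddCommGroup E] [NormedSpace ℝ E] {n : WithTop ℕ∞}
    {g h : E → R42} {U : Set E} (hg : ContDiffOn ℝ n g U) (hh : ContDiffOn ℝ n h U) :
    ContDiffOn ℝ n (fun z => form (g z) (h z)) U :=
  ((formBilin.contDiff.comp_contDiffOn hh).clm_apply hg)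

lemma differentiableAt_form {E : Type*} [NormedAddCommGroup E] [NormedSpace ℝ E]
    {g h : E → R42} {y : E} (hg : DifferentiableAt ℝ g y) (hh : DifferentiableAt ℝ h y) :
    DifferentiableAt ℝ (fun z => form (g z) (h z)) y :=
  ((formBilin.differentiableAt.comp y hh).clm_apply hg)

lemma fderiv_form {E : Type*} [NormedAddCommGroup E] [NormedSpace ℝ E] {g h : E → R42} {y : E}
    (hg : DifferentiableAt ℝ g y) (hh : DifferentiableAt ℝ h y) (e : E) :
    fderiv ℝ (fun z => form (g z) (h z)) y e
      = form (fderiv ℝ g y e) (h y) + form (g y) (fderiv ℝ h y e) := by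
  have : (fun z => form (g z) (h z)) = fun z => (formBilin (h z)) (g z) := rfl
  have h1 : DifferentiableAt ℝ (fun z => formBilin (h z)) y := formBilin.differentiableAt.comp y hh
  rw [this, fderiv_clm_apply h1 hg]
  have h2 : fderiv ℝ (fun z => formBilin (h z)) y = formBilin.comp (fderiv ℝ h y) :=
    (formBilin.hasFDerivAt.comp y hh.hasFDerivAt).fderiv
  simp [h2]

lemma pd_form {g h : Plane → R42} {y : Plane} (hg : DifferentiableAt ℝ g y)
    (hh : DifferentiableAt ℝ h y) (i : Fin 2) :
    pd i (fun z => form (g z) (h z)) y = form (pd i g y) (h y) + form (g y) (pd i h y) :=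
  fderiv_form hg hh _

/-- Derivative of a scalar product which is constant on an open set. -/
lemma form_pd_eq_neg {g h : Plane → R42} {U : Set Plane} {c : ℝ} (hU : IsOpen U)
    (hg : ContDiffOn ℝ ∞ g U) (hh : ContDiffOn ℝ ∞ h U) (hc : ∀ z ∈ U, form (g z) (h z) = c)
    {y : Plane} (hy : y ∈ U) (i : Fin 2) : form (pd i g y) (h y) = -form (g y) (pd i h y) := by
  have := pd_form ((hg.contDiffAt (hU.mem_nhds hy)).differentiableAt (by simp))
    ((hh.contDiffAt (hU.mem_nhds hy)).differentiableAt (by simp)) i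
  rw [pd_eq_zero_of_const hU hc hy] at this
  linarith

lemma form_pd_self {g : Plane → R42} {U : Set Plane} {c : ℝ} (hU : IsOpen U)
    (hg : ContDiffOn ℝ ∞ g U) (hc : ∀ z ∈ U, form (g z) (g z) = c)
    {y : Plane} (hy : y ∈ U) (i : Fin 2) : form (pd i g y) (g y) = 0 := by
  have h1 := form_pd_eq_neg hU hg hg hc hy i
  rw [form_comm (g y)] at h1
  linarith

lemma form_pd_const {g : Plane → R42} {w : R42} {U : Set Plane} {c : ℝ} (hU : IsOpen U)
    (hg : ContDiffOn ℝ ∞ g U) (hc : ∀ z ∈ U, form (g z) w = c)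
    {y : Plane} (hy : y ∈ U) (i : Fin 2) : form (pd i g y) w = 0 := by
  rw [form_pd_eq_neg hU hg (h := fun _ => w) contDiffOn_const hc hy]
  simp [pd, form_zero_right]

/-! ### Derivatives on the surface in charts -/

section Chart

variable {M : Type*} [TopologicalSpace M] [ChartedSpace Plane M]

/-- The tangent map of a chart inverse. -/
noncomputable def chartVec (ψ : OpenPartialHomeomorph M Plane) (y : Plane) :
    Plane →L[ℝ] TangentSpace 𝓘(ℝ, Plane) (ψ.symm y) :=
  mfderiv 𝓘(ℝ, Plane) 𝓘(ℝ, Plane) ψ.symm y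

variable {ψ : OpenPartialHomeomorph M Plane}

lemma mdifferentiable_of_mem_maximalAtlas
    (hψ : ψ ∈ IsManifold.maximalAtlas 𝓘(ℝ, Plane) ∞ M) :
    ψ.MDifferentiable 𝓘(ℝ, Plane) 𝓘(ℝ, Plane) :=
  ⟨(contMDiffOn_of_mem_maximalAtlas hψ).mdifferentiableOn (by simp),
    (contMDiffOn_symm_of_mem_maximalAtlas hψ).mdifferentiableOn (by simp)⟩

lemma chartVec_bijective (hψ : ψ ∈ IsManifold.maximalAtlas 𝓘(ℝ, Plane) ∞ M) {y : Plane}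
    (hy : y ∈ ψ.target) : Function.Bijective (chartVec ψ y) :=
  (mdifferentiable_of_mem_maximalAtlas hψ).symm.mfderiv_bijective hy

lemma fderiv_comp_symm (hψ : ψ ∈ IsManifold.maximalAtlas 𝓘(ℝ, Plane) ∞ M) {y : Plane}
    (hy : y ∈ ψ.target) {g : M → R42}
    (hg : MDifferentiableAt 𝓘(ℝ, Plane) 𝓘(ℝ, R42) g (ψ.symm y)) (e : Plane) :
    fderiv ℝ (g ∘ ψ.symm) y e = deriv1 g (ψ.symm y) (chartVec ψ y e) := by
  rw [← mfderiv_eq_fderiv, mfderiv_comp y hg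
    ((mdifferentiable_of_mem_maximalAtlas hψ).mdifferentiableAt_symm hy)]
  rfl

lemma contDiffOn_comp_symm (hψ : ψ ∈ IsManifold.maximalAtlas 𝓘(ℝ, Plane) ∞ M)
    {g : M → R42} {U : Set M} (hg : ContMDiffOn 𝓘(ℝ, Plane) 𝓘(ℝ, R42) ∞ g U) :
    ContDiffOn ℝ ∞ (g ∘ ψ.symm) (ψ.target ∩ ψ.symm ⁻¹' U) :=
  (hg.comp ((contMDiffOn_symm_of_mem_maximalAtlas hψ).mono inter_subset_left)
    fun _ hy => hy.2).contDiffOn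

lemma contMDiffOn_comp_chart (hψ : ψ ∈ IsManifold.maximalAtlas 𝓘(ℝ, Plane) ∞ M)
    {s : Plane → R42} {T : Set Plane} (hs : ContDiffOn ℝ ∞ s T) :
    ContMDiffOn 𝓘(ℝ, Plane) 𝓘(ℝ, R42) ∞ (s ∘ ψ) (ψ.source ∩ ψ ⁻¹' T) :=
  hs.contMDiffOn.comp ((contMDiffOn_of_mem_maximalAtlas hψ).mono inter_subset_left)
    fun _ hy => hy.2

/-- The tangent vector with components `e` of the lift `s` in a chart. -/
lemma deriv1_comp_chart (hψ : ψ ∈ IsManifold.maximalAtlas 𝓘(ℝ, Plane) ∞ M)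
    {s : Plane → R42} {T : Set Plane} (hT : IsOpen T) (hs : ContDiffOn ℝ ∞ s T) {y : Plane}
    (hy : y ∈ ψ.target) (hyT : y ∈ T) (e : Plane) :
    deriv1 (s ∘ ψ) (ψ.symm y) (chartVec ψ y e) = fderiv ℝ s y e := by
  have h1 : MDifferentiableAt 𝓘(ℝ, Plane) 𝓘(ℝ, R42) (s ∘ ψ) (ψ.symm y) := by
    have := (contMDiffOn_comp_chart hψ hs).mdifferentiableOn (n := ∞) (by simp)
    refine this.mdifferentiableAt ((ψ.isOpen_inter_preimage hT).mem_nhds ⟨ψ.map_target hy, ?_⟩)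
    simpa [ψ.right_inv hy] using hyT
  rw [← fderiv_comp_symm hψ hy h1]
  congr 1
  apply Filter.EventuallyEq.fderiv_eq
  filter_upwards [ψ.open_target.mem_nhds hy] with z hz
  simp [ψ.right_inv hz]

lemma mdifferentiableAt_of_contMDiffOn {g : M → R42} {U : Set M} (hU : IsOpen U)
    (hg : ContMDiffOn 𝓘(ℝ, Plane) 𝓘(ℝ, R42) ∞ g U) {x : M} (hx : x ∈ U) :
    MDifferentiableAt 𝓘(ℝ, Plane) 𝓘(ℝ, R42) g x :=
  (hg.mdifferentiableOn (by simp)).mdifferentiableAt (hU.mem_nhds hx)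

lemma deriv1_add {g h : M → R42} {x : M} (hg : MDifferentiableAt 𝓘(ℝ, Plane) 𝓘(ℝ, R42) g x)
    (hh : MDifferentiableAt 𝓘(ℝ, Plane) 𝓘(ℝ, R42) h x) (X : TangentSpace 𝓘(ℝ, Plane) x) :
    deriv1 (fun z => g z + h z) x X = deriv1 g x X + deriv1 h x X := by
  have := (hg.hasMFDerivAt.add hh.hasMFDerivAt).mfderiv
  exact congrArg (fun L => L X) this

lemma deriv1_const_smul {g : M → R42} {x : M}
    (hg : MDifferentiableAt 𝓘(ℝ, Plane) 𝓘(ℝ, R42) g x) (a : ℝ)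
    (X : TangentSpace 𝓘(ℝ, Plane) x) :
    deriv1 (fun z => a • g z) x X = a • deriv1 g x X := by
  have := (hg.hasMFDerivAt.const_smul a).mfderiv
  exact congrArg (fun L => L X) this

lemma deriv1_linearComb {g h : M → R42} {x : M}
    (hg : MDifferentiableAt 𝓘(ℝ, Plane) 𝓘(ℝ, R42) g x)
    (hh : MDifferentiableAt 𝓘(ℝ, Plane) 𝓘(ℝ, R42) h x) (a b : ℝ)
    (X : TangentSpace 𝓘(ℝ, Plane) x) :
    deriv1 (fun z => a • g z + b • h z) x X = a • deriv1 g x X + b • deriv1 h x X := by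
  rw [← deriv1_const_smul hg, ← deriv1_const_smul hh]
  exact deriv1_add (hg.const_smul a) (hh.const_smul b) X

lemma deriv1_const (c : R42) (x : M) (X : TangentSpace 𝓘(ℝ, Plane) x) :
    deriv1 (fun _ => c) x X = 0 := by
  rw [deriv1, mfderiv_const]; rfl

lemma deriv1_const_add {g : M → R42} {x : M}
    (hg : MDifferentiableAt 𝓘(ℝ, Plane) 𝓘(ℝ, R42) g x) (c : R42)
    (X : TangentSpace 𝓘(ℝ, Plane) x) :
    deriv1 (fun z => c + g z) x X = deriv1 g x X := by
  rw [deriv1_add (g := fun _ => c) mdifferentiableAt_const hg, deriv1_const, zero_add]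

variable [IsManifold 𝓘(ℝ, Plane) ∞ M]

/-- Product rule on the surface for a scalar product of constant value. -/
lemma form_deriv1_eq_neg {g h : M → R42} {U : Set M} {c : ℝ} {x : M} (hU : U ∈ 𝓝 x)
    (hg : MDifferentiableAt 𝓘(ℝ, Plane) 𝓘(ℝ, R42) g x)
    (hh : MDifferentiableAt 𝓘(ℝ, Plane) 𝓘(ℝ, R42) h x) (hc : ∀ z ∈ U, form (g z) (h z) = c)
    (X : TangentSpace 𝓘(ℝ, Plane) x) :
    form (deriv1 g x X) (h x) = -form (g x) (deriv1 h x X) := by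
  have hψ := IsManifold.chart_mem_maximalAtlas (I := 𝓘(ℝ, Plane)) (n := ∞) (M := M) x
  obtain ⟨ψ, hψ', hx⟩ : ∃ ψ ∈ IsManifold.maximalAtlas 𝓘(ℝ, Plane) ∞ M, x ∈ ψ.source :=
    ⟨_, hψ, mem_chart_source _ _⟩
  obtain ⟨y, hy, rfl⟩ : ∃ y ∈ ψ.target, x = ψ.symm y := ⟨ψ x, ψ.map_source hx, (ψ.left_inv hx).symm⟩
  obtain ⟨e, rfl⟩ := (chartVec_bijective hψ' hy).2 X
  rw [← fderiv_comp_symm hψ' hy hg, ← fderiv_comp_symm hψ' hy hh]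
  have hs := (mdifferentiable_of_mem_maximalAtlas hψ').mdifferentiableAt_symm hy
  have h1 := fderiv_form (mdifferentiableAt_iff_differentiableAt.1 (hg.comp y hs))
    (mdifferentiableAt_iff_differentiableAt.1 (hh.comp y hs)) e
  have h2 : (fun z => form ((g ∘ ψ.symm) z) ((h ∘ ψ.symm) z)) =ᶠ[𝓝 y] fun _ => c := by
    filter_upwards [(ψ.continuousAt_symm hy).preimage_mem_nhds hU] with z hz
    exact hc _ hz
  rw [h2.fderiv_eq] at h1
  simp only [Function.comp_apply, fderiv_fun_const, Pi.zero_apply,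
    zero_apply] at h1
  linarith

lemma form_deriv1_self {g : M → R42} {U : Set M} {c : ℝ} {x : M} (hU : U ∈ 𝓝 x)
    (hg : MDifferentiableAt 𝓘(ℝ, Plane) 𝓘(ℝ, R42) g x) (hc : ∀ z ∈ U, form (g z) (g z) = c)
    (X : TangentSpace 𝓘(ℝ, Plane) x) : form (deriv1 g x X) (g x) = 0 := by
  have h1 := form_deriv1_eq_neg hU hg hg hc X
  rw [form_comm (g x)] at h1
  linarith

lemma form_deriv1_const {g : M → R42} {w : R42} {U : Set M} {c : ℝ} {x : M} (hU : U ∈ 𝓝 x)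
    (hg : MDifferentiableAt 𝓘(ℝ, Plane) 𝓘(ℝ, R42) g x) (hc : ∀ z ∈ U, form (g z) w = c)
    (X : TangentSpace 𝓘(ℝ, Plane) x) : form (deriv1 g x X) w = 0 := by
  have := form_deriv1_eq_neg (h := fun _ => w) hU hg mdifferentiableAt_const hc X
  rwa [deriv1_const, form_zero_right, neg_zero] at this

end Chart


/-! ### Expansions in a full orthonormal basis -/

lemma wedge_comm (a b z w : R42) : wedge a b z w = wedge z w a b := by
  simp only [wedge, form_comm z, form_comm w]; ring

lemma IsFrame.form_eq_full {p q f t e₁ e₂ : R42} (he : IsFrame p q f t e₁ e₂)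
    (h : IsTetrad p q f t) (a b : R42) :
    form a b = -(form a p * form b p) + form a q * form b q - form a f * form b f
      + form a t * form b t + form a e₁ * form b e₁ + form a e₂ * form b e₂ := by
  conv_lhs => rw [he.expand_full h a]
  simp only [form_expand, form_comm _ b]
  ring

lemma IsFrame.wedge_ne_zero {p q f t e₁ e₂ a b : R42} (he : IsFrame p q f t e₁ e₂)
    (h : IsTetrad p q f t) (ha : IsNormalTo p q f t a) (hb : IsNormalTo p q f t b)
    (hab : ∀ r s : ℝ, r • a + s • b = 0 → r = 0 ∧ s = 0) : wedge a b e₁ e₂ ≠ 0 := by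
  intro h0
  have h0' : form a e₁ * form b e₂ - form a e₂ * form b e₁ = 0 := h0
  have h1 := hab (form b e₁) (-form a e₁) (he.eq_zero h ((ha.smul _).add (hb.smul _))
    (by simp only [form_expand]; ring) (by simp only [form_expand]; linarith))
  have h2 := hab (form b e₂) (-form a e₂) (he.eq_zero h ((ha.smul _).add (hb.smul _))
    (by simp only [form_expand]; linarith) (by simp only [form_expand]; ring))
  have ha0 : a = 0 := he.eq_zero h ha (by linarith [h1.2]) (by linarith [h2.2])
  have := (hab 1 0 (by simp [ha0])).1
  norm_num at this

/-! ### The Gauss equation for surfaces in hyperbolic space -/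

/-- Brioschi's formula for a surface `c` with unit normal field `n` in a hyperbolic space
vanishes if and only if the second fundamental form has the same determinant as the first. -/
lemma brioschi_eq_zero_iff {p q : R42} {c n : Plane → R42} {T : Set Plane} (hT : IsOpen T)
    (hc : ContDiffOn ℝ ∞ c T) (hn : ContDiffOn ℝ ∞ n T)
    (htet : ∀ y ∈ T, IsTetrad p q (c y) (n y))
    (hcn : ∀ i, ∀ y ∈ T, form (pd i c y) (n y) = 0) {y : Plane} (hy : y ∈ T)
    (hne : wedge (pd 0 c y) (pd 1 c y) (pd 0 c y) (pd 1 c y) ≠ 0) :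
    brioschi (fun y => form (pd 0 c y) (pd 0 c y)) (fun y => form (pd 0 c y) (pd 1 c y))
      (fun y => form (pd 1 c y) (pd 1 c y)) y = 0 ↔
    wedge (pd 0 c y) (pd 1 c y) (pd 0 n y) (pd 1 n y)
      = wedge (pd 0 c y) (pd 1 c y) (pd 0 c y) (pd 1 c y) := by
  have sm1 : ∀ i, ContDiffOn ℝ ∞ (pd i c) T := contDiffOn_pd hT hc
  have sm2 : ∀ i j, ContDiffOn ℝ ∞ (pd i (pd j c)) T := fun i j => contDiffOn_pd hT (sm1 j) i
  have d1 : ∀ i, ∀ z ∈ T, DifferentiableAt ℝ (pd i c) z := fun i z hz =>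
    ((sm1 i).contDiffAt (hT.mem_nhds hz)).differentiableAt (by simp)
  have d2 : ∀ i j, ∀ z ∈ T, DifferentiableAt ℝ (pd i (pd j c)) z := fun i j z hz =>
    ((sm2 i j).contDiffAt (hT.mem_nhds hz)).differentiableAt (by simp)
  have comm1 : ∀ z ∈ T, pd 1 (pd 0 c) z = pd 0 (pd 1 c) z := fun z hz =>
    pd_comm (hc.contDiffAt (hT.mem_nhds hz)) 1 0
  have D1 : ∀ k i j, ∀ z ∈ T, pd k (fun y => form (pd i c y) (pd j c y)) z
      = form (pd k (pd i c) z) (pd j c z) + form (pd i c z) (pd k (pd j c) z) :=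
    fun k i j z hz => pd_form (d1 i z hz) (d1 j z hz) k
  have D2 : ∀ l k i j, pd l (pd k (fun y => form (pd i c y) (pd j c y))) y
      = (form (pd l (pd k (pd i c)) y) (pd j c y) + form (pd k (pd i c) y) (pd l (pd j c) y))
      + (form (pd l (pd i c) y) (pd k (pd j c) y) + form (pd i c y) (pd l (pd k (pd j c)) y)) := by
    intro l k i j
    rw [pd_congr_of_eqOn hT (D1 k i j) hy, pd_add, pd_form, pd_form]
    · exact d1 i y hy
    · exact d2 k j y hy
    · exact d2 k i y hy
    · exact d1 j y hy
    · exact differentiableAt_form (d2 k i y hy) (d1 j y hy)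
    · exact differentiableAt_form (d1 i y hy) (d2 k j y hy)
  -- The combination -E_vv/2 + F_uv - G_uu/2 in Brioschi's formula contains third derivatives of c;
  -- these two identities make them cancel.
  have third1 : pd 1 (pd 1 (pd 0 c)) y = pd 0 (pd 1 (pd 1 c)) y := by
    rw [pd_congr_of_eqOn hT comm1 hy, pd_comm ((sm1 1).contDiffAt (hT.mem_nhds hy))]
  have third2 : pd 0 (pd 1 (pd 0 c)) y = pd 0 (pd 0 (pd 1 c)) y :=
    pd_congr_of_eqOn hT comm1 hy 0
  obtain ⟨e₁, e₂, he⟩ := (htet y hy).exists_frame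
  have h := htet y hy
  -- components of the first derivatives
  have np : ∀ i, IsNormalTo p q (c y) (n y) (pd i c y) := fun i =>
    ⟨form_pd_const hT hc (fun z hz => (htet z hz).fp) hy i,
      form_pd_const hT hc (fun z hz => (htet z hz).fq) hy i,
      form_pd_self hT hc (fun z hz => (htet z hz).ff) hy i, hcn i y hy⟩
  have nn : ∀ i, IsNormalTo p q (c y) (n y) (pd i n y) := fun i =>
    ⟨form_pd_const hT hn (fun z hz => (htet z hz).tp) hy i,
      form_pd_const hT hn (fun z hz => (htet z hz).tq) hy i, by
      rw [form_pd_eq_neg hT hn hc (fun z hz => (htet z hz).tf) hy i, form_comm, hcn i y hy,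
        neg_zero],
      form_pd_self hT hn (fun z hz => (htet z hz).tt) hy i⟩
  -- components of the second derivatives
  have s_p : ∀ i j, form (pd i (pd j c) y) p = 0 := fun i j =>
    form_pd_const hT (sm1 j) (fun z hz => form_pd_const hT hc (fun z hz => (htet z hz).fp) hz j) hy i
  have s_q : ∀ i j, form (pd i (pd j c) y) q = 0 := fun i j =>
    form_pd_const hT (sm1 j) (fun z hz => form_pd_const hT hc (fun z hz => (htet z hz).fq) hz j) hy i
  have s_c : ∀ i j, form (pd i (pd j c) y) (c y) = -form (pd j c y) (pd i c y) := fun i j =>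
    form_pd_eq_neg hT (sm1 j) hc (fun z hz => form_pd_self hT hc (fun z hz => (htet z hz).ff) hz j)
      hy i
  have s_n : ∀ i j, form (pd i (pd j c) y) (n y) = -form (pd j c y) (pd i n y) := fun i j =>
    form_pd_eq_neg hT (sm1 j) hn (hcn j) hy i
  have hsym : form (pd 1 c y) (pd 0 n y) = form (pd 0 c y) (pd 1 n y) := by
    have h1 := s_n 0 1
    rw [← comm1 y hy, s_n 1 0] at h1
    linarith
  -- Gauss decomposition: along c and n the second derivatives of c have the first and second
  -- fundamental forms as components, up to sign. The parts along e₁, e₂ cancel in Brioschi's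
  -- determinants.
  have f00_11 : form (pd 0 (pd 0 c) y) (pd 1 (pd 1 c) y)
      = -(form (pd 0 c y) (pd 0 c y) * form (pd 1 c y) (pd 1 c y))
        + form (pd 0 c y) (pd 0 n y) * form (pd 1 c y) (pd 1 n y)
        + form (pd 0 (pd 0 c) y) e₁ * form (pd 1 (pd 1 c) y) e₁
        + form (pd 0 (pd 0 c) y) e₂ * form (pd 1 (pd 1 c) y) e₂ := by
    rw [he.form_eq_full h]; simp only [s_p, s_q, s_c, s_n]; ring
  have f01_01 : form (pd 0 (pd 1 c) y) (pd 0 (pd 1 c) y)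
      = -(form (pd 0 c y) (pd 1 c y) * form (pd 0 c y) (pd 1 c y))
        + form (pd 0 c y) (pd 1 n y) * form (pd 0 c y) (pd 1 n y)
        + form (pd 0 (pd 1 c) y) e₁ * form (pd 0 (pd 1 c) y) e₁
        + form (pd 0 (pd 1 c) y) e₂ * form (pd 0 (pd 1 c) y) e₂ := by
    rw [he.form_eq_full h]; simp only [s_p, s_q, s_c, s_n, form_comm (pd 1 c y) (pd 0 c y), hsym]
    ring
  set W := wedge (pd 0 c y) (pd 1 c y) (pd 0 c y) (pd 1 c y) with hW
  -- This is K = det II / det I - 1, where the summand -1 stems from the timelike component along c,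
  -- i.e. from the curvature of the ambient hyperbolic space.
  have key : brioschi (fun y => form (pd 0 c y) (pd 0 c y)) (fun y => form (pd 0 c y) (pd 1 c y))
      (fun y => form (pd 1 c y) (pd 1 c y)) y
      = (wedge (pd 0 c y) (pd 1 c y) (pd 0 n y) (pd 1 n y) - W) * W / W ^ 2 := by
    have hden : form (pd 0 c y) (pd 0 c y) * form (pd 1 c y) (pd 1 c y)
        - form (pd 0 c y) (pd 1 c y) ^ 2 = W := by
      rw [hW, wedge, form_comm (pd 1 c y) (pd 0 c y)]; ring
    have a1 := D1 0 0 0 y hy; have a2 := D1 1 0 0 y hy; have a3 := D1 0 0 1 y hy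
    have a4 := D1 1 0 1 y hy; have a5 := D1 0 1 1 y hy; have a6 := D1 1 1 1 y hy
    rw [brioschi, hden]
    congr 1
    rw [Matrix.det_fin_three, Matrix.det_fin_three]
    simp only [Matrix.cons_val, Matrix.of_apply]
    rw [D2, D2, D2, a1, a2, a3, a4, a5, a6]
    rw [third1, third2]
    simp only [comm1 y hy, hW, wedge, hsym]
    simp only [form_comm (pd 0 c y) (pd 0 (pd 0 c) y), form_comm (pd 0 c y) (pd 0 (pd 1 c) y),
      form_comm (pd 1 c y) (pd 0 (pd 1 c) y), form_comm (pd 1 c y) (pd 1 (pd 1 c) y),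
      form_comm (pd 0 c y) (pd 1 (pd 1 c) y),
      form_comm (pd 0 c y) (pd 0 (pd 1 (pd 1 c)) y), form_comm (pd 1 c y) (pd 0 (pd 0 (pd 1 c)) y),
      form_comm (pd 1 c y) (pd 0 c y)]
    rw [f00_11, f01_01]
    rw [form_comm (pd 0 (pd 0 c) y) (pd 0 c y), form_comm (pd 0 (pd 0 c) y) (pd 1 c y),
      form_comm (pd 0 (pd 1 c) y) (pd 0 c y), form_comm (pd 0 (pd 1 c) y) (pd 1 c y),
      form_comm (pd 1 (pd 1 c) y) (pd 0 c y), form_comm (pd 1 (pd 1 c) y) (pd 1 c y)]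
    simp only [he.form_eq h (np 0) (b := pd 0 (pd 0 c) y), he.form_eq h (np 1) (b := pd 0 (pd 0 c) y),
      he.form_eq h (np 0) (b := pd 0 (pd 1 c) y), he.form_eq h (np 1) (b := pd 0 (pd 1 c) y),
      he.form_eq h (np 0) (b := pd 1 (pd 1 c) y), he.form_eq h (np 1) (b := pd 1 (pd 1 c) y),
      he.form_eq h (np 0) (b := pd 0 c y), he.form_eq h (np 0) (b := pd 1 c y),
      he.form_eq h (np 1) (b := pd 1 c y)]
    ring
  rw [key, div_eq_zero_iff, or_iff_left (pow_ne_zero _ hne), mul_eq_zero, or_iff_left hne,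
    sub_eq_zero]

/-! ### Fronts -/

section Fronts

variable {M : Type*} [TopologicalSpace M] [ChartedSpace Plane M]
  {H : HyperbolicModel} {f t : M → R42}

/-- The differentials of `f` and `t` have the same determinant at `x`. -/
def FlatAt (f t : M → R42) (x : M) : Prop :=
  ∀ (X Y : TangentSpace 𝓘(ℝ, Plane) x) (z w : R42),
    wedge (deriv1 f x X) (deriv1 f x Y) z w = wedge (deriv1 t x X) (deriv1 t x Y) z w

lemma exists_chart_point [IsManifold 𝓘(ℝ, Plane) ∞ M] (x : M) : ∃ ψ ∈ IsManifold.maximalAtlas 𝓘(ℝ, Plane) ∞ M,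
    ∃ y ∈ ψ.target, x = ψ.symm y :=
  ⟨chartAt Plane x, IsManifold.chart_mem_maximalAtlas x, chartAt Plane x x,
    mem_chart_target _ _, by simp⟩

namespace IsFront

lemma mdiff_f (h : IsFront H f t) (x : M) : MDifferentiableAt 𝓘(ℝ, Plane) 𝓘(ℝ, R42) f x :=
  h.smooth_f.mdifferentiable (by simp) x

lemma mdiff_t (h : IsFront H f t) (x : M) : MDifferentiableAt 𝓘(ℝ, Plane) 𝓘(ℝ, R42) t x :=
  h.smooth_t.mdifferentiable (by simp) x

lemma tetrad (h : IsFront H f t) (x : M) : IsTetrad H.p H.q (f x) (t x) :=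
  ⟨H.pp, H.qq, (h.mem_space x).2.2.1, h.t_t x, H.pq, (h.mem_space x).1, (h.mem_space x).2.1,
    h.t_p x, h.t_q x, h.t_f x⟩

variable {ψ : OpenPartialHomeomorph M Plane}

lemma contDiffOn_f (h : IsFront H f t) (hψ : ψ ∈ IsManifold.maximalAtlas 𝓘(ℝ, Plane) ∞ M) :
    ContDiffOn ℝ ∞ (f ∘ ψ.symm) ψ.target := by
  simpa using contDiffOn_comp_symm hψ h.smooth_f.contMDiffOn (U := univ)

lemma contDiffOn_t (h : IsFront H f t) (hψ : ψ ∈ IsManifold.maximalAtlas 𝓘(ℝ, Plane) ∞ M) :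
    ContDiffOn ℝ ∞ (t ∘ ψ.symm) ψ.target := by
  simpa using contDiffOn_comp_symm hψ h.smooth_t.contMDiffOn (U := univ)

lemma pd_f (h : IsFront H f t) (hψ : ψ ∈ IsManifold.maximalAtlas 𝓘(ℝ, Plane) ∞ M) {y : Plane}
    (hy : y ∈ ψ.target) (i : Fin 2) : pd i (f ∘ ψ.symm) y
      = deriv1 f (ψ.symm y) (chartVec ψ y (EuclideanSpace.single i 1)) :=
  fderiv_comp_symm hψ hy (h.mdiff_f _) _

lemma pd_t (h : IsFront H f t) (hψ : ψ ∈ IsManifold.maximalAtlas 𝓘(ℝ, Plane) ∞ M) {y : Plane}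
    (hy : y ∈ ψ.target) (i : Fin 2) : pd i (t ∘ ψ.symm) y
      = deriv1 t (ψ.symm y) (chartVec ψ y (EuclideanSpace.single i 1)) :=
  fderiv_comp_symm hψ hy (h.mdiff_t _) _

lemma form_pd_normal (h : IsFront H f t) (hψ : ψ ∈ IsManifold.maximalAtlas 𝓘(ℝ, Plane) ∞ M)
    (i : Fin 2) {y : Plane} (hy : y ∈ ψ.target) :
    form (pd i (f ∘ ψ.symm) y) ((t ∘ ψ.symm) y) = 0 := by
  rw [h.pd_f hψ hy]; exact h.normal _ _

variable [IsManifold 𝓘(ℝ, Plane) ∞ M]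

lemma normalTo_deriv_f (h : IsFront H f t) (x : M) (X : TangentSpace 𝓘(ℝ, Plane) x) :
    IsNormalTo H.p H.q (f x) (t x) (deriv1 f x X) :=
  ⟨form_deriv1_const univ_mem (h.mdiff_f x) (fun z _ => (h.tetrad z).fp) X,
    form_deriv1_const univ_mem (h.mdiff_f x) (fun z _ => (h.tetrad z).fq) X,
    form_deriv1_self univ_mem (h.mdiff_f x) (fun z _ => (h.tetrad z).ff) X, h.normal x X⟩

lemma normalTo_deriv_t (h : IsFront H f t) (x : M) (X : TangentSpace 𝓘(ℝ, Plane) x) :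
    IsNormalTo H.p H.q (f x) (t x) (deriv1 t x X) :=
  ⟨form_deriv1_const univ_mem (h.mdiff_t x) (fun z _ => (h.tetrad z).tp) X,
    form_deriv1_const univ_mem (h.mdiff_t x) (fun z _ => (h.tetrad z).tq) X, by
    rw [form_deriv1_eq_neg univ_mem (h.mdiff_t x) (h.mdiff_f x) (fun z _ => (h.tetrad z).tf) X,
      form_comm, h.normal, neg_zero],
    form_deriv1_self univ_mem (h.mdiff_t x) (fun z _ => (h.tetrad z).tt) X⟩

/-- The second fundamental form is symmetric. -/
lemma second_symm (h : IsFront H f t) (x : M) (X Y : TangentSpace 𝓘(ℝ, Plane) x) :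
    form (deriv1 f x X) (deriv1 t x Y) = form (deriv1 f x Y) (deriv1 t x X) := by
  obtain ⟨ψ, hψ, y, hy, rfl⟩ := exists_chart_point x
  obtain ⟨e, rfl⟩ := (chartVec_bijective hψ hy).2 X
  obtain ⟨e', rfl⟩ := (chartVec_bijective hψ hy).2 Y
  rw [← fderiv_comp_symm hψ hy (h.mdiff_f _), ← fderiv_comp_symm hψ hy (h.mdiff_f _),
    ← fderiv_comp_symm hψ hy (h.mdiff_t _), ← fderiv_comp_symm hψ hy (h.mdiff_t _)]
  have hc := h.contDiffOn_f hψ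
  have key : ∀ i j, form (pd i (pd j (f ∘ ψ.symm)) y) ((t ∘ ψ.symm) y)
      = -form (pd j (f ∘ ψ.symm) y) (pd i (t ∘ ψ.symm) y) := fun i j =>
    form_pd_eq_neg ψ.open_target (contDiffOn_pd ψ.open_target hc j) (h.contDiffOn_t hψ)
      (fun z hz => h.form_pd_normal hψ j hz) hy i
  have hs : form (pd 1 (f ∘ ψ.symm) y) (pd 0 (t ∘ ψ.symm) y)
      = form (pd 0 (f ∘ ψ.symm) y) (pd 1 (t ∘ ψ.symm) y) := by
    have h1 := key 0 1
    rw [pd_comm (hc.contDiffAt (ψ.open_target.mem_nhds hy)), key 1 0] at h1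
    linarith
  simp only [fderiv_eq_pd, form_expand, hs]
  ring

/-- An immersed front in hyperbolic space has vanishing Gauss curvature at `x` if and only
if the differentials of the surface and of its normal have the same determinant at `x`. -/
lemma gaussCurvature_eq_zero_iff (h : IsFront H f t) (x : M)
    (hinj : Function.Injective (deriv1 f x)) : gaussCurvature f x = 0 ↔ FlatAt f t x := by
  obtain ⟨ψ, hψeq⟩ : ∃ ψ, ψ = chartAt Plane x := ⟨_, rfl⟩
  have hψ : ψ ∈ IsManifold.maximalAtlas 𝓘(ℝ, Plane) ∞ M := hψeq ▸ IsManifold.chart_mem_maximalAtlas x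
  obtain ⟨y, hy, hyx, hxy⟩ : ∃ y ∈ ψ.target, y = chartAt Plane x x ∧ x = ψ.symm y :=
    ⟨chartAt Plane x x, by simp [hψeq], rfl, by simp [hψeq]⟩
  have hg : gaussCurvature f x = brioschi
      (fun y => form (pd 0 (f ∘ ψ.symm) y) (pd 0 (f ∘ ψ.symm) y))
      (fun y => form (pd 0 (f ∘ ψ.symm) y) (pd 1 (f ∘ ψ.symm) y))
      (fun y => form (pd 1 (f ∘ ψ.symm) y) (pd 1 (f ∘ ψ.symm) y)) y := by
    rw [gaussCurvature, hyx, hψeq]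
  rw [hg]
  clear hg hyx hψeq
  subst hxy
  obtain ⟨e₁, e₂, he⟩ := (h.tetrad (ψ.symm y)).exists_frame
  have hT := h.tetrad (ψ.symm y)
  have nf : ∀ i, IsNormalTo H.p H.q (f (ψ.symm y)) (t (ψ.symm y)) (pd i (f ∘ ψ.symm) y) := fun i =>
    h.pd_f hψ hy i ▸ h.normalTo_deriv_f _ _
  have nt : ∀ i, IsNormalTo H.p H.q (f (ψ.symm y)) (t (ψ.symm y)) (pd i (t ∘ ψ.symm) y) := fun i =>
    h.pd_t hψ hy i ▸ h.normalTo_deriv_t _ _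
  have hne : wedge (pd 0 (f ∘ ψ.symm) y) (pd 1 (f ∘ ψ.symm) y) e₁ e₂ ≠ 0 := by
    refine he.wedge_ne_zero hT (nf 0) (nf 1) fun r s hrs => ?_
    rw [h.pd_f hψ hy, h.pd_f hψ hy] at hrs
    have hrs' : deriv1 f (ψ.symm y) (chartVec ψ y (r • EuclideanSpace.single 0 1
        + s • EuclideanSpace.single 1 1)) = 0 := by simpa only [map_add, map_smul] using hrs
    have h0 := (chartVec_bijective hψ hy).1 ((hinj (hrs'.trans (map_zero _).symm)).trans
      (map_zero _).symm)
    have h1 := congrFun (congrArg (fun v : Plane => v.ofLp) h0)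
    exact ⟨by simpa using h1 0, by simpa using h1 1⟩
  rw [brioschi_eq_zero_iff (p := H.p) (q := H.q) ψ.open_target (h.contDiffOn_f hψ)
    (h.contDiffOn_t hψ) (fun z _ => h.tetrad _) (fun i z hz => h.form_pd_normal hψ i hz) hy]
  -- All bivectors are multiples of e₁ ∧ e₂, so after cancelling the nonzero factor of the two
  -- partial derivatives of f only one scalar equation for the coordinate fields remains, and it
  -- extends to all X, Y by bilinearity.
  · rw [he.wedge_eq hT (nf 0) (nf 1), wedge_comm e₁, he.wedge_eq hT (nf 0) (nf 1)
      (pd 0 (f ∘ ψ.symm) y), wedge_comm e₁ e₂ (pd 0 (f ∘ ψ.symm) y), mul_right_inj' hne]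
    constructor
    · intro hD X Y z w
      obtain ⟨e, rfl⟩ := (chartVec_bijective hψ hy).2 X
      obtain ⟨e', rfl⟩ := (chartVec_bijective hψ hy).2 Y
      rw [he.wedge_eq hT (h.normalTo_deriv_f _ _) (h.normalTo_deriv_f _ _),
        he.wedge_eq hT (h.normalTo_deriv_t _ _) (h.normalTo_deriv_t _ _),
        ← fderiv_comp_symm hψ hy (h.mdiff_f _), ← fderiv_comp_symm hψ hy (h.mdiff_f _),
        ← fderiv_comp_symm hψ hy (h.mdiff_t _), ← fderiv_comp_symm hψ hy (h.mdiff_t _)]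
      congr 1
      simp only [wedge] at hD
      simp only [fderiv_eq_pd, wedge, form_expand]
      linear_combination (-(e 0 * e' 1 - e 1 * e' 0)) * hD
    · intro hF
      rw [h.pd_f hψ hy, h.pd_f hψ hy, h.pd_t hψ hy, h.pd_t hψ hy, hF]
  · rw [he.wedge_eq hT (nf 0) (nf 1), wedge_comm e₁]
    exact mul_ne_zero hne hne

end IsFront

end Fronts


/-! ### Parallel fronts -/

section Parallel

variable {M : Type*} {H : HyperbolicModel} {f t : M → R42}

lemma parallelFront_parallelFront (a b : ℝ) :
    parallelFront (parallelFront f t a) (parallelNormal f t a) b = parallelFront f t (a + b) := by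
  funext x
  simp only [parallelFront, parallelNormal, Real.cosh_add, Real.sinh_add]
  module

/-- The pairs (p, q) and (t, f) undergo the same hyperbolic rotation, so the spanning pair p + t, q
+ f is merely replaced by another basis of its span. The inverse rotation, with -sinh a, gives the
second inclusion. -/
lemma legendreLift_parallel (a : ℝ) :
    legendreLift (H.parallel a) (parallelFront f t a) (parallelNormal f t a)
      = legendreLift H f t := by
  have key : ∀ (H : HyperbolicModel) (f t : M → R42) (a : ℝ) (x : M),
      legendreLift (H.parallel a) (parallelFront f t a) (parallelNormal f t a) x
        ≤ legendreLift H f t x := by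
    intro H f t a x
    rw [legendreLift, legendreLift, Submodule.span_le]
    rintro v (rfl | rfl)
    · refine Submodule.mem_span_pair.2 ⟨Real.cosh a, Real.sinh a, ?_⟩
      simp only [HyperbolicModel.parallel, parallelFront]; module
    · refine Submodule.mem_span_pair.2 ⟨Real.sinh a, Real.cosh a, ?_⟩
      simp only [HyperbolicModel.parallel, parallelNormal]; module
  funext x
  refine le_antisymm (key H f t a x) ?_
  have hcs : Real.cosh a ^ 2 - Real.sinh a ^ 2 = 1 := Real.cosh_sq_sub_sinh_sq a
  have e : ∀ v : R42, v = (Real.cosh a ^ 2 - Real.sinh a ^ 2) • v := fun v => by rw [hcs, one_smul]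
  rw [legendreLift, legendreLift, Submodule.span_le]
  rintro v (rfl | rfl)
  · refine Submodule.mem_span_pair.2 ⟨Real.cosh a, -Real.sinh a, ?_⟩
    rw [e (H.q + f x)]
    simp only [HyperbolicModel.parallel, parallelFront, parallelNormal]; module
  · refine Submodule.mem_span_pair.2 ⟨-Real.sinh a, Real.cosh a, ?_⟩
    rw [e (H.p + t x)]
    simp only [HyperbolicModel.parallel, parallelFront, parallelNormal]; module

end Parallel

section Lift

variable {M : Type*} [TopologicalSpace M] [ChartedSpace Plane M]
  {H : HyperbolicModel} {f t : M → R42}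

lemma contMDiffOn_const_smul {g : M → R42} {U : Set M} (a : ℝ)
    (hg : ContMDiffOn 𝓘(ℝ, Plane) 𝓘(ℝ, R42) ∞ g U) :
    ContMDiffOn 𝓘(ℝ, Plane) 𝓘(ℝ, R42) ∞ (fun x => a • g x) U :=
  (contDiff_const_smul a).contMDiff.comp_contMDiffOn hg

lemma contMDiffOn_linearComb {g h : M → R42} {U : Set M} (a b : ℝ)
    (hg : ContMDiffOn 𝓘(ℝ, Plane) 𝓘(ℝ, R42) ∞ g U)
    (hh : ContMDiffOn 𝓘(ℝ, Plane) 𝓘(ℝ, R42) ∞ h U) :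
    ContMDiffOn 𝓘(ℝ, Plane) 𝓘(ℝ, R42) ∞ (fun x => a • g x + b • h x) U :=
  (contMDiffOn_const_smul a hg).add (contMDiffOn_const_smul b hh)

lemma IsFront.deriv1_parallelFront (h : IsFront H f t) (a : ℝ) (x : M)
    (X : TangentSpace 𝓘(ℝ, Plane) x) : deriv1 (parallelFront f t a) x X
      = Real.cosh a • deriv1 f x X + Real.sinh a • deriv1 t x X :=
  deriv1_linearComb (h.mdiff_f x) (h.mdiff_t x) _ _ X

lemma IsFront.deriv1_parallelNormal (h : IsFront H f t) (a : ℝ) (x : M)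
    (X : TangentSpace 𝓘(ℝ, Plane) x) : deriv1 (parallelNormal f t a) x X
      = Real.sinh a • deriv1 f x X + Real.cosh a • deriv1 t x X :=
  deriv1_linearComb (h.mdiff_f x) (h.mdiff_t x) _ _ X

/-- The difference df ∧ df - dt ∧ dt is invariant under hyperbolic rotations of (f, t). Flatness can
thus be tested on f even where f itself is not immersed. -/
lemma IsFront.flatAt_parallel_iff (h : IsFront H f t) (a : ℝ) (x : M) :
    FlatAt (parallelFront f t a) (parallelNormal f t a) x ↔ FlatAt f t x := by
  have hcs := Real.cosh_sq a
  refine forall_congr' fun X => forall_congr' fun Y => forall_congr' fun z =>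
    forall_congr' fun w => ?_
  rw [h.deriv1_parallelFront, h.deriv1_parallelFront, h.deriv1_parallelNormal,
    h.deriv1_parallelNormal, ← sub_eq_zero, ← sub_eq_zero (a := wedge (deriv1 f x X) _ _ _)]
  have key : ∀ a₁ a₂ b₁ b₂ : R42,
      wedge (Real.cosh a • a₁ + Real.sinh a • b₁) (Real.cosh a • a₂ + Real.sinh a • b₂) z w
        - wedge (Real.sinh a • a₁ + Real.cosh a • b₁) (Real.sinh a • a₂ + Real.cosh a • b₂) z w
      = wedge a₁ a₂ z w - wedge b₁ b₂ z w := by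
    intro a₁ a₂ b₁ b₂
    simp only [wedge, form_expand]
    linear_combination (form a₁ z * form a₂ w - form a₁ w * form a₂ z
      - form b₁ z * form b₂ w + form b₁ w * form b₂ z) * hcs
  rw [key]

lemma HyperbolicModel.space_parallel (H : HyperbolicModel) (a : ℝ) :
    (H.parallel a).space = H.space := by
  have hcs := Real.cosh_sq a
  ext y
  simp only [HyperbolicModel.space, HyperbolicModel.parallel, mem_ofPred_eq, form_expand]
  constructor
  · rintro ⟨h1, h2, h3, h4⟩
    refine ⟨?_, ?_, h3, h4⟩
    · linear_combination Real.cosh a * h1 - Real.sinh a * h2 - form y H.p * hcs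
    · linear_combination Real.cosh a * h2 - Real.sinh a * h1 - form y H.q * hcs
  · rintro ⟨h1, h2, h3, h4⟩
    simp [h1, h2, h3, h4]

lemma IsFront.parallel [IsManifold 𝓘(ℝ, Plane) ∞ M] (h : IsFront H f t) (a : ℝ) :
    IsFront (H.parallel a) (parallelFront f t a) (parallelNormal f t a) := by
  have hcs := Real.cosh_sq a
  have tet := fun x => h.tetrad x
  constructor
  · exact contMDiffOn_univ.1 (contMDiffOn_linearComb _ _ h.smooth_f.contMDiffOn
      h.smooth_t.contMDiffOn)
  · exact contMDiffOn_univ.1 (contMDiffOn_linearComb _ _ h.smooth_f.contMDiffOn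
      h.smooth_t.contMDiffOn)
  · intro x
    rw [H.space_parallel]
    obtain ⟨h1, h2, h3, h4⟩ := h.mem_space x
    have T := tet x
    refine ⟨?_, ?_, ?_, ?_⟩
    · simp [parallelFront, form_expand, T.fp, T.tp]
    · simp [parallelFront, form_expand, T.fq, T.tq]
    · simp only [parallelFront, form_expand, T.ff, T.tt, form_comm (f x) (t x), T.tf]
      linear_combination -hcs
    -- Expanding |o|² = -1 gives (f,o)² = 1 + (t,o)² + (e₁,o)² + (e₂,o)². Hence |sinh a (t,o)| <
    -- cosh a |(f,o)|, and the parallel surface stays on the same sheet.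
    · obtain ⟨e₁, e₂, he⟩ := T.exists_frame
      have ho := he.form_eq_full T H.o H.o
      rw [H.oo, H.op, H.oq, form_comm H.o (f x), form_comm H.o (t x)] at ho
      simp only [parallelFront, form_expand]
      have hlt : (Real.sinh a * form (t x) H.o) ^ 2 < (-(Real.cosh a * form (f x) H.o)) ^ 2 := by
        nlinarith [mul_self_nonneg (form H.o e₁), mul_self_nonneg (form H.o e₂),
          sq_nonneg (Real.sinh a), sq_nonneg (form (t x) H.o)]
      have := abs_lt_of_sq_lt_sq' hlt
        (by nlinarith [Real.cosh_pos a])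
      linarith [this.2]
  · intro x
    simp [HyperbolicModel.parallel, parallelNormal, form_expand, (tet x).fp, (tet x).fq,
      (tet x).tp, (tet x).tq]
  · intro x
    simp [HyperbolicModel.parallel, parallelNormal, form_expand, (tet x).fp, (tet x).fq,
      (tet x).tp, (tet x).tq]
  · intro x
    simp only [parallelNormal, form_expand, (tet x).ff, (tet x).tt, form_comm (f x) (t x),
      (tet x).tf]
    linear_combination hcs
  · intro x
    simp only [parallelNormal, parallelFront, form_expand, (tet x).ff, (tet x).tt,
      form_comm (f x) (t x), (tet x).tf]
    ring
  · intro x X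
    have h2 := (h.normalTo_deriv_t x X).t
    have h3 := (h.normalTo_deriv_t x X).f
    have h4 := (h.normalTo_deriv_f x X).f
    rw [h.deriv1_parallelFront]
    simp only [parallelNormal, form_expand, h.normal x X, h2, h3, h4]
    ring
  · intro x X h1 h2
    rw [h.deriv1_parallelFront] at h1
    rw [h.deriv1_parallelNormal] at h2
    have e1 : deriv1 f x X = (Real.cosh a ^ 2 - Real.sinh a ^ 2) • deriv1 f x X := by
      rw [Real.cosh_sq_sub_sinh_sq, one_smul]
    have e2 : deriv1 t x X = (Real.cosh a ^ 2 - Real.sinh a ^ 2) • deriv1 t x X := by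
      rw [Real.cosh_sq_sub_sinh_sq, one_smul]
    apply h.immersion x X
    · rw [e1]
      calc _ = Real.cosh a • (Real.cosh a • deriv1 f x X + Real.sinh a • deriv1 t x X)
            - Real.sinh a • (Real.sinh a • deriv1 f x X + Real.cosh a • deriv1 t x X) := by module
        _ = 0 := by rw [h1, h2]; simp
    · rw [e2]
      calc _ = Real.cosh a • (Real.sinh a • deriv1 f x X + Real.cosh a • deriv1 t x X)
            - Real.sinh a • (Real.cosh a • deriv1 f x X + Real.sinh a • deriv1 t x X) := by module
        _ = 0 := by rw [h1, h2]; simp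

/-! ### The Legendre lift of a front -/

/-- Pairing with q and p reads off the coefficients: (q+f, q) = 1, (p+t, p) = -1 and the mixed
products vanish. In particular sections of the lift have smooth coefficients. -/
lemma IsTetrad.mem_span_iff {p q f t v : R42} (T : IsTetrad p q f t) :
    v ∈ Submodule.span ℝ {q + f, p + t} ↔ v = form v q • (q + f) - form v p • (p + t) := by
  constructor
  · intro hv
    obtain ⟨a, b, rfl⟩ := Submodule.mem_span_pair.1 hv
    simp only [form_expand, T.pp, T.qq, T.pq, T.fp, T.fq, T.tp, T.tq, form_comm q p]
    module
  · intro hv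
    rw [hv]
    exact Submodule.sub_mem _ (Submodule.smul_mem _ _ (Submodule.subset_span (by simp)))
      (Submodule.smul_mem _ _ (Submodule.subset_span (by simp)))

lemma IsTetrad.isContactElement {p q f t : R42} (T : IsTetrad p q f t) :
    IsContactElement (Submodule.span ℝ {q + f, p + t}) := by
  constructor
  · have hli : LinearIndependent ℝ ![q + f, p + t] := by
      rw [LinearIndependent.pair_iff]
      intro a b hab
      have h1 := congrArg (form · q) hab
      have h2 := congrArg (form · p) hab
      simp only [form_expand, T.pp, T.qq, T.pq, T.fp, T.fq, T.tp, T.tq, form_comm q p]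
        at h1 h2
      constructor <;> linarith
    have := finrank_span_eq_card hli
    rwa [Matrix.range_cons_cons_empty, Fintype.card_fin] at this
  · intro a ha b hb
    rw [T.mem_span_iff.1 ha, T.mem_span_iff.1 hb]
    simp only [form_expand, T.pp, T.qq, T.pq, T.fp, T.fq, T.tp, T.tq, T.ff, T.tt, T.tf,
      form_comm q p, form_comm p f, form_comm p t, form_comm q f,
      form_comm q t, form_comm f t]
    ring

/-- Derivative of a map which is expanded in `q + f` and `p + t`. -/
lemma deriv1_eq_of_eq_combination [IsManifold 𝓘(ℝ, Plane) ∞ M] {p q : R42} {U : Set M}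
    {ρ : M → R42} {x : M} (hf : MDifferentiableAt 𝓘(ℝ, Plane) 𝓘(ℝ, R42) f x)
    (ht : MDifferentiableAt 𝓘(ℝ, Plane) 𝓘(ℝ, R42) t x)
    (hρ : MDifferentiableAt 𝓘(ℝ, Plane) 𝓘(ℝ, R42) ρ x) (hU : U ∈ 𝓝 x)
    (h : ∀ z ∈ U, ρ z = form (ρ z) q • (q + f z) - form (ρ z) p • (p + t z))
    (X : TangentSpace 𝓘(ℝ, Plane) x) :
    deriv1 ρ x X = form (ρ x) q • deriv1 f x X - form (ρ x) p • deriv1 t x X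
      + (form (deriv1 ρ x X) q • (q + f x) - form (deriv1 ρ x X) p • (p + t x)) := by
  obtain ⟨ψ, hψ, y, hy, rfl⟩ := exists_chart_point x
  obtain ⟨e, rfl⟩ := (chartVec_bijective hψ hy).2 X
  rw [← fderiv_comp_symm hψ hy hf, ← fderiv_comp_symm hψ hy ht, ← fderiv_comp_symm hψ hy hρ]
  have hs := (mdifferentiable_of_mem_maximalAtlas hψ).mdifferentiableAt_symm hy
  have dρ : DifferentiableAt ℝ (ρ ∘ ψ.symm) y :=
    mdifferentiableAt_iff_differentiableAt.1 (hρ.comp y hs)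
  have df : DifferentiableAt ℝ (f ∘ ψ.symm) y :=
    mdifferentiableAt_iff_differentiableAt.1 (hf.comp y hs)
  have dt : DifferentiableAt ℝ (t ∘ ψ.symm) y :=
    mdifferentiableAt_iff_differentiableAt.1 (ht.comp y hs)
  have heq : (ρ ∘ ψ.symm) =ᶠ[𝓝 y] fun z => form ((ρ ∘ ψ.symm) z) q • (q + (f ∘ ψ.symm) z)
      - form ((ρ ∘ ψ.symm) z) p • (p + (t ∘ ψ.symm) z) := by
    filter_upwards [(ψ.continuousAt_symm hy).preimage_mem_nhds hU] with z hz
    exact h _ hz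
  have cd : ∀ w : R42, DifferentiableAt ℝ (fun z => form ((ρ ∘ ψ.symm) z) w) y := fun w =>
    differentiableAt_form dρ (differentiableAt_const w)
  have cf : ∀ w : R42, fderiv ℝ (fun z => form ((ρ ∘ ψ.symm) z) w) y e
      = form (fderiv ℝ (ρ ∘ ψ.symm) y e) w := fun w => by
    rw [fderiv_form dρ (differentiableAt_const w)]; simp [form_zero_right]
  conv_lhs => rw [heq.fderiv_eq, fderiv_fun_sub ((cd _).fun_smul (df.const_add _))
    ((cd _).fun_smul (dt.const_add _)), fderiv_fun_smul (cd _) (df.const_add _),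
    fderiv_fun_smul (cd _) (dt.const_add _), fderiv_const_add, fderiv_const_add]
  simp only [add_apply, sub_apply, smul_apply, ContinuousLinearMap.smulRight_apply, cf]
  simp only [Function.comp_apply]
  module

namespace IsFront

lemma mem_lift_iff (h : IsFront H f t) {x : M} {v : R42} : v ∈ legendreLift H f t x ↔
    v = form v H.q • (H.q + f x) - form v H.p • (H.p + t x) :=
  (h.tetrad x).mem_span_iff

lemma eq_zero_of_mem_lift (h : IsFront H f t) {x : M} {v : R42} (hv : v ∈ legendreLift H f t x)
    (hq : form v H.q = 0) (hp : form v H.p = 0) : v = 0 := by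
  rw [h.mem_lift_iff.1 hv, hq, hp]; simp

lemma contactElement (h : IsFront H f t) (x : M) : IsContactElement (legendreLift H f t x) :=
  (h.tetrad x).isContactElement

lemma isSection_q (h : IsFront H f t) (U : Set M) :
    IsSection (legendreLift H f t) U (fun x => H.q + f x) :=
  ⟨(contMDiff_const.add h.smooth_f).contMDiffOn, fun _ _ => Submodule.subset_span (by simp)⟩

lemma isSection_p (h : IsFront H f t) (U : Set M) :
    IsSection (legendreLift H f t) U (fun x => H.p + t x) :=
  ⟨(contMDiff_const.add h.smooth_t).contMDiffOn, fun _ _ => Submodule.subset_span (by simp)⟩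

variable [IsManifold 𝓘(ℝ, Plane) ∞ M]

/-- Derivative of a section of the Legendre lift. -/
lemma deriv1_section (h : IsFront H f t) {U : Set M} (hU : IsOpen U) {ρ : M → R42}
    (hρ : IsSection (legendreLift H f t) U ρ) {x : M} (hx : x ∈ U)
    (X : TangentSpace 𝓘(ℝ, Plane) x) :
    deriv1 ρ x X = form (ρ x) H.q • deriv1 f x X - form (ρ x) H.p • deriv1 t x X
      + (form (deriv1 ρ x X) H.q • (H.q + f x) - form (deriv1 ρ x X) H.p • (H.p + t x)) :=
  deriv1_eq_of_eq_combination (h.mdiff_f x) (h.mdiff_t x)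
    (mdifferentiableAt_of_contMDiffOn hU hρ.1 hx) (hU.mem_nhds hx)
    (fun _ hz => h.mem_lift_iff.1 (hρ.2 _ hz)) X

/-- Modulo the contact element, the derivative of a section is a combination of df and dt. These are
orthogonal to p, q, f, t, which gives the contact condition; they meet the contact element only in
zero, which turns the immersion property of (f, t) into that of the lift. -/
lemma isLegendre (h : IsFront H f t) : IsLegendre (legendreLift H f t) where
  contactElement := h.contactElement
  smooth x₀ := ⟨univ, isOpen_univ, mem_univ _, _, _, h.isSection_q _, h.isSection_p _,
    fun _ _ => rfl⟩
  contact U hU σ τ hσ hτ x hx X := by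
    have nf := h.normalTo_deriv_f x X
    have nt := h.normalTo_deriv_t x X
    have hc := (h.contactElement x).2 _ (Submodule.sub_mem _
      (Submodule.smul_mem _ (form (deriv1 σ x X) H.q) ((h.isSection_q univ).2 x (mem_univ _)))
      (Submodule.smul_mem _ (form (deriv1 σ x X) H.p) ((h.isSection_p univ).2 x (mem_univ _))))
      _ (hτ.2 x hx)
    rw [h.deriv1_section hU hσ hx X, form_add_left, hc, h.mem_lift_iff.1 (hτ.2 x hx)]
    simp only [form_expand, nf.p, nf.q, nf.f, nf.t, nt.p, nt.q, nt.f, nt.t]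
    ring
  immersion x X hX := by
    have hq := hX univ isOpen_univ (mem_univ _) _ (h.isSection_q _)
    have hp := hX univ isOpen_univ (mem_univ _) _ (h.isSection_p _)
    rw [deriv1_const_add (h.mdiff_f x)] at hq
    rw [deriv1_const_add (h.mdiff_t x)] at hp
    exact h.immersion x X
      (h.eq_zero_of_mem_lift hq (h.normalTo_deriv_f x X).q (h.normalTo_deriv_f x X).p)
      (h.eq_zero_of_mem_lift hp (h.normalTo_deriv_t x X).q (h.normalTo_deriv_t x X).p)

/-- Curvature directions in terms of the differentials of a front and its normal. -/
lemma exists_curvature_direction (h : IsFront H f t) {x : M} {c : R42}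
    (hc : IsCurvatureSphere (legendreLift H f t) x c) :
    ∃ X : TangentSpace 𝓘(ℝ, Plane) x, X ≠ 0 ∧
      form c H.q • deriv1 f x X - form c H.p • deriv1 t x X = 0 := by
  obtain ⟨-, hcF, X, hX, hs⟩ := hc
  refine ⟨X, hX, ?_⟩
  -- The condition is tested on the section through c with constant coefficients. Its derivative
  -- lies in the contact element and is orthogonal to p and q, hence vanishes.
  have h1 := hs univ isOpen_univ (mem_univ _)
    (fun z => form c H.q • (H.q + f z) + (-form c H.p) • (H.p + t z))
    ⟨contMDiffOn_linearComb _ _ (h.isSection_q univ).1 (h.isSection_p univ).1, fun z _ =>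
      Submodule.add_mem _ (Submodule.smul_mem _ _ (Submodule.subset_span (by simp)))
        (Submodule.smul_mem _ _ (Submodule.subset_span (by simp)))⟩
    (by rw [neg_smul, ← sub_eq_add_neg]; exact (h.mem_lift_iff.1 hcF).symm)
  have d1 := (h.isSection_q univ).1.mdifferentiableOn (by simp) |>.mdifferentiableAt
    (univ_mem (f := 𝓝 x))
  have d2 := (h.isSection_p univ).1.mdifferentiableOn (by simp) |>.mdifferentiableAt
    (univ_mem (f := 𝓝 x))
  rw [deriv1_linearComb d1 d2] at h1
  rw [deriv1_const_add (h.mdiff_f x), deriv1_const_add (h.mdiff_t x), neg_smul,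
    ← sub_eq_add_neg] at h1
  have nn := ((h.normalTo_deriv_f x X).smul (form c H.q)).sub
    ((h.normalTo_deriv_t x X).smul (form c H.p))
  exact h.eq_zero_of_mem_lift h1 nn.q nn.p

end IsFront

lemma IsCurvatureSphere.smul {F : M → Submodule ℝ R42} {x : M} {c : R42}
    (h : IsCurvatureSphere F x c) {a : ℝ} (ha : a ≠ 0) : IsCurvatureSphere F x (a • c) := by
  obtain ⟨h0, hF, X, hX, hs⟩ := h
  refine ⟨smul_ne_zero ha h0, Submodule.smul_mem _ _ hF, X, hX, fun U hU hx σ hσ hσx => ?_⟩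
  have h1 := hs U hU hx (fun z => a⁻¹ • σ z)
    ⟨contMDiffOn_const_smul _ hσ.1, fun z hz => Submodule.smul_mem _ _ (hσ.2 z hz)⟩
    (by rw [hσx, smul_smul, inv_mul_cancel₀ ha, one_smul])
  rw [deriv1_const_smul (mdifferentiableAt_of_contMDiffOn hU hσ.1 hx)] at h1
  have := Submodule.smul_mem _ a h1
  rwa [smul_smul, mul_inv_cancel₀ ha, one_smul] at this

end Lift


/-! ### Principal frames of flat fronts -/

section Principal

variable {M : Type*} [TopologicalSpace M] [ChartedSpace Plane M]
  {H : HyperbolicModel} {f t : M → R42} {x : M}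

/-- The pair (P, N) is proportional to (n, -m), and the common factor is its component in this
direction. It is applied to P = dσ(X), N = dρ(X) in a curvature direction X. -/
lemma exists_common_factor {m n : ℝ} {P N : R42} (hmn : m ^ 2 + n ^ 2 ≠ 0)
    (h : m • P + n • N = 0) :
    P = n • ((m ^ 2 + n ^ 2)⁻¹ • (n • P - m • N)) ∧
      N = (-m) • ((m ^ 2 + n ^ 2)⁻¹ • (n • P - m • N)) := by
  have e : ∀ v : R42, v = ((m ^ 2 + n ^ 2)⁻¹ * (m ^ 2 + n ^ 2)) • v := fun v => by
    rw [inv_mul_cancel₀ hmn, one_smul]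
  constructor
  · calc P = ((m ^ 2 + n ^ 2)⁻¹ * (m ^ 2 + n ^ 2)) • P
          - ((m ^ 2 + n ^ 2)⁻¹ * m) • (m • P + n • N) := by rw [h, smul_zero, sub_zero, ← e]
      _ = _ := by module
  · calc N = ((m ^ 2 + n ^ 2)⁻¹ * (m ^ 2 + n ^ 2)) • N
          - ((m ^ 2 + n ^ 2)⁻¹ * n) • (m • P + n • N) := by rw [h, smul_zero, sub_zero, ← e]
      _ = _ := by module

/-- Written in dσ and dρ, the form in which flatness is evaluated on curvature directions, where dσ
and dρ are proportional. -/
lemma FlatAt.wedge_add (h : FlatAt f t x) (X Y : TangentSpace 𝓘(ℝ, Plane) x) (z w : R42) :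
    wedge (deriv1 t x X + deriv1 f x X) (deriv1 t x Y - deriv1 f x Y) z w
      + wedge (deriv1 t x X - deriv1 f x X) (deriv1 t x Y + deriv1 f x Y) z w = 0 := by
  have h1 := h X Y z w
  simp only [wedge, form_expand] at h1 ⊢
  linear_combination (-2) * h1

/-- Change of basis by q + f = (σ - ρ)/2 and p + t = (σ + ρ)/2. -/
lemma lift_expand {c p q f t : R42}
    (hc : c = form c q • (q + f) - form c p • (p + t)) :
    c = ((form c q - form c p) / 2) • ((p + q) + (t + f))
      + (-(form c q + form c p) / 2) • ((p - q) + (t - f)) := by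
  conv_lhs => rw [hc]
  module

namespace IsFront

lemma immersion_add_sub (h : IsFront H f t) (x : M) (X : TangentSpace 𝓘(ℝ, Plane) x)
    (h1 : deriv1 t x X + deriv1 f x X = 0) (h2 : deriv1 t x X - deriv1 f x X = 0) : X = 0 := by
  refine h.immersion x X ?_ ?_
  · have : deriv1 f x X = (1 / 2 : ℝ) • ((deriv1 t x X + deriv1 f x X)
      - (deriv1 t x X - deriv1 f x X)) := by module
    rw [this, h1, h2]; simp
  · have : deriv1 t x X = (1 / 2 : ℝ) • ((deriv1 t x X + deriv1 f x X)
      + (deriv1 t x X - deriv1 f x X)) := by module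
    rw [this, h1, h2]; simp

/-- In a principal frame, almost all parallel surfaces are immersed. -/
lemma exists_parallel_injective (h : IsFront H f t) {k : ℝ} {e₁ e₂ : R42} (hk : 0 < k)
    (he : IsFrame H.p H.q (f x) (t x) e₁ e₂)
    (hX : ∀ X : TangentSpace 𝓘(ℝ, Plane) x, ∃ a b : ℝ,
        deriv1 t x X + deriv1 f x X = k • (a • e₁ + b • e₂) ∧
        deriv1 t x X - deriv1 f x X = k⁻¹ • ((-a) • e₁ + b • e₂)) :
    ∃ a : ℝ, Function.Injective (deriv1 (parallelFront f t a) x) := by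
  -- Twice the differential of the parallel surface at distance d is eᵈdσ - e⁻ᵈdρ. In the frame its
  -- coefficients are eᵈk ± (eᵈk)⁻¹, so only eᵈk = 1 fails to immerse; the choice made here is eᵈk =
  -- e.
  refine ⟨1 - Real.log k, ?_⟩
  rw [injective_iff_map_eq_zero]
  intro X h0
  obtain ⟨a, b, h1, h2⟩ := hX X
  rw [h.deriv1_parallelFront] at h0
  have hexp : Real.exp (1 - Real.log k) = Real.exp 1 * k⁻¹ := by
    rw [sub_eq_add_neg, Real.exp_add, Real.exp_neg, Real.exp_log hk]
  have hexp' : Real.exp (-(1 - Real.log k)) = Real.exp (-1) * k := by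
    rw [neg_sub, sub_eq_add_neg, add_comm, Real.exp_add, Real.exp_log hk]
  have h3 : Real.exp (1 - Real.log k) • (deriv1 t x X + deriv1 f x X)
      - Real.exp (-(1 - Real.log k)) • (deriv1 t x X - deriv1 f x X) = 0 := by
    calc _ = (2 : ℝ) • (Real.cosh (1 - Real.log k) • deriv1 f x X
          + Real.sinh (1 - Real.log k) • deriv1 t x X) := by
          rw [Real.cosh_eq, Real.sinh_eq]; module
      _ = 0 := by rw [h0, smul_zero]
  rw [h1, h2, hexp, hexp', smul_smul, smul_smul, mul_assoc, mul_assoc, inv_mul_cancel₀ hk.ne',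
    mul_inv_cancel₀ hk.ne', mul_one, mul_one] at h3
  have p1 := congrArg (form · e₁) h3
  have p2 := congrArg (form · e₂) h3
  simp only [form_expand, he.norm₁, he.norm₂, he.orth, form_comm e₂ e₁] at p1 p2
  have pos1 := Real.exp_pos 1
  have pos2 := Real.exp_pos (-1)
  have hlt : Real.exp (-1) < Real.exp 1 := Real.exp_lt_exp.2 (by norm_num)
  have ha : a = 0 := by
    have : (Real.exp 1 + Real.exp (-1)) * a = 0 := by linear_combination p1
    exact (mul_eq_zero.1 this).resolve_left (by positivity)
  have hb : b = 0 := by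
    have : (Real.exp 1 - Real.exp (-1)) * b = 0 := by linear_combination p2
    exact (mul_eq_zero.1 this).resolve_left (by linarith)
  subst ha hb
  exact h.immersion_add_sub x X (by rw [h1]; simp) (by rw [h2]; simp)

variable [IsManifold 𝓘(ℝ, Plane) ∞ M]

lemma normalTo_add (h : IsFront H f t) (x : M) (X : TangentSpace 𝓘(ℝ, Plane) x) :
    IsNormalTo H.p H.q (f x) (t x) (deriv1 t x X + deriv1 f x X) :=
  (h.normalTo_deriv_t x X).add (h.normalTo_deriv_f x X)

lemma normalTo_sub (h : IsFront H f t) (x : M) (X : TangentSpace 𝓘(ℝ, Plane) x) :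
    IsNormalTo H.p H.q (f x) (t x) (deriv1 t x X - deriv1 f x X) :=
  (h.normalTo_deriv_t x X).sub (h.normalTo_deriv_f x X)

lemma form_add_sub_symm (h : IsFront H f t) (x : M) (X Y : TangentSpace 𝓘(ℝ, Plane) x) :
    form (deriv1 t x X + deriv1 f x X) (deriv1 t x Y - deriv1 f x Y)
      = form (deriv1 t x Y + deriv1 f x Y) (deriv1 t x X - deriv1 f x X) := by
  have h1 := h.second_symm x X Y
  simp only [form_expand, form_comm (deriv1 t x X), form_comm (deriv1 t x Y) (deriv1 f x X)]
  rw [form_comm (deriv1 f x Y) (deriv1 f x X), h1]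

lemma exists_curvature_direction' (h : IsFront H f t) {c : R42}
    (hc : IsCurvatureSphere (legendreLift H f t) x c) :
    ∃ (m n : ℝ) (X : TangentSpace 𝓘(ℝ, Plane) x), m ^ 2 + n ^ 2 ≠ 0 ∧ X ≠ 0 ∧
      c = m • ((H.p + H.q) + (t x + f x)) + n • ((H.p - H.q) + (t x - f x)) ∧
      m • (deriv1 t x X + deriv1 f x X) + n • (deriv1 t x X - deriv1 f x X) = 0 := by
  obtain ⟨X, hX, hd⟩ := h.exists_curvature_direction hc
  have hce := lift_expand (h.mem_lift_iff.1 hc.2.1)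
  refine ⟨_, _, X, ?_, hX, hce, ?_⟩
  · intro h0
    have h1 : (form c H.q - form c H.p) / 2 = 0 := by nlinarith
    have h2 : -(form c H.q + form c H.p) / 2 = 0 := by nlinarith
    rw [h1, h2] at hce
    exact hc.1 (by simpa using hce)
  · rw [← hd]; module

/-- The curvature spheres of a flat front are harmonic with respect to the spheres which touch
the infinity spheres, and curvature directions are orthogonal. -/
lemma exists_principal (h : IsFront H f t) (hflat : FlatAt f t x) {c₁ c₂ : R42}
    (hli : LinearIndependent ℝ ![c₁, c₂]) (hc₁ : IsCurvatureSphere (legendreLift H f t) x c₁)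
    (hc₂ : IsCurvatureSphere (legendreLift H f t) x c₂) :
    ∃ (m n : ℝ) (v₁ v₂ : R42) (X₁ X₂ : TangentSpace 𝓘(ℝ, Plane) x), m ≠ 0 ∧ n ≠ 0 ∧
      IsNormalTo H.p H.q (f x) (t x) v₁ ∧ IsNormalTo H.p H.q (f x) (t x) v₂ ∧
      v₁ ≠ 0 ∧ v₂ ≠ 0 ∧ form v₁ v₂ = 0 ∧
      deriv1 t x X₁ + deriv1 f x X₁ = n • v₁ ∧ deriv1 t x X₁ - deriv1 f x X₁ = (-m) • v₁ ∧
      deriv1 t x X₂ + deriv1 f x X₂ = n • v₂ ∧ deriv1 t x X₂ - deriv1 f x X₂ = m • v₂ ∧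
      IsCurvatureSphere (legendreLift H f t) x
        (m • ((H.p + H.q) + (t x + f x)) + n • ((H.p - H.q) + (t x - f x))) ∧
      IsCurvatureSphere (legendreLift H f t) x
        (m • ((H.p + H.q) + (t x + f x)) - n • ((H.p - H.q) + (t x - f x))) := by
  obtain ⟨m, n, X₁, hmn, hX₁, hc1, hd1⟩ := h.exists_curvature_direction' hc₁
  obtain ⟨m', n', X₂, hmn', hX₂, hc2, hd2⟩ := h.exists_curvature_direction' hc₂
  have hT := h.tetrad x
  obtain ⟨hP1, hN1⟩ := exists_common_factor hmn hd1
  obtain ⟨hP2, hN2⟩ := exists_common_factor hmn' hd2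
  have nv1 := (((h.normalTo_add x X₁).smul n).sub ((h.normalTo_sub x X₁).smul m)).smul
    (m ^ 2 + n ^ 2)⁻¹
  have nv2 := (((h.normalTo_add x X₂).smul n').sub ((h.normalTo_sub x X₂).smul m')).smul
    (m' ^ 2 + n' ^ 2)⁻¹
  set v₁ : R42 := (m ^ 2 + n ^ 2)⁻¹ • (n • (deriv1 t x X₁ + deriv1 f x X₁)
    - m • (deriv1 t x X₁ - deriv1 f x X₁))
  set v₂ : R42 := (m' ^ 2 + n' ^ 2)⁻¹ • (n' • (deriv1 t x X₂ + deriv1 f x X₂)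
    - m' • (deriv1 t x X₂ - deriv1 f x X₂))
  clear_value v₁ v₂
  have hv1 : v₁ ≠ 0 := by
    intro h0
    rw [h0, smul_zero] at hP1 hN1
    exact hX₁ (h.immersion_add_sub x X₁ hP1 hN1)
  have hv2 : v₂ ≠ 0 := by
    intro h0
    rw [h0, smul_zero] at hP2 hN2
    exact hX₂ (h.immersion_add_sub x X₂ hP2 hN2)
  have hdet : m * n' - m' * n ≠ 0 := by
    intro h0
    rw [LinearIndependent.pair_iff] at hli
    set σ := (H.p + H.q) + (t x + f x)
    set ρ := (H.p - H.q) + (t x - f x)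
    have h1 := hli n' (-n) (by
      rw [hc1, hc2]
      calc _ = (m * n' - m' * n) • σ := by module
        _ = 0 := by rw [h0, zero_smul])
    have h2 := hli m' (-m) (by
      rw [hc1, hc2]
      calc _ = (-(m * n' - m' * n)) • ρ := by module
        _ = 0 := by rw [h0, neg_zero, zero_smul])
    have hm : m = 0 := by linarith [h2.2]
    have hn : n = 0 := by linarith [h1.2]
    exact hmn (by rw [hm, hn]; norm_num)
  -- With dσ(X₁) = n v₁, dρ(X₁) = -m v₁ and likewise for X₂, symmetry of the second fundamental form
  -- reads (mn' - m'n)(v₁, v₂) = 0. The factor is nonzero as the curvature spheres are distinct.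
  have hsym := h.form_add_sub_symm x X₁ X₂
  rw [hP1, hN1, hP2, hN2] at hsym
  have horth : form v₁ v₂ = 0 := by
    simp only [form_expand, form_comm v₂ v₁] at hsym
    have : (m * n' - m' * n) * form v₁ v₂ = 0 := by linear_combination hsym
    exact (mul_eq_zero.1 this).resolve_left hdet
  have hw := hflat.wedge_add X₁ X₂ v₁ v₂
  rw [hP1, hN1, hP2, hN2] at hw
  -- Evaluating flatness on v₁ ∧ v₂ gives (nm' + mn')|v₁|²|v₂|² = 0, and normal vectors have
  -- positive norm. This is the harmonic position of the curvature spheres.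
  have hharm : n * m' + m * n' = 0 := by
    simp only [wedge, form_expand, form_comm v₂ v₁, horth] at hw
    have h1 := (nv1.pos hT hv1).ne'
    have h2 := (nv2.pos hT hv2).ne'
    have : (n * m' + m * n') * (form v₁ v₁ * form v₂ v₂) = 0 := by linear_combination -hw
    exact (mul_eq_zero.1 this).resolve_right (mul_ne_zero h1 h2)
  have hm : m ≠ 0 := by rintro rfl; apply hdet; linarith
  have hn : n ≠ 0 := by rintro rfl; apply hdet; linarith
  have hn' : n' ≠ 0 := by
    rintro rfl
    have : m' = 0 := by simpa [hn] using hharm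
    exact hdet (by rw [this]; ring)
  have hm' : m' = -(m * n') / n := by field_simp; linarith
  -- Rescaling v₂ by n'/n turns (n', -m') into (n, m), so that both principal directions are
  -- described by the same m and n.
  refine ⟨m, n, v₁, (n' / n) • v₂, X₁, X₂, hm, hn, nv1, nv2.smul _, hv1,
    smul_ne_zero (div_ne_zero hn' hn) hv2, by rw [form_smul_right, horth, mul_zero], hP1, hN1,
    ?_, ?_, hc1 ▸ hc₁, ?_⟩
  · rw [hP2, smul_smul]; congr 1; field_simp
  · rw [hN2, smul_smul, hm']; congr 1; field_simp
  · have := hc₂.smul (a := -n / n') (div_ne_zero (neg_ne_zero.2 hn) hn')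
    rw [hc2, smul_add, smul_smul, smul_smul, hm'] at this
    convert this using 2
    rw [sub_eq_add_neg, ← neg_smul]
    congr 2 <;> field_simp

/-- An orthonormal frame `e₁, e₂` of principal directions of a flat front: the differentials of
`t ± f` are diagonal, with coefficients determined by a single positive number `k`. -/
lemma exists_principal_frame (h : IsFront H f t) (hflat : FlatAt f t x) {c₁ c₂ : R42}
    (hli : LinearIndependent ℝ ![c₁, c₂]) (hc₁ : IsCurvatureSphere (legendreLift H f t) x c₁)
    (hc₂ : IsCurvatureSphere (legendreLift H f t) x c₂) :
    ∃ (k : ℝ) (e₁ e₂ : R42), 0 < k ∧ IsFrame H.p H.q (f x) (t x) e₁ e₂ ∧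
      ∀ X : TangentSpace 𝓘(ℝ, Plane) x, ∃ a b : ℝ,
        deriv1 t x X + deriv1 f x X = k • (a • e₁ + b • e₂) ∧
        deriv1 t x X - deriv1 f x X = k⁻¹ • ((-a) • e₁ + b • e₂) := by
  obtain ⟨m, n, v₁, v₂, X₁, X₂, hm, hn, nv1, nv2, hv1, hv2, horth, hP1, hN1, hP2, hN2, -, -⟩ :=
    h.exists_principal hflat hli hc₁ hc₂
  have hT := h.tetrad x
  -- the general step, up to the order of the two principal directions
  have key : ∀ (l : ℝ) (v₁ v₂ : R42), 0 < l → IsNormalTo H.p H.q (f x) (t x) v₁ →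
      IsNormalTo H.p H.q (f x) (t x) v₂ → v₁ ≠ 0 → v₂ ≠ 0 → form v₁ v₂ = 0 →
      (∀ X, form (deriv1 t x X - deriv1 f x X) v₁
        = -l * form (deriv1 t x X + deriv1 f x X) v₁) →
      (∀ X, form (deriv1 t x X - deriv1 f x X) v₂
        = l * form (deriv1 t x X + deriv1 f x X) v₂) →
      ∃ (k : ℝ) (e₁ e₂ : R42), 0 < k ∧ IsFrame H.p H.q (f x) (t x) e₁ e₂ ∧
        ∀ X : TangentSpace 𝓘(ℝ, Plane) x, ∃ a b : ℝ,
          deriv1 t x X + deriv1 f x X = k • (a • e₁ + b • e₂) ∧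
          deriv1 t x X - deriv1 f x X = k⁻¹ • ((-a) • e₁ + b • e₂) := by
    clear * - hT h
    intro l v₁ v₂ hl nv1 nv2 hv1 hv2 horth h1 h2
    have he : IsFrame H.p H.q (f x) (t x) ((√(form v₁ v₁))⁻¹ • v₁) ((√(form v₂ v₂))⁻¹ • v₂) :=
      ⟨nv1.smul _, nv2.smul _, form_inv_sqrt_smul (nv1.pos hT hv1),
        form_inv_sqrt_smul (nv2.pos hT hv2), by simp [form_expand, horth]⟩
    have h1' : ∀ X, form (deriv1 t x X - deriv1 f x X) ((√(form v₁ v₁))⁻¹ • v₁)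
        = -l * form (deriv1 t x X + deriv1 f x X) ((√(form v₁ v₁))⁻¹ • v₁) := fun X => by
      rw [form_smul_right, form_smul_right, h1]; ring
    have h2' : ∀ X, form (deriv1 t x X - deriv1 f x X) ((√(form v₂ v₂))⁻¹ • v₂)
        = l * form (deriv1 t x X + deriv1 f x X) ((√(form v₂ v₂))⁻¹ • v₂) := fun X => by
      rw [form_smul_right, form_smul_right, h2]; ring
    generalize (√(form v₁ v₁))⁻¹ • v₁ = e₁ at *
    generalize (√(form v₂ v₂))⁻¹ • v₂ = e₂ at *
    have hl0 := (Real.sqrt_pos.2 hl).ne'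
    have hs := Real.mul_self_sqrt hl.le
    -- The components of dρ are ∓l times those of dσ, and k must satisfy k⁻¹/k = l.
    refine ⟨(√l)⁻¹, e₁, e₂, inv_pos.2 (Real.sqrt_pos.2 hl), he, fun X =>
      ⟨√l * form (deriv1 t x X + deriv1 f x X) e₁,
        √l * form (deriv1 t x X + deriv1 f x X) e₂, ?_, ?_⟩⟩
    · conv_lhs => rw [he.expand hT (h.normalTo_add x X)]
      rw [smul_add, smul_smul, smul_smul, inv_mul_cancel_left₀ hl0, inv_mul_cancel_left₀ hl0]
    · conv_lhs => rw [he.expand hT (h.normalTo_sub x X), h1', h2', ← hs]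
      rw [inv_inv]
      module
  have r1 : ∀ X, form (deriv1 t x X - deriv1 f x X) v₁
      = -(m / n) * form (deriv1 t x X + deriv1 f x X) v₁ := by
    intro X
    have := h.form_add_sub_symm x X X₁
    rw [hP1, hN1, form_smul_right, form_smul_left, form_comm v₁] at this
    field_simp; linarith
  have r2 : ∀ X, form (deriv1 t x X - deriv1 f x X) v₂
      = (m / n) * form (deriv1 t x X + deriv1 f x X) v₂ := by
    intro X
    have := h.form_add_sub_symm x X X₂
    rw [hP2, hN2, form_smul_right, form_smul_left, form_comm v₂] at this
    field_simp; linarith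
  -- Exchanging the two principal directions changes the sign of m/n, so it may be assumed positive.
  rcases lt_or_gt_of_ne (div_ne_zero hm hn) with hl | hl
  · exact key (-(m / n)) v₂ v₁ (by linarith) nv2 nv1 hv2 hv1 (by rw [form_comm, horth])
      (fun X => by rw [r2, neg_neg]) r1
  · exact key (m / n) v₁ v₂ hl nv1 nv2 hv1 hv2 horth r1 r2

/-- Harmonic separation of the curvature spheres implies flatness. -/
lemma flatAt_of_harmonic (h : IsFront H f t) {c₁ c₂ : R42}
    (hc₁ : IsCurvatureSphere (legendreLift H f t) x c₁)
    (hc₂ : IsCurvatureSphere (legendreLift H f t) x c₂)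
    (hp : Submodule.span ℝ {(H.p + H.q) + (t x + f x)} = Submodule.span ℝ {c₁ + c₂})
    (hm : Submodule.span ℝ {(H.p - H.q) + (t x - f x)} = Submodule.span ℝ {c₁ - c₂}) :
    FlatAt f t x := by
  have T := h.tetrad x
  obtain ⟨m, n, X₁, hmn, hX₁, hc1, hd1⟩ := h.exists_curvature_direction' hc₁
  obtain ⟨m', n', X₂, hmn', hX₂, hc2, hd2⟩ := h.exists_curvature_direction' hc₂
  set σ := (H.p + H.q) + (t x + f x) with hσ
  set ρ := (H.p - H.q) + (t x - f x) with hρ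
  have hσm : c₁ + c₂ ∈ Submodule.span ℝ {σ} := hp ▸ Submodule.mem_span_singleton_self _
  have hρm : c₁ - c₂ ∈ Submodule.span ℝ {ρ} := hm ▸ Submodule.mem_span_singleton_self _
  obtain ⟨α, hα⟩ := Submodule.mem_span_singleton.1 hσm
  obtain ⟨β, hβ⟩ := Submodule.mem_span_singleton.1 hρm
  rw [hc1, hc2] at hα hβ
  have fσp : form σ (H.p + H.q) = 0 := by
    simp [hσ, form_expand, T.pp, T.qq, T.pq, T.fp, T.fq, T.tp, T.tq, form_comm H.q H.p]
  have fσm : form σ (H.p - H.q) = -2 := by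
    simp [hσ, form_expand, T.pp, T.qq, T.pq, T.fp, T.fq, T.tp, T.tq, form_comm H.q H.p]; norm_num
  have fρp : form ρ (H.p + H.q) = -2 := by
    simp [hρ, form_expand, T.pp, T.qq, T.pq, T.fp, T.fq, T.tp, T.tq, form_comm H.q H.p]; norm_num
  have fρm : form ρ (H.p - H.q) = 0 := by
    simp [hρ, form_expand, T.pp, T.qq, T.pq, T.fp, T.fq, T.tp, T.tq, form_comm H.q H.p]
  -- As c₁ + c₂ has no component along ρ and c₁ - c₂ none along σ, the curvature spheres are mσ ±
  -- nρ. Pairing with p+q isolates the coefficient of ρ, pairing with p-q that of σ.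
  have hn' : n' = -n := by
    have := congrArg (form · (H.p + H.q)) hα
    simp only [form_add_left, form_smul_left, fσp, fρp] at this
    linarith
  have hm' : m' = m := by
    have := congrArg (form · (H.p - H.q)) hβ
    simp only [form_add_left, form_sub_left, form_smul_left, fσm, fρm] at this
    linarith
  subst hn' hm'
  have hσ0 : σ ≠ 0 := by intro h0; rw [h0, form_zero_left] at fσm; norm_num at fσm
  have hρ0 : ρ ≠ 0 := by intro h0; rw [h0, form_zero_left] at fρp; norm_num at fρp
  have hm0 : m' ≠ 0 := by
    rintro rfl
    have h1 : c₁ + c₂ = 0 := by rw [hc1, hc2]; module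
    rw [h1, Submodule.span_zero_singleton, Submodule.span_singleton_eq_bot] at hp
    exact hσ0 hp
  have hn0 : n ≠ 0 := by
    rintro rfl
    have h1 : c₁ - c₂ = 0 := by rw [hc1, hc2]; module
    rw [h1, Submodule.span_zero_singleton, Submodule.span_singleton_eq_bot] at hm
    exact hρ0 hm
  obtain ⟨hP1, hN1⟩ := exists_common_factor hmn hd1
  obtain ⟨hP2, hN2⟩ := exists_common_factor hmn' hd2
  set v₁ : R42 := (m' ^ 2 + n ^ 2)⁻¹ • (n • (deriv1 t x X₁ + deriv1 f x X₁)
    - m' • (deriv1 t x X₁ - deriv1 f x X₁))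
  set v₂ : R42 := (m' ^ 2 + (-n) ^ 2)⁻¹ • ((-n) • (deriv1 t x X₂ + deriv1 f x X₂)
    - m' • (deriv1 t x X₂ - deriv1 f x X₂))
  -- On a common direction both m dσ + n dρ and m dσ - n dρ would vanish, hence dσ and dρ, against
  -- the immersion property. Flatness may then be checked on the basis X₁, X₂, where both sides
  -- equal (m² - n²)/4 times v₁ ∧ v₂.
  have hli : LinearIndependent ℝ ![X₁, X₂] := by
    rw [LinearIndependent.pair_iff' hX₁]
    rintro r rfl
    have hr : r ≠ 0 := by rintro rfl; exact hX₂ (zero_smul _ _)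
    rw [map_smul, map_smul, ← smul_add, ← smul_sub, smul_comm m', smul_comm (-n), ← smul_add] at hd2
    have hd2' := (smul_eq_zero.1 hd2).resolve_left hr
    apply hX₁
    apply h.immersion_add_sub x X₁
    · have : (2 * m') • (deriv1 t x X₁ + deriv1 f x X₁) = 0 := by
        rw [neg_smul] at hd2'
        calc _ = (m' • (deriv1 t x X₁ + deriv1 f x X₁) + n • (deriv1 t x X₁ - deriv1 f x X₁))
          + (m' • (deriv1 t x X₁ + deriv1 f x X₁) + -(n • (deriv1 t x X₁ - deriv1 f x X₁))) := by
              module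
          _ = 0 := by rw [hd1, hd2', add_zero]
      exact (smul_eq_zero.1 this).resolve_left (by simpa using hm0)
    · have : (2 * n) • (deriv1 t x X₁ - deriv1 f x X₁) = 0 := by
        rw [neg_smul] at hd2'
        calc _ = (m' • (deriv1 t x X₁ + deriv1 f x X₁) + n • (deriv1 t x X₁ - deriv1 f x X₁))
          - (m' • (deriv1 t x X₁ + deriv1 f x X₁) + -(n • (deriv1 t x X₁ - deriv1 f x X₁))) := by
              module
          _ = 0 := by rw [hd1, hd2', sub_zero]
      exact (smul_eq_zero.1 this).resolve_left (by simpa using hn0)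
  have hspan : ∀ X : TangentSpace 𝓘(ℝ, Plane) x, ∃ r s : ℝ, r • X₁ + s • X₂ = X := by
    intro X
    have htop := hli.span_eq_top_of_card_eq_finrank
      (by rw [Fintype.card_fin]; exact (finrank_euclideanSpace_fin (𝕜 := ℝ) (n := 2)).symm)
    rw [Matrix.range_cons_cons_empty] at htop
    exact Submodule.mem_span_pair.1 (htop ▸ Submodule.mem_top)
  intro X Y z w
  obtain ⟨r, s, rfl⟩ := hspan X
  obtain ⟨r', s', rfl⟩ := hspan Y
  have e1 : deriv1 f x X₁ = (1 / 2 : ℝ) • (n • v₁ - (-m') • v₁) := by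
    rw [← hP1, ← hN1]; module
  have e2 : deriv1 f x X₂ = (1 / 2 : ℝ) • ((-n) • v₂ - (-m') • v₂) := by
    rw [← hP2, ← hN2]; module
  have e3 : deriv1 t x X₁ = (1 / 2 : ℝ) • (n • v₁ + (-m') • v₁) := by
    rw [← hP1, ← hN1]; module
  have e4 : deriv1 t x X₂ = (1 / 2 : ℝ) • ((-n) • v₂ + (-m') • v₂) := by
    rw [← hP2, ← hN2]; module
  simp only [map_add, map_smul, e1, e2, e3, e4, wedge, form_expand]
  ring

/-- Injectivity is an open condition on linear maps and the differential is continuous. Flatness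
asks for an immersed parallel surface on a neighbourhood, whereas the principal frame provides one
only at the point. -/
lemma eventually_injective (h : IsFront H f t) (hx : Function.Injective (deriv1 f x)) :
    ∀ᶠ z in 𝓝 x, Function.Injective (deriv1 f z) := by
  obtain ⟨ψ, hψ, y, hy, rfl⟩ := exists_chart_point x
  have key : ∀ z ∈ ψ.target, Function.Injective (fderiv ℝ (f ∘ ψ.symm) z)
      ↔ Function.Injective (deriv1 f (ψ.symm z)) := by
    intro z hz
    have : (fderiv ℝ (f ∘ ψ.symm) z : Plane → R42) = deriv1 f (ψ.symm z) ∘ chartVec ψ z := by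
      funext e; exact fderiv_comp_symm hψ hz (h.mdiff_f _) e
    rw [this]
    exact Function.Injective.of_comp_iff' _ (chartVec_bijective hψ hz)
  have hcont : ContinuousAt (fderiv ℝ (f ∘ ψ.symm)) y :=
    ((h.contDiffOn_f hψ).continuousOn_fderiv_of_isOpen ψ.open_target (by simp)).continuousAt
      (ψ.open_target.mem_nhds hy)
  have hev := hcont.preimage_mem_nhds
    (ContinuousLinearMap.isOpen_injective.mem_nhds ((key y hy).2 hx))
  have hψc : ContinuousAt ψ (ψ.symm y) := ψ.continuousAt (ψ.map_target hy)
  have hs := ψ.open_source.mem_nhds (ψ.map_target hy)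
  have hev' : ∀ᶠ z in 𝓝 (ψ.symm y), Function.Injective (fderiv ℝ (f ∘ ψ.symm) (ψ z)) := by
    refine hψc.eventually (p := fun z => Function.Injective (fderiv ℝ (f ∘ ψ.symm) z)) ?_
    rw [ψ.right_inv hy]
    exact hev
  filter_upwards [hev', hs] with z hz hzs
  have := (key _ (ψ.map_source hzs)).1 hz
  rwa [ψ.left_inv hzs] at this

end IsFront

/-- Flatness in terms of determinants of differentials. -/
lemma IsFlatFront.flatAt [IsManifold 𝓘(ℝ, Plane) ∞ M] (h : IsFlatFront H f t) (x : M) :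
    FlatAt f t x := by
  obtain ⟨a, ha⟩ := h.flat x
  obtain ⟨hinj, hK⟩ := ha.self_of_nhds
  exact (h.front.flatAt_parallel_iff a x).1
    (((h.front.parallel a).gaussCurvature_eq_zero_iff x hinj).1 hK)

/-- The surface itself may be singular; the principal frame supplies a distance at which the
parallel surface is immersed near the point, and `FlatAt` passes to it. -/
lemma IsFront.isFlatFront [IsManifold 𝓘(ℝ, Plane) ∞ M] (h : IsFront H f t)
    (hflat : ∀ x, FlatAt f t x) (hu : UmbilicFree (legendreLift H f t)) : IsFlatFront H f t := by
  refine ⟨h, fun x => ?_⟩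
  obtain ⟨c₁, c₂, hli, hc₁, hc₂⟩ := hu x
  obtain ⟨k, e₁, e₂, hk, he, hX⟩ := h.exists_principal_frame (hflat x) hli hc₁ hc₂
  obtain ⟨a, ha⟩ := h.exists_parallel_injective hk he hX
  refine ⟨a, ((h.parallel a).eventually_injective ha).mono fun z hz => ⟨hz, ?_⟩⟩
  exact ((h.parallel a).gaussCurvature_eq_zero_iff z hz).2
    ((h.flatAt_parallel_iff a z).2 (hflat z))

lemma IsFlatFront.parallel [IsManifold 𝓘(ℝ, Plane) ∞ M] (h : IsFlatFront H f t) (a : ℝ) :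
    IsFlatFront (H.parallel a) (parallelFront f t a) (parallelNormal f t a) := by
  refine ⟨h.front.parallel a, fun x => ?_⟩
  obtain ⟨b, hb⟩ := h.flat x
  refine ⟨b - a, ?_⟩
  rwa [parallelFront_parallelFront, add_sub_cancel]

end Principal


/-! ### Coordinates with prescribed differentials -/

/-- Closed 1-forms on convex domains are exact. -/
lemma exists_pd_eq_of_closed {B : Set Plane} (hB : IsOpen B) (hconv : Convex ℝ B)
    {α : Fin 2 → Plane → ℝ} (hα : ∀ i, ContDiffOn ℝ ∞ (α i) B)
    (hcl : ∀ y ∈ B, pd 1 (α 0) y = pd 0 (α 1) y) :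
    ∃ u : Plane → ℝ, ContDiffOn ℝ ∞ u B ∧ ∀ y ∈ B, ∀ i, pd i u y = α i y := by
  let pr : Fin 2 → Plane →L[ℝ] ℝ := fun i => EuclideanSpace.proj i
  let β : Plane → Plane →L[ℝ] ℝ := fun y => α 0 y • pr 0 + α 1 y • pr 1
  have hβ : ContDiffOn ℝ ∞ β B :=
    ((hα 0).smul contDiffOn_const).add ((hα 1).smul contDiffOn_const)
  have hd : ∀ y ∈ B, ∀ i, DifferentiableAt ℝ (α i) y := fun y hy i =>
    ((hα i).contDiffAt (hB.mem_nhds hy)).differentiableAt (by simp)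
  have hpr : ∀ i (e : Plane), pr i e = e i := fun _ _ => rfl
  have hsymm : ∀ y ∈ B, ∀ e e', fderiv ℝ β y e e' = fderiv ℝ β y e' e := by
    intro y hy e e'
    have hf : fderiv ℝ β y = (fderiv ℝ (α 0) y).smulRight (pr 0)
        + (fderiv ℝ (α 1) y).smulRight (pr 1) :=
      (((hd y hy 0).hasFDerivAt.smul_const (pr 0)).add
        ((hd y hy 1).hasFDerivAt.smul_const (pr 1))).fderiv
    have h1 := hcl y hy
    rw [hf]
    simp only [add_apply, ContinuousLinearMap.smulRight_apply, smul_apply, fderiv_eq_pd,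
      smul_eq_mul, hpr, h1]
    ring
  obtain ⟨u, hu⟩ := hconv.exists_forall_hasFDerivAt_of_fderiv_symmetric hB
    (hβ.differentiableOn (by simp)) hsymm
  refine ⟨u, ?_, fun y hy i => ?_⟩
  · rw [contDiffOn_infty_iff_fderiv_of_isOpen hB]
    exact ⟨fun y hy => (hu y hy).differentiableAt.differentiableWithinAt,
      hβ.congr fun y hy => (hu y hy).fderiv⟩
  · rw [pd, (hu y hy).fderiv]
    fin_cases i <;> simp [β, pr]

/-- Two functions with independent differentials are local coordinates of the plane. -/
lemma exists_chart_of_independent {B : Set Plane} (hB : IsOpen B) {u v : Plane → ℝ}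
    (hu : ContDiffOn ℝ ∞ u B) (hv : ContDiffOn ℝ ∞ v B)
    (hdet : ∀ y ∈ B, pd 0 u y * pd 1 v y - pd 1 u y * pd 0 v y ≠ 0) {y₀ : Plane} (hy₀ : y₀ ∈ B) :
    ∃ φ : OpenPartialHomeomorph Plane Plane, y₀ ∈ φ.source ∧ φ.source ⊆ B ∧
      ContDiffOn ℝ ∞ φ φ.source ∧ ContDiffOn ℝ ∞ φ.symm φ.target ∧
      ∀ y ∈ φ.source, ∀ g : Plane → R42, DifferentiableAt ℝ g y → ∀ i,
        pd i g y = pd i u y • pd 0 (g ∘ φ.symm) (φ y) + pd i v y • pd 1 (g ∘ φ.symm) (φ y) := by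
  let Φ : Plane → Plane := fun y => !₂[u y, v y]
  have hΦ : ContDiffOn ℝ ∞ Φ B := by
    rw [contDiffOn_euclidean]
    intro i
    fin_cases i
    · exact hu
    · exact hv
  have hΦd : ∀ y ∈ B, HasFDerivAt Φ (fderiv ℝ Φ y) y := fun y hy =>
    ((hΦ.contDiffAt (hB.mem_nhds hy)).differentiableAt (by simp)).hasFDerivAt
  have c0 : ∀ y ∈ B, ∀ e, (fderiv ℝ Φ y e) 0 = fderiv ℝ u y e := fun y hy e => by
    have := ((EuclideanSpace.proj (0 : Fin 2) : Plane →L[ℝ] ℝ).hasFDerivAt.comp y (hΦd y hy)).fderiv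
    have h2 : (EuclideanSpace.proj (0 : Fin 2) : Plane →L[ℝ] ℝ) ∘ Φ = u := by
      funext z; simp [Φ]
    rw [h2] at this
    rw [this]; simp
  have c1 : ∀ y ∈ B, ∀ e, (fderiv ℝ Φ y e) 1 = fderiv ℝ v y e := fun y hy e => by
    have := ((EuclideanSpace.proj (1 : Fin 2) : Plane →L[ℝ] ℝ).hasFDerivAt.comp y (hΦd y hy)).fderiv
    have h2 : (EuclideanSpace.proj (1 : Fin 2) : Plane →L[ℝ] ℝ) ∘ Φ = v := by
      funext z; simp [Φ]
    rw [h2] at this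
    rw [this]; simp
  have hinj : ∀ y ∈ B, Function.Injective (fderiv ℝ Φ y) := by
    intro y hy
    rw [injective_iff_map_eq_zero]
    intro e he
    have e0 := c0 y hy e
    have e1 := c1 y hy e
    rw [he, fderiv_eq_pd] at e0 e1
    simp only [PiLp.zero_apply, smul_eq_mul] at e0 e1
    have hd := hdet y hy
    have z0 : (pd 0 u y * pd 1 v y - pd 1 u y * pd 0 v y) * e 0 = 0 := by
      linear_combination pd 1 u y * e1 - pd 1 v y * e0
    have z1 : (pd 0 u y * pd 1 v y - pd 1 u y * pd 0 v y) * e 1 = 0 := by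
      linear_combination pd 0 v y * e0 - pd 0 u y * e1
    ext i
    fin_cases i
    · exact (mul_eq_zero.1 z0).resolve_left hd
    · exact (mul_eq_zero.1 z1).resolve_left hd
  have hequiv : ∀ y ∈ B, ∃ L : Plane ≃L[ℝ] Plane, (L : Plane →L[ℝ] Plane) = fderiv ℝ Φ y := by
    intro y hy
    have hk : (fderiv ℝ Φ y : Plane →ₗ[ℝ] Plane).ker = ⊥ := LinearMap.ker_eq_bot.2 (hinj y hy)
    refine ⟨ContinuousLinearEquiv.ofBijective (fderiv ℝ Φ y) hk
      (LinearMap.ker_eq_bot_iff_range_eq_top.1 hk), ?_⟩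
    ext e : 1
    rfl
  obtain ⟨L₀, hL₀⟩ := hequiv y₀ hy₀
  have h0 : HasFDerivAt Φ (L₀ : Plane →L[ℝ] Plane) y₀ := hL₀ ▸ hΦd y₀ hy₀
  have hcd := hΦ.contDiffAt (hB.mem_nhds hy₀)
  let φ := (hcd.toOpenPartialHomeomorph Φ h0 (by simp)).restrOpen B hB
  have hφ : (φ : Plane → Plane) = Φ := rfl
  have hsub : φ.source ⊆ B := inter_subset_right
  refine ⟨φ, ⟨hcd.mem_toOpenPartialHomeomorph_source h0 (by simp), hy₀⟩, hsub, hΦ.mono hsub, ?_, ?_⟩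
  · intro z hz
    have hzB := hsub (φ.map_target hz)
    obtain ⟨L, hL⟩ := hequiv _ hzB
    exact (φ.contDiffAt_symm hz (f₀' := L) (by rw [hL]; exact hΦd _ hzB)
      (hΦ.contDiffAt (hB.mem_nhds hzB))).contDiffWithinAt
  · intro y hy g hg i
    have hyB := hsub hy
    have hsymm : DifferentiableAt ℝ φ.symm (φ y) := by
      obtain ⟨L, hL⟩ := hequiv _ hyB
      refine (φ.contDiffAt_symm (n := ∞) (φ.map_source hy) (f₀' := L) ?_ ?_).differentiableAt
        (by simp)
      · rw [φ.left_inv hy, hL]; exact hΦd _ hyB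
      · rw [φ.left_inv hy]; exact hΦ.contDiffAt (hB.mem_nhds hyB)
    have hg' : DifferentiableAt ℝ (g ∘ φ.symm) (φ y) := by
      apply DifferentiableAt.comp _ _ hsymm
      rwa [φ.left_inv hy]
    have heq : g =ᶠ[𝓝 y] (g ∘ φ.symm) ∘ Φ := by
      filter_upwards [φ.open_source.mem_nhds hy] with z hz
      change g z = g (φ.symm (φ z))
      rw [φ.left_inv hz]
    have hcomp : fderiv ℝ ((g ∘ φ.symm) ∘ Φ) y = (fderiv ℝ (g ∘ φ.symm) (φ y)).comp (fderiv ℝ Φ y) :=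
      fderiv_comp y hg' (hΦd y hyB).differentiableAt
    rw [pd_congr heq, pd, hcomp, ContinuousLinearMap.comp_apply, fderiv_eq_pd, c0 y hyB, c1 y hyB]
    rfl

/-! ### Closed forms from principal frames -/

/-- If the vector-valued 1-form `k⁻¹ dσ - k dρ` has rank one at every point, with orthogonal
complementary part, then it is the product of a unit field and a closed 1-form. -/
lemma exists_closed_form {σ ρ : Plane → R42} {k : Plane → ℝ} {U : Set Plane} (hU : IsOpen U)
    (hσ : ContDiffOn ℝ ∞ σ U) (hρ : ContDiffOn ℝ ∞ ρ U) (hk : ContDiffOn ℝ ∞ k U)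
    (hpos : ∀ y ∈ U, 0 < k y)
    (hrep : ∀ y ∈ U, ∃ (e₁ e₂ : R42) (a b : Fin 2 → ℝ), form e₁ e₁ = 1 ∧ form e₁ e₂ = 0 ∧
      ∀ i, pd i σ y = k y • (a i • e₁ + b i • e₂) ∧ pd i ρ y = (k y)⁻¹ • ((-a i) • e₁ + b i • e₂))
    {y₀ : Plane} (hy₀ : y₀ ∈ U) (hne : ∃ w, (k y₀)⁻¹ • pd w σ y₀ - k y₀ • pd w ρ y₀ ≠ 0) :
    ∃ V ⊆ U, IsOpen V ∧ y₀ ∈ V ∧ ∃ (e : Plane → R42) (α : Fin 2 → Plane → ℝ),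
      (∀ i, ContDiffOn ℝ ∞ (α i) V) ∧ (∀ y ∈ V, pd 1 (α 0) y = pd 0 (α 1) y) ∧
      ∀ y ∈ V, form (e y) (e y) = 1 ∧
        ∀ i, (k y)⁻¹ • pd i σ y - k y • pd i ρ y = (2 * α i y) • e y := by
  obtain ⟨w, hw⟩ := hne
  have hkinv : ContDiffOn ℝ ∞ (fun y => (k y)⁻¹) U := hk.inv fun y hy => (hpos y hy).ne'
  let E : Fin 2 → Plane → R42 := fun i y => (k y)⁻¹ • pd i σ y - k y • pd i ρ y
  have hEs : ∀ i, ContDiffOn ℝ ∞ (E i) U := fun i =>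
    (hkinv.smul (contDiffOn_pd hU hσ i)).sub (hk.smul (contDiffOn_pd hU hρ i))
  -- pointwise description of `E`
  have hE : ∀ y ∈ U, ∃ (e₁ : R42) (a : Fin 2 → ℝ), form e₁ e₁ = 1 ∧
      (∀ i, E i y = (2 * a i) • e₁) ∧
      (∀ i, form (pd i σ y) e₁ = k y * a i) ∧ ∀ i, form (pd i ρ y) e₁ = -((k y)⁻¹ * a i) := by
    intro y hy
    obtain ⟨e₁, e₂, a, b, h1, h2, h3⟩ := hrep y hy
    have hk0 := (hpos y hy).ne'
    refine ⟨e₁, a, h1, fun i => ?_, fun i => ?_, fun i => ?_⟩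
    · simp only [E, (h3 i).1, (h3 i).2, smul_smul, inv_mul_cancel₀ hk0, mul_inv_cancel₀ hk0]
      module
    · rw [(h3 i).1]; simp only [form_expand, h1, form_comm e₂ e₁, h2]; ring
    · rw [(h3 i).2]; simp only [form_expand, h1, form_comm e₂ e₁, h2]; ring
  let Q : Plane → ℝ := fun y => form (E w y) (E w y)
  have hQ : ContDiffOn ℝ ∞ Q U := contDiffOn_form (hEs w) (hEs w)
  -- The unit vectors e₁ of the hypothesis need not depend smoothly on the point. Where one
  -- component E w does not vanish, its normalization is a smooth unit field that equals ±e₁.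
  let V := U ∩ Q ⁻¹' {0}ᶜ
  have hV : IsOpen V := hQ.continuousOn.isOpen_inter_preimage hU isOpen_compl_singleton
  have hVU : V ⊆ U := inter_subset_left
  have hy₀V : y₀ ∈ V := by
    refine ⟨hy₀, ?_⟩
    obtain ⟨e₁, a, h1, h2, -, -⟩ := hE y₀ hy₀
    intro h0
    have h0' : form (E w y₀) (E w y₀) = 0 := h0
    rw [h2 w] at h0'
    simp only [form_expand, h1, mul_one, mul_self_eq_zero] at h0'
    apply hw
    change E w y₀ = 0
    rw [h2 w, h0', zero_smul]
  have hQpos : ∀ y ∈ V, 0 < Q y := by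
    intro y hy
    obtain ⟨e₁, a, h1, h2, -, -⟩ := hE y hy.1
    have : Q y = (2 * a w) ^ 2 := by simp only [Q, h2, form_expand, h1]; ring
    exact lt_of_le_of_ne (this ▸ sq_nonneg _) (Ne.symm hy.2)
  let e : Plane → R42 := fun y => (√(Q y))⁻¹ • E w y
  have hsq : ContDiffOn ℝ ∞ (fun y => (√(Q y))⁻¹) V :=
    ((hQ.mono hVU).sqrt fun y hy => (hQpos y hy).ne').inv
      fun y hy => (Real.sqrt_pos.2 (hQpos y hy)).ne'
  have hes : ContDiffOn ℝ ∞ e V := hsq.smul ((hEs w).mono hVU)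
  let α : Fin 2 → Plane → ℝ := fun i y => (1 / 2) * form (E i y) (e y)
  have hαs : ∀ i, ContDiffOn ℝ ∞ (α i) V := fun i =>
    contDiffOn_const.mul (contDiffOn_form ((hEs i).mono hVU) hes)
  have hee : ∀ y ∈ V, form (e y) (e y) = 1 := fun y hy => form_inv_sqrt_smul (hQpos y hy)
  -- the smooth choice agrees with the pointwise one up to sign
  have hgood : ∀ y ∈ V, (∀ i, E i y = (2 * α i y) • e y) ∧
      (∀ i, form (pd i σ y) (e y) = k y * α i y) ∧
      ∀ i, form (pd i ρ y) (e y) = -((k y)⁻¹ * α i y) := by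
    intro y hy
    obtain ⟨e₁, a, h1, h2, h3, h4⟩ := hE y hy.1
    obtain ⟨s, hs⟩ : ∃ s : ℝ, e y = s • e₁ :=
      ⟨(√(Q y))⁻¹ * (2 * a w), by simp only [e, h2 w, smul_smul]⟩
    have hs2 : s * s = 1 := by
      have := hee y hy
      rw [hs] at this
      simpa [form_expand, h1] using this
    have hα : ∀ i, α i y = s * a i := fun i => by
      simp only [α, h2 i, hs, form_expand, h1]; ring
    refine ⟨fun i => ?_, fun i => ?_, fun i => ?_⟩
    · rw [h2 i, hα, hs, smul_smul]
      congr 1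
      linear_combination (-(2 * a i)) * hs2
    · rw [hs, form_smul_right, h3, hα]; ring
    · rw [hs, form_smul_right, h4, hα]; ring
  refine ⟨V, hVU, hV, hy₀V, e, α, hαs, fun y hy => ?_, fun y hy => ⟨hee y hy, (hgood y hy).1⟩⟩
  have hyU := hVU hy
  have dk : DifferentiableAt ℝ k y := (hk.contDiffAt (hU.mem_nhds hyU)).differentiableAt (by simp)
  have dki : DifferentiableAt ℝ (fun y => (k y)⁻¹) y :=
    (hkinv.contDiffAt (hU.mem_nhds hyU)).differentiableAt (by simp)
  have dσ : ∀ i, DifferentiableAt ℝ (pd i σ) y := fun i =>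
    ((contDiffOn_pd hU hσ i).contDiffAt (hU.mem_nhds hyU)).differentiableAt (by simp)
  have dρ : ∀ i, DifferentiableAt ℝ (pd i ρ) y := fun i =>
    ((contDiffOn_pd hU hρ i).contDiffAt (hU.mem_nhds hyU)).differentiableAt (by simp)
  have dE : ∀ i, DifferentiableAt ℝ (E i) y := fun i =>
    ((hEs i).contDiffAt (hU.mem_nhds hyU)).differentiableAt (by simp)
  have de : DifferentiableAt ℝ e y := (hes.contDiffAt (hV.mem_nhds hy)).differentiableAt (by simp)
  obtain ⟨g1, g2, g3⟩ := hgood y hy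
  -- Since E i is a multiple of the unit field e, it is orthogonal to de, so only the derivative of
  -- E i contributes.
  have hα : ∀ j i, pd j (α i) y = (1 / 2) * form (pd j (E i) y) (e y) := by
    intro j i
    have h0 : form (e y) (pd j e y) = 0 := by rw [form_comm, form_pd_self hV hes hee hy]
    have hc : pd j (fun _ : Plane => (1 / 2 : ℝ)) y = 0 := by simp [pd]
    rw [pd_mul (differentiableAt_const _) (differentiableAt_form (dE i) de), pd_form (dE i) de,
      g1 i, form_smul_left _ _ (pd j e y), h0, hc]
    ring
  have hpE : ∀ j i, pd j (E i) y = (pd j (fun y => (k y)⁻¹) y • pd i σ y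
      + (k y)⁻¹ • pd j (pd i σ) y) - (pd j k y • pd i ρ y + k y • pd j (pd i ρ) y) := by
    intro j i
    rw [← pd_smul dki (dσ i), ← pd_smul dk (dρ i)]
    exact pd_sub (dki.fun_smul (dσ i)) (dk.fun_smul (dρ i)) j
  have hinv : ∀ j, pd j (fun y => (k y)⁻¹) y * k y + (k y)⁻¹ * pd j k y = 0 := by
    intro j
    rw [← pd_mul dki dk]
    exact pd_eq_zero_of_const hU (fun z hz => inv_mul_cancel₀ (hpos z hz).ne') hyU j
  have cσ := pd_comm (hσ.contDiffAt (hU.mem_nhds hyU)) 1 0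
  have cρ := pd_comm (hρ.contDiffAt (hU.mem_nhds hyU)) 1 0
  rw [hα, hα, hpE, hpE, cσ, cρ]
  simp only [form_expand, g2, g3]
  -- The mixed second derivatives have cancelled. The remaining terms are α wedged with k d(k⁻¹) +
  -- k⁻¹ dk = d(k⁻¹k) = 0.
  linear_combination (1 / 2 * α 0 y) * hinv 1 - (1 / 2 * α 1 y) * hinv 0


/-! ### Curvature line coordinates -/

lemma pd_neg {g : Plane → R42} (y : Plane) (i : Fin 2) :
    pd i (fun z => -g z) y = -pd i g y := by
  rw [pd, fderiv_fun_neg]; rfl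

/-- A vector annihilated by both linear forms a and b is annihilated by dσ and dρ, so a and b are
independent. -/
lemma det_ne_zero_of_immersion {σ ρ : Plane → R42} {y : Plane} {l r : ℝ} {e₁ e₂ : R42}
    {a b : Fin 2 → ℝ}
    (h : ∀ i, pd i σ y = l • (a i • e₁ + b i • e₂) ∧ pd i ρ y = r • ((-a i) • e₁ + b i • e₂))
    (himm : ∀ X, fderiv ℝ σ y X = 0 → fderiv ℝ ρ y X = 0 → X = 0) :
    a 0 * b 1 - a 1 * b 0 ≠ 0 := by
  have key : ∀ X₀ X₁ : ℝ, X₀ * a 0 + X₁ * a 1 = 0 → X₀ * b 0 + X₁ * b 1 = 0 → X₀ = 0 ∧ X₁ = 0 := by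
    intro X₀ X₁ h1 h2
    have hX := himm !₂[X₀, X₁]
      (by
        rw [fderiv_eq_pd, (h 0).1, (h 1).1]
        calc _ = l • ((X₀ * a 0 + X₁ * a 1) • e₁ + (X₀ * b 0 + X₁ * b 1) • e₂) := by
              simp only [Matrix.cons_val_zero, Matrix.cons_val_one]; module
          _ = 0 := by rw [h1, h2]; simp)
      (by
        rw [fderiv_eq_pd, (h 0).2, (h 1).2]
        calc _ = r • ((-(X₀ * a 0 + X₁ * a 1)) • e₁ + (X₀ * b 0 + X₁ * b 1) • e₂) := by
              simp only [Matrix.cons_val_zero, Matrix.cons_val_one]; module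
          _ = 0 := by rw [h1, h2]; simp)
    have h3 := congrArg (fun v : Plane => v 0) hX
    have h4 := congrArg (fun v : Plane => v 1) hX
    exact ⟨by simpa using h3, by simpa using h4⟩
  intro hdet
  have h1 := key (b 1) (-b 0) (by linarith) (by ring)
  have h2 := key (a 1) (-a 0) (by ring) (by linarith)
  have h3 := key 1 0 (by linarith [h2.2]) (by linarith [h1.2])
  norm_num at h3

/-- Cramer's rule, used to read off the partial derivatives in new coordinates from the chain rule.
-/
lemma eq_of_independent_combinations {a₀ a₁ b₀ b₁ : ℝ} (hdet : a₀ * b₁ - a₁ * b₀ ≠ 0)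
    {S₀ S₁ A B : R42} (h0 : a₀ • A + b₀ • B = a₀ • S₀ + b₀ • S₁)
    (h1 : a₁ • A + b₁ • B = a₁ • S₀ + b₁ • S₁) : S₀ = A ∧ S₁ = B := by
  constructor
  · rw [← sub_eq_zero]
    refine (smul_eq_zero.1 ?_).resolve_left hdet
    calc _ = b₁ • ((a₀ • S₀ + b₀ • S₁) - (a₀ • A + b₀ • B))
          - b₀ • ((a₁ • S₀ + b₁ • S₁) - (a₁ • A + b₁ • B)) := by module
      _ = 0 := by rw [h0, h1]; simp
  · rw [← sub_eq_zero]
    refine (smul_eq_zero.1 ?_).resolve_left hdet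
    calc _ = a₀ • ((a₁ • S₀ + b₁ • S₁) - (a₁ • A + b₁ • B))
          - a₁ • ((a₀ • S₀ + b₀ • S₁) - (a₀ • A + b₀ • B)) := by module
      _ = 0 := by rw [h0, h1]; simp

/-- Curvature line coordinates in which `dσ` and `dρ` are conformal, with inverse factors. -/
lemma exists_curvature_line_coordinates {σ ρ : Plane → R42} {U : Set Plane} (hU : IsOpen U)
    (hσ : ContDiffOn ℝ ∞ σ U) (hρ : ContDiffOn ℝ ∞ ρ U)
    (hrep : ∀ y ∈ U, ∃ (k : ℝ) (e₁ e₂ : R42), 0 < k ∧ form e₁ e₁ = 1 ∧ form e₂ e₂ = 1 ∧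
      form e₁ e₂ = 0 ∧ ∀ X : Plane, ∃ a b : ℝ, fderiv ℝ σ y X = k • (a • e₁ + b • e₂) ∧
        fderiv ℝ ρ y X = k⁻¹ • ((-a) • e₁ + b • e₂))
    (himm : ∀ y ∈ U, ∀ X, fderiv ℝ σ y X = 0 → fderiv ℝ ρ y X = 0 → X = 0)
    {y₀ : Plane} (hy₀ : y₀ ∈ U) :
    ∃ (φ : OpenPartialHomeomorph Plane Plane) (k : Plane → ℝ), y₀ ∈ φ.source ∧ φ.source ⊆ U ∧
      ContDiffOn ℝ ∞ φ φ.source ∧ ContDiffOn ℝ ∞ φ.symm φ.target ∧ ContDiffOn ℝ ∞ k φ.target ∧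
      ∀ z ∈ φ.target, 0 < k z ∧ ∃ e₁ e₂ : R42, form e₁ e₁ = 1 ∧ form e₂ e₂ = 1 ∧
        form e₁ e₂ = 0 ∧ pd 0 (σ ∘ φ.symm) z = k z • e₁ ∧ pd 1 (σ ∘ φ.symm) z = k z • e₂ ∧
        pd 0 (ρ ∘ φ.symm) z = (k z)⁻¹ • (-e₁) ∧ pd 1 (ρ ∘ φ.symm) z = (k z)⁻¹ • e₂ := by
  let n₁ : Plane → ℝ := fun y => form (pd 0 σ y) (pd 0 σ y)
  let n₂ : Plane → ℝ := fun y => form (pd 0 ρ y) (pd 0 ρ y)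
  -- The factor k is given only pointwise. As |σ_u|² = k²(a² + b²) and |ρ_u|² = k⁻²(a² + b²) in the
  -- given coordinates, it is the fourth root of their quotient and hence smooth.
  let K : Plane → ℝ := fun y => √√(n₁ y / n₂ y)
  have hrep' : ∀ y ∈ U, 0 < n₁ y ∧ 0 < n₂ y ∧ 0 < K y ∧ ∃ (e₁ e₂ : R42) (a b : Fin 2 → ℝ),
      form e₁ e₁ = 1 ∧ form e₂ e₂ = 1 ∧ form e₁ e₂ = 0 ∧ a 0 * b 1 - a 1 * b 0 ≠ 0 ∧
      ∀ i, pd i σ y = K y • (a i • e₁ + b i • e₂) ∧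
        pd i ρ y = (K y)⁻¹ • ((-a i) • e₁ + b i • e₂) := by
    intro y hy
    obtain ⟨k, e₁, e₂, hk, h1, h2, h3, hX⟩ := hrep y hy
    choose a b hab using fun i : Fin 2 => hX (EuclideanSpace.single i 1)
    have hdet := det_ne_zero_of_immersion (l := k) (r := k⁻¹) hab (himm y hy)
    have hpos : 0 < a 0 ^ 2 + b 0 ^ 2 := by
      by_contra! hle
      have ha : a 0 = 0 := by nlinarith [sq_nonneg (a 0), sq_nonneg (b 0)]
      have hb : b 0 = 0 := by nlinarith [sq_nonneg (a 0), sq_nonneg (b 0)]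
      exact hdet (by rw [ha, hb]; ring)
    have hn₁ : n₁ y = k ^ 2 * (a 0 ^ 2 + b 0 ^ 2) := by
      have : pd 0 σ y = _ := (hab 0).1
      simp only [n₁, this, form_expand, h1, h2, h3, form_comm e₂ e₁]; ring
    have hn₂ : n₂ y = (k⁻¹) ^ 2 * (a 0 ^ 2 + b 0 ^ 2) := by
      have : pd 0 ρ y = _ := (hab 0).2
      simp only [n₂, this, form_expand, h1, h2, h3, form_comm e₂ e₁]; ring
    have hK : K y = k := by
      have : n₁ y / n₂ y = (k ^ 2) ^ 2 := by rw [hn₁, hn₂]; field_simp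
      simp only [K, this]
      rw [Real.sqrt_sq (by positivity), Real.sqrt_sq hk.le]
    refine ⟨by rw [hn₁]; positivity, by rw [hn₂]; positivity, hK ▸ hk, e₁, e₂, a, b, h1, h2, h3,
      hdet, ?_⟩
    rw [hK]
    exact hab
  have hK : ContDiffOn ℝ ∞ K U := by
    have s1 : ContDiffOn ℝ ∞ n₁ U := contDiffOn_form (contDiffOn_pd hU hσ 0) (contDiffOn_pd hU hσ 0)
    have s2 : ContDiffOn ℝ ∞ n₂ U := contDiffOn_form (contDiffOn_pd hU hρ 0) (contDiffOn_pd hU hρ 0)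
    have hq : ∀ y ∈ U, 0 < n₁ y / n₂ y := fun y hy => div_pos (hrep' y hy).1 (hrep' y hy).2.1
    exact ((s1.div s2 fun y hy => (hrep' y hy).2.1.ne').sqrt fun y hy => (hq y hy).ne').sqrt
      fun y hy => (Real.sqrt_pos.2 (hq y hy)).ne'
  have hKpos : ∀ y ∈ U, 0 < K y := fun y hy => (hrep' y hy).2.2.1
  obtain ⟨-, -, hk0, e₁, e₂, a, b, h1, h2, h3, hdet, hab⟩ := hrep' y₀ hy₀
  obtain ⟨V, hVU, hV, hyV, e, α, hα, hαc, he⟩ := exists_closed_form hU hσ hρ hK hKpos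
    (fun y hy => by
      obtain ⟨-, -, -, e₁, e₂, a, b, h1, h2, h3, -, hab⟩ := hrep' y hy
      exact ⟨e₁, e₂, a, b, h1, h3, hab⟩) hy₀ (by
      by_contra! hcon
      have ha : ∀ i, a i = 0 := fun i => by
        have := hcon i
        rw [(hab i).1, (hab i).2, smul_smul, smul_smul, inv_mul_cancel₀ hk0.ne',
          mul_inv_cancel₀ hk0.ne'] at this
        have := congrArg (form · e₁) this
        simp only [form_expand, h1, h3, form_comm e₂ e₁] at this
        linarith
      exact hdet (by rw [ha, ha]; ring))
  -- Replacing ρ by -ρ exchanges the roles of e₁ and e₂, so the same lemma yields the second closed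
  -- form.
  obtain ⟨V', hVU', hV', hyV', e', β, hβ, hβc, he'⟩ := exists_closed_form hU hσ hρ.neg hK hKpos
    (fun y hy => by
      obtain ⟨-, -, -, e₁, e₂, a, b, h1, h2, h3, -, hab⟩ := hrep' y hy
      refine ⟨e₂, e₁, b, a, h2, by rw [form_comm, h3], fun i => ⟨?_, ?_⟩⟩
      · rw [(hab i).1, add_comm]
      · rw [pd_neg, (hab i).2]; module) hy₀ (by
      by_contra! hcon
      have hb : ∀ i, b i = 0 := fun i => by
        have := hcon i
        rw [pd_neg, (hab i).1, (hab i).2, smul_neg, smul_smul, smul_smul, inv_mul_cancel₀ hk0.ne',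
          mul_inv_cancel₀ hk0.ne'] at this
        have := congrArg (form · e₂) this
        simp only [form_expand, h2, h3] at this
        linarith
      exact hdet (by rw [hb, hb]; ring))
  -- A ball is convex, so both closed forms are exact there.
  obtain ⟨ε, hε, hball⟩ := Metric.isOpen_iff.1 (hV.inter hV') y₀ ⟨hyV, hyV'⟩
  set B := Metric.ball y₀ ε with hBdef
  have hB : IsOpen B := Metric.isOpen_ball
  have hBV : B ⊆ V := fun y hy => (hball hy).1
  have hBV' : B ⊆ V' := fun y hy => (hball hy).2
  obtain ⟨u, hu, hud⟩ := exists_pd_eq_of_closed hB (convex_ball _ _) (fun i => (hα i).mono hBV)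
    fun y hy => hαc y (hBV hy)
  obtain ⟨v, hv, hvd⟩ := exists_pd_eq_of_closed hB (convex_ball _ _) (fun i => (hβ i).mono hBV')
    fun y hy => hβc y (hBV' hy)
  have hfin : ∀ y ∈ B, (∀ i, pd i σ y = K y • (α i y • e y + β i y • e' y) ∧
      pd i ρ y = (K y)⁻¹ • ((-α i y) • e y + β i y • e' y)) := by
    intro y hy i
    have p1 := (he y (hBV hy)).2 i
    have p2 := (he' y (hBV' hy)).2 i
    rw [pd_neg] at p2
    have hK0 := (hKpos y (hVU (hBV hy))).ne'
    constructor
    · have : (K y)⁻¹ • pd i σ y = α i y • e y + β i y • e' y := by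
        calc _ = (1 / 2 : ℝ) • (((K y)⁻¹ • pd i σ y - K y • pd i ρ y)
              + ((K y)⁻¹ • pd i σ y - K y • -pd i ρ y)) := by module
          _ = _ := by rw [p1, p2]; module
      rw [← this, smul_smul, mul_inv_cancel₀ hK0, one_smul]
    · have : K y • pd i ρ y = (-α i y) • e y + β i y • e' y := by
        calc _ = (1 / 2 : ℝ) • (((K y)⁻¹ • pd i σ y - K y • -pd i ρ y)
              - ((K y)⁻¹ • pd i σ y - K y • pd i ρ y)) := by module
          _ = _ := by rw [p1, p2]; module
      rw [← this, smul_smul, inv_mul_cancel₀ hK0, one_smul]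
  have hdet' : ∀ y ∈ B, α 0 y * β 1 y - α 1 y * β 0 y ≠ 0 := fun y hy =>
    det_ne_zero_of_immersion (a := fun i => α i y) (b := fun i => β i y) (hfin y hy)
      (himm y (hVU (hBV hy)))
  -- The vectors α_i e and β_j e' are multiples of e₁ and e₂, hence orthogonal. Some product α_i β_j
  -- is nonzero because the determinant of the two forms is.
  have horth : ∀ y ∈ B, form (e y) (e' y) = 0 := by
    intro y hy
    obtain ⟨-, -, hKy, e₁, e₂, a, b, h1, h2, h3, -, hab⟩ := hrep' y (hVU (hBV hy))
    have hprod : ∀ i j, α i y * β j y * form (e y) (e' y) = 0 := by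
      intro i j
      have p1 := (he y (hBV hy)).2 i
      have p2 := (he' y (hBV' hy)).2 j
      rw [pd_neg] at p2
      have q1 : (2 * α i y) • e y = (2 * a i) • e₁ := by
        rw [← p1, (hab i).1, (hab i).2, smul_smul, smul_smul, inv_mul_cancel₀ hKy.ne',
          mul_inv_cancel₀ hKy.ne']; module
      have q2 : (2 * β j y) • e' y = (2 * b j) • e₂ := by
        rw [← p2, (hab j).1, (hab j).2, smul_neg, smul_smul, smul_smul, inv_mul_cancel₀ hKy.ne',
          mul_inv_cancel₀ hKy.ne']; module
      have : form ((2 * α i y) • e y) ((2 * β j y) • e' y) = 0 := by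
        rw [q1, q2]; simp [form_expand, h3]
      simp only [form_expand] at this
      linarith
    have h01 := hprod 0 1
    have h10 := hprod 1 0
    refine (mul_eq_zero.1 (?_ : (α 0 y * β 1 y - α 1 y * β 0 y) * form (e y) (e' y) = 0)).resolve_left
      (hdet' y hy)
    linear_combination h01 - h10
  obtain ⟨φ, hφ0, hφB, hφs, hφs', hchain⟩ := exists_chart_of_independent hB hu hv
    (fun y hy => by rw [hud y hy, hud y hy, hvd y hy, hvd y hy]; exact hdet' y hy)
    (Metric.mem_ball_self hε)
  have hφU : φ.source ⊆ U := fun y hy => hVU (hBV (hφB hy))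
  refine ⟨φ, K ∘ φ.symm, hφ0, hφU, hφs, hφs',
    hK.comp hφs' fun z hz => hφU (φ.map_target hz), fun z hz => ?_⟩
  obtain ⟨y, hy, rfl⟩ : ∃ y ∈ φ.source, z = φ y := ⟨φ.symm z, φ.map_target hz, (φ.right_inv hz).symm⟩
  have hyB := hφB hy
  have hdσ : DifferentiableAt ℝ σ y :=
    (hσ.contDiffAt (hU.mem_nhds (hφU hy))).differentiableAt (by simp)
  have hdρ : DifferentiableAt ℝ ρ y :=
    (hρ.contDiffAt (hU.mem_nhds (hφU hy))).differentiableAt (by simp)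
  have cσ := hchain y hy σ hdσ
  have cρ := hchain y hy ρ hdρ
  simp only [Function.comp_apply, φ.left_inv hy]
  simp only [hud y hyB, hvd y hyB] at cσ cρ
  have r1 := eq_of_independent_combinations (hdet' y hyB) (A := K y • e y) (B := K y • e' y)
    (by rw [← cσ 0, (hfin y hyB 0).1]; module) (by rw [← cσ 1, (hfin y hyB 1).1]; module)
  have r2 := eq_of_independent_combinations (hdet' y hyB) (A := (K y)⁻¹ • (-e y))
    (B := (K y)⁻¹ • e' y)
    (by rw [← cρ 0, (hfin y hyB 0).2]; module) (by rw [← cρ 1, (hfin y hyB 1).2]; module)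
  exact ⟨hKpos y (hφU hy), e y, e' y, (he y (hBV hyB)).1, (he' y (hBV' hyB)).1, horth y hyB,
    r1.1, r1.2, r2.1, r2.2⟩

/-! ### Moutard lifts -/

/-- Light cone maps with orthonormal derivatives are Moutard lifts if they envelop, together with
a second map, a common congruence of contact elements in curvature line coordinates. -/
lemma moutard_of_orthonormal {T : Set Plane} (hT : IsOpen T) {s r : Plane → R42} {c : R42}
    (hs : ContDiffOn ℝ ∞ s T) (hr : ContDiffOn ℝ ∞ r T)
    (hss : ∀ z ∈ T, form (s z) (s z) = 0) (hsr : ∀ z ∈ T, form (s z) (r z) = 0)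
    (hsc : ∀ z ∈ T, form (s z) c = 0)
    (hd : ∀ z ∈ T, ∃ (e₁ e₂ : R42) (l₁ l₂ m τ : ℝ), form e₁ e₁ = 1 ∧ form e₂ e₂ = 1 ∧
      form e₁ e₂ = 0 ∧ form (s z) e₁ = 0 ∧ form (s z) e₂ = 0 ∧ form (r z) e₁ = 0 ∧
      form (r z) e₂ = 0 ∧ pd 0 s z = e₁ + l₁ • s z ∧ pd 1 s z = e₂ + l₂ • s z ∧
      pd 0 r z = τ • e₁ + m • r z ∧
      ∀ x, form x (s z) = 0 → form x (r z) = 0 → form x e₁ = 0 → form x e₂ = 0 → form x c = 0 →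
        x ∈ Submodule.span ℝ {s z}) :
    ∀ z ∈ T, form (pd 0 s z) (pd 1 s z) = 0 ∧ 0 < form (pd 0 s z) (pd 0 s z) ∧
      0 < form (pd 1 s z) (pd 1 s z) ∧ pd 0 (pd 1 s) z ∈ Submodule.span ℝ {s z} := by
  have hs0 := contDiffOn_pd hT hs 0
  have hs1 := contDiffOn_pd hT hs 1
  have facts : ∀ z ∈ T, form (pd 0 s z) (pd 0 s z) = 1 ∧ form (pd 1 s z) (pd 1 s z) = 1 ∧
      form (pd 1 s z) (pd 0 s z) = 0 ∧ form (pd 1 s z) (s z) = 0 ∧ form (pd 1 s z) (r z) = 0 ∧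
      form (pd 1 s z) (pd 0 r z) = 0 := by
    intro z hz
    obtain ⟨e₁, e₂, l₁, l₂, m, τ, h1, h2, h3, h4, h5, -, h7, h8, h9, h10, -⟩ := hd z hz
    rw [h8, h9, h10]
    simp only [form_expand, h1, h2, h3, h4, h5, h7, hss z hz, hsr z hz, form_comm e₁ (s z),
      form_comm e₂ (s z), form_comm e₂ (r z), form_comm e₂ e₁]
    norm_num
  intro z hz
  obtain ⟨f1, f2, f3, f4, f5, f6⟩ := facts z hz
  refine ⟨by rw [form_comm, f3], by rw [f1]; norm_num, by rw [f2]; norm_num, ?_⟩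
  -- All scalar products among s, r, s_u, s_v, c used here are constant, as is (s_v, r).
  -- Differentiating them shows s_uv orthogonal to s, r, s_v, s_u and c; the hypothesis says that
  -- only multiples of s remain.
  have x1 : form (pd 0 (pd 1 s) z) (s z) = 0 := by
    rw [form_pd_eq_neg hT hs1 hs (fun w hw => (facts w hw).2.2.2.1) hz, f3, neg_zero]
  have x2 : form (pd 0 (pd 1 s) z) (r z) = 0 := by
    rw [form_pd_eq_neg hT hs1 hr (fun w hw => (facts w hw).2.2.2.2.1) hz, f6, neg_zero]
  have x3 : form (pd 0 (pd 1 s) z) (pd 1 s z) = 0 :=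
    form_pd_self hT hs1 (fun w hw => (facts w hw).2.1) hz 0
  have x4 : form (pd 0 (pd 1 s) z) (pd 0 s z) = 0 := by
    rw [pd_comm (hs.contDiffAt (hT.mem_nhds hz)) 0 1]
    exact form_pd_self hT hs0 (fun w hw => (facts w hw).1) hz 1
  have x5 : form (pd 0 (pd 1 s) z) c = 0 :=
    form_pd_const hT hs1 (fun w hw => form_pd_const hT hs hsc hw 1) hz 0
  obtain ⟨e₁, e₂, l₁, l₂, m, τ, -, -, -, -, -, -, -, h8, h9, -, hspan⟩ := hd z hz
  rw [h8, form_add_right, form_smul_right, x1] at x4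
  rw [h9, form_add_right, form_smul_right, x1] at x3
  exact hspan _ x1 x2 (by linarith) (by linarith) x5

/-- Vectors orthogonal to the contact element, to its enveloping directions and to an
infinity sphere. -/
lemma IsFrame.mem_span_of_orthogonal {p q f t e₁ e₂ : R42} (he : IsFrame p q f t e₁ e₂)
    (h : IsTetrad p q f t) {x : R42} {ε : ℝ} (hε : ε * ε = 1) (h1 : form x ((p + q) + (t + f)) = 0)
    (h2 : form x ((p - q) + (t - f)) = 0) (h3 : form x e₁ = 0) (h4 : form x e₂ = 0)
    (h5 : form x (p + ε • q) = 0) : x ∈ Submodule.span ℝ {(p + ε • q) + (t + ε • f)} := by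
  rw [Submodule.mem_span_singleton]
  -- The three orthogonality relations express the products of x with t, q and f through (x, p);
  -- substituting into the full expansion leaves -(x, p) times the touching lift.
  refine ⟨-form x p, ?_⟩
  simp only [form_expand] at h1 h2 h5
  have ht : form x t = -form x p := by linarith
  have hq : form x q = -(ε * form x p) := by
    linear_combination ε * h5 - form x q * hε
  have hf : form x f = ε * form x p := by linarith
  conv_rhs => rw [he.expand_full h x, ht, hq, hf, h3, h4]
  module


/-! ### From flat fronts to isothermic sphere congruences -/

section FlatFrontToOmega

/-- The values -2 serve as the normalization by which lifts of S⁺ and S⁻ are later singled out. -/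
lemma form_touchingLift {p q f t : R42} (T : IsTetrad p q f t) :
    form ((p + q) + (t + f)) ((p + q) + (t + f)) = 0 ∧
    form ((p + q) + (t + f)) ((p - q) + (t - f)) = 0 ∧
    form ((p - q) + (t - f)) ((p - q) + (t - f)) = 0 ∧
    form ((p + q) + (t + f)) (p + q) = 0 ∧ form ((p + q) + (t + f)) (p - q) = -2 ∧
    form ((p - q) + (t - f)) (p + q) = -2 ∧ form ((p - q) + (t - f)) (p - q) = 0 := by
  simp only [form_expand, T.pp, T.qq, T.pq, T.fp, T.fq, T.tp, T.tq, T.ff, T.tt, T.tf,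
      form_comm q p, form_comm p f, form_comm p t, form_comm q f,
      form_comm q t, form_comm f t]
  norm_num

lemma form_touchingLift_normal {p q f t e : R42} (h : IsNormalTo p q f t e) :
    form ((p + q) + (t + f)) e = 0 ∧ form ((p - q) + (t - f)) e = 0 := by
  simp [form_expand, form_comm _ e, h.p, h.q, h.f, h.t]

variable {M : Type*} [TopologicalSpace M] [ChartedSpace Plane M]
  {H : HyperbolicModel} {f t : M → R42}

lemma deriv1_sub {g h : M → R42} {x : M} (hg : MDifferentiableAt 𝓘(ℝ, Plane) 𝓘(ℝ, R42) g x)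
    (hh : MDifferentiableAt 𝓘(ℝ, Plane) 𝓘(ℝ, R42) h x) (X : TangentSpace 𝓘(ℝ, Plane) x) :
    deriv1 (fun z => g z - h z) x X = deriv1 g x X - deriv1 h x X := by
  have := (hg.hasMFDerivAt.sub hh.hasMFDerivAt).mfderiv
  exact congrArg (fun L => L X) this

namespace IsFront

lemma contMDiff_add (h : IsFront H f t) :
    ContMDiff 𝓘(ℝ, Plane) 𝓘(ℝ, R42) ∞ (fun x => (H.p + H.q) + (t x + f x)) :=
  contMDiff_const.add (h.smooth_t.add h.smooth_f)

lemma contMDiff_sub (h : IsFront H f t) :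
    ContMDiff 𝓘(ℝ, Plane) 𝓘(ℝ, R42) ∞ (fun x => (H.p - H.q) + (t x - f x)) :=
  contMDiff_const.add (h.smooth_t.sub h.smooth_f)

lemma deriv1_add (h : IsFront H f t) (x : M) (X : TangentSpace 𝓘(ℝ, Plane) x) :
    deriv1 (fun x => (H.p + H.q) + (t x + f x)) x X = deriv1 t x X + deriv1 f x X := by
  rw [← LieSphere.deriv1_add (h.mdiff_t x) (h.mdiff_f x)]
  exact deriv1_const_add ((h.mdiff_t x).add (h.mdiff_f x)) _ X

lemma deriv1_sub (h : IsFront H f t) (x : M) (X : TangentSpace 𝓘(ℝ, Plane) x) :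
    deriv1 (fun x => (H.p - H.q) + (t x - f x)) x X = deriv1 t x X - deriv1 f x X := by
  rw [← LieSphere.deriv1_sub (h.mdiff_t x) (h.mdiff_f x)]
  exact deriv1_const_add ((h.mdiff_t x).sub (h.mdiff_f x)) _ X

variable [IsManifold 𝓘(ℝ, Plane) ∞ M]

/-- Curvature line coordinates of a flat front. -/
lemma exists_curvature_chart (h : IsFront H f t) (hflat : ∀ x, FlatAt f t x)
    (hu : UmbilicFree (legendreLift H f t)) (x₀ : M) :
    ∃ ψ ∈ IsManifold.maximalAtlas 𝓘(ℝ, Plane) ∞ M, x₀ ∈ ψ.source ∧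
      ∃ k : Plane → ℝ, ContDiffOn ℝ ∞ k ψ.target ∧ ∀ z ∈ ψ.target, 0 < k z ∧ ∃ e₁ e₂ : R42,
        IsFrame H.p H.q (f (ψ.symm z)) (t (ψ.symm z)) e₁ e₂ ∧
        pd 0 ((fun x => (H.p + H.q) + (t x + f x)) ∘ ψ.symm) z = k z • e₁ ∧
        pd 1 ((fun x => (H.p + H.q) + (t x + f x)) ∘ ψ.symm) z = k z • e₂ ∧
        pd 0 ((fun x => (H.p - H.q) + (t x - f x)) ∘ ψ.symm) z = (k z)⁻¹ • (-e₁) ∧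
        pd 1 ((fun x => (H.p - H.q) + (t x - f x)) ∘ ψ.symm) z = (k z)⁻¹ • e₂ := by
  obtain ⟨χ, hχeq⟩ : ∃ χ, χ = chartAt Plane x₀ := ⟨_, rfl⟩
  have hχ : χ ∈ IsManifold.maximalAtlas 𝓘(ℝ, Plane) ∞ M :=
    hχeq ▸ IsManifold.chart_mem_maximalAtlas x₀
  have hx₀ : x₀ ∈ χ.source := hχeq ▸ mem_chart_source _ _
  clear hχeq
  set σ : M → R42 := fun x => (H.p + H.q) + (t x + f x) with hσdef
  set ρ : M → R42 := fun x => (H.p - H.q) + (t x - f x) with hρdef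
  have dσ : ∀ {ψ : OpenPartialHomeomorph M Plane},
      ψ ∈ IsManifold.maximalAtlas 𝓘(ℝ, Plane) ∞ M → ∀ y ∈ ψ.target, ∀ e,
      fderiv ℝ (σ ∘ ψ.symm) y e = deriv1 t (ψ.symm y) (chartVec ψ y e)
        + deriv1 f (ψ.symm y) (chartVec ψ y e) := fun hψ y hy e => by
    rw [fderiv_comp_symm hψ hy (h.contMDiff_add.mdifferentiable (by simp) _), h.deriv1_add]
  have dρ : ∀ {ψ : OpenPartialHomeomorph M Plane},
      ψ ∈ IsManifold.maximalAtlas 𝓘(ℝ, Plane) ∞ M → ∀ y ∈ ψ.target, ∀ e,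
      fderiv ℝ (ρ ∘ ψ.symm) y e = deriv1 t (ψ.symm y) (chartVec ψ y e)
        - deriv1 f (ψ.symm y) (chartVec ψ y e) := fun hψ y hy e => by
    rw [fderiv_comp_symm hψ hy (h.contMDiff_sub.mdifferentiable (by simp) _), h.deriv1_sub]
  have sσ : ContDiffOn ℝ ∞ (σ ∘ χ.symm) χ.target := by
    simpa using contDiffOn_comp_symm hχ h.contMDiff_add.contMDiffOn (U := univ)
  have sρ : ContDiffOn ℝ ∞ (ρ ∘ χ.symm) χ.target := by
    simpa using contDiffOn_comp_symm hχ h.contMDiff_sub.contMDiffOn (U := univ)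
  obtain ⟨φ, k, hφ0, hφU, hφs, hφs', hk, hφ⟩ := exists_curvature_line_coordinates χ.open_target
    sσ sρ (fun y hy => by
      obtain ⟨c₁, c₂, hli, hc₁, hc₂⟩ := hu (χ.symm y)
      obtain ⟨k, e₁, e₂, hk, he, hX⟩ := h.exists_principal_frame (hflat _) hli hc₁ hc₂
      refine ⟨k, e₁, e₂, hk, he.norm₁, he.norm₂, he.orth, fun X => ?_⟩
      rw [dσ hχ y hy, dρ hχ y hy]
      exact hX _)
    (fun y hy X h1 h2 => by
      rw [dσ hχ y hy] at h1
      rw [dρ hχ y hy] at h2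
      exact (chartVec_bijective hχ hy).1 ((h.immersion_add_sub _ _ h1 h2).trans (map_zero _).symm))
    (χ.map_source hx₀)
  have hψtarget : (χ.trans φ).target = φ.target := by
    rw [OpenPartialHomeomorph.trans_target]
    exact inter_eq_left.2 fun z hz => hφU (φ.map_target hz)
  have hψ : χ.trans φ ∈ IsManifold.maximalAtlas 𝓘(ℝ, Plane) ∞ M := by
    rw [IsManifold.mem_maximalAtlas_iff_contMDiffOn]
    constructor
    · rw [OpenPartialHomeomorph.coe_trans, OpenPartialHomeomorph.trans_source]
      exact hφs.contMDiffOn.comp ((contMDiffOn_of_mem_maximalAtlas hχ).mono inter_subset_left)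
        fun _ hx => hx.2
    · rw [OpenPartialHomeomorph.coe_trans_symm, hψtarget]
      exact (contMDiffOn_symm_of_mem_maximalAtlas hχ).comp hφs'.contMDiffOn
        fun z hz => hφU (φ.map_target hz)
  refine ⟨χ.trans φ, hψ, ?_, k, by rwa [hψtarget], fun z hz => ?_⟩
  · rw [OpenPartialHomeomorph.trans_source]; exact ⟨hx₀, hφ0⟩
  · obtain ⟨hkz, e₁, e₂, h1, h2, h3, h4, h5, h6, h7⟩ := hφ z (hψtarget ▸ hz)
    have hn : ∀ (i : Fin 2) (e : R42), pd i (σ ∘ (χ.trans φ).symm) z = k z • e →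
        IsNormalTo H.p H.q (f ((χ.trans φ).symm z)) (t ((χ.trans φ).symm z)) e := by
      intro i e hie
      have : e = (k z)⁻¹ • pd i (σ ∘ (χ.trans φ).symm) z := by
        rw [hie, smul_smul, inv_mul_cancel₀ hkz.ne', one_smul]
      rw [this, pd, dσ hψ z hz]
      exact (h.normalTo_add _ _).smul _
    exact ⟨hkz, e₁, e₂, ⟨hn 0 e₁ h4, hn 1 e₂ h5, h1, h2, h3⟩, h4, h5, h6, h7⟩

/-- The Moutard lifts are s = k⁻¹σ and r = kρ in common curvature line coordinates. The factors
cancel those of dσ and dρ, so the derivatives are orthonormal up to multiples of the lifts. Each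
lift serves as the second enveloped map for the other. -/
lemma isIsothermic (h : IsFront H f t) (hflat : ∀ x, FlatAt f t x)
    (hu : UmbilicFree (legendreLift H f t)) :
    IsIsothermic (fun x => Submodule.span ℝ {(H.p + H.q) + (t x + f x)}) ∧
    IsIsothermic (fun x => Submodule.span ℝ {(H.p - H.q) + (t x - f x)}) := by
  rw [IsIsothermic, IsIsothermic, ← forall_and]
  intro x₀
  obtain ⟨ψ, hψ, hx₀, k, hk, hz⟩ := h.exists_curvature_chart hflat hu x₀
  set σ : M → R42 := fun x => (H.p + H.q) + (t x + f x) with hσdef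
  set ρ : M → R42 := fun x => (H.p - H.q) + (t x - f x) with hρdef
  have hT := ψ.open_target
  have tet := fun z : Plane => h.tetrad (ψ.symm z)
  have hk0 : ∀ z ∈ ψ.target, k z ≠ 0 := fun z hz' => (hz z hz').1.ne'
  have hki : ContDiffOn ℝ ∞ (fun z => (k z)⁻¹) ψ.target := hk.inv hk0
  have sσ : ContDiffOn ℝ ∞ (σ ∘ ψ.symm) ψ.target := by
    simpa using contDiffOn_comp_symm hψ h.contMDiff_add.contMDiffOn (U := univ)
  have sρ : ContDiffOn ℝ ∞ (ρ ∘ ψ.symm) ψ.target := by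
    simpa using contDiffOn_comp_symm hψ h.contMDiff_sub.contMDiffOn (U := univ)
  let s : Plane → R42 := fun z => (k z)⁻¹ • (σ ∘ ψ.symm) z
  let r : Plane → R42 := fun z => k z • (ρ ∘ ψ.symm) z
  have hs : ContDiffOn ℝ ∞ s ψ.target := hki.smul sσ
  have hr : ContDiffOn ℝ ∞ r ψ.target := hk.smul sρ
  have dat : ∀ {W : Type} [NormedAddCommGroup W] [NormedSpace ℝ W] {g : Plane → W},
      ContDiffOn ℝ ∞ g ψ.target → ∀ z ∈ ψ.target, DifferentiableAt ℝ g z := fun hg z hz' =>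
    (hg.contDiffAt (hT.mem_nhds hz')).differentiableAt (by simp)
  have forms := fun z : Plane => form_touchingLift (tet z)
  have hsval : ∀ z, s z = (k z)⁻¹ • ((H.p + H.q) + (t (ψ.symm z) + f (ψ.symm z))) := fun z => rfl
  have hrval : ∀ z, r z = k z • ((H.p - H.q) + (t (ψ.symm z) - f (ψ.symm z))) := fun z => rfl
  have hss : ∀ z ∈ ψ.target, form (s z) (s z) = 0 := fun z _ => by
    rw [hsval, form_smul_left, form_smul_right, (forms z).1]; simp
  have hsr : ∀ z ∈ ψ.target, form (s z) (r z) = 0 := fun z _ => by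
    rw [hsval, hrval, form_smul_left, form_smul_right, (forms z).2.1]; simp
  have hrr : ∀ z ∈ ψ.target, form (r z) (r z) = 0 := fun z _ => by
    rw [hrval, form_smul_left, form_smul_right, (forms z).2.2.1]; simp
  have hsp : ∀ z ∈ ψ.target, form (s z) (H.p + H.q) = 0 := fun z _ => by
    rw [hsval, form_smul_left, (forms z).2.2.2.1]; simp
  have hrp : ∀ z ∈ ψ.target, form (r z) (H.p - H.q) = 0 := fun z _ => by
    rw [hrval, form_smul_left, (forms z).2.2.2.2.2.2]; simp
  have ds : ∀ z ∈ ψ.target, ∀ i e, pd i (σ ∘ ψ.symm) z = k z • e →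
      pd i s z = e + (pd i (fun z => (k z)⁻¹) z * k z) • s z := by
    intro z hz' i e hie
    rw [pd_smul (dat hki z hz') (dat sσ z hz'), hie, smul_smul, inv_mul_cancel₀ (hk0 z hz'),
      one_smul, add_comm]
    simp only [s, smul_smul, mul_assoc, mul_inv_cancel₀ (hk0 z hz'), mul_one]
  have dr : ∀ z ∈ ψ.target, ∀ i e, pd i (ρ ∘ ψ.symm) z = (k z)⁻¹ • e →
      pd i r z = e + (pd i k z * (k z)⁻¹) • r z := by
    intro z hz' i e hie
    rw [pd_smul (dat hk z hz') (dat sρ z hz'), hie, smul_smul, mul_inv_cancel₀ (hk0 z hz'),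
      one_smul, add_comm]
    simp only [r, smul_smul, mul_assoc, inv_mul_cancel₀ (hk0 z hz'), mul_one]
  have perp : ∀ z ∈ ψ.target, ∀ e, IsNormalTo H.p H.q (f (ψ.symm z)) (t (ψ.symm z)) e →
      form (s z) e = 0 ∧ form (r z) e = 0 := by
    intro z _ e he
    rw [hsval, hrval, form_smul_left, form_smul_left, (form_touchingLift_normal he).1,
      (form_touchingLift_normal he).2]
    simp
  have span_s : ∀ z ∈ ψ.target, Submodule.span ℝ {σ (ψ.symm z)} = Submodule.span ℝ {s z} :=
    fun z hz' => (Submodule.span_singleton_smul_eq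
      (IsUnit.mk0 _ (inv_ne_zero (hk0 z hz'))) _).symm
  have span_r : ∀ z ∈ ψ.target, Submodule.span ℝ {ρ (ψ.symm z)} = Submodule.span ℝ {r z} :=
    fun z hz' => (Submodule.span_singleton_smul_eq (IsUnit.mk0 _ (hk0 z hz')) _).symm
  have cancel_s : ∀ z ∈ ψ.target, ∀ x, form x (s z) = 0 →
      form x ((H.p + H.q) + (t (ψ.symm z) + f (ψ.symm z))) = 0 := fun z hz' x hx => by
    rw [hsval, form_smul_right] at hx
    exact (mul_eq_zero.1 hx).resolve_left (inv_ne_zero (hk0 z hz'))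
  have cancel_r : ∀ z ∈ ψ.target, ∀ x, form x (r z) = 0 →
      form x ((H.p - H.q) + (t (ψ.symm z) - f (ψ.symm z))) = 0 := fun z hz' x hx => by
    rw [hrval, form_smul_right] at hx
    exact (mul_eq_zero.1 hx).resolve_left (hk0 z hz')
  have ms := moutard_of_orthonormal hT hs hr hss hsr hsp (fun z hz' => by
    obtain ⟨-, e₁, e₂, he, h1, h2, h3, h4⟩ := hz z hz'
    have p1 := perp z hz' e₁ he.normal₁
    have p2 := perp z hz' e₂ he.normal₂
    refine ⟨e₁, e₂, _, _, pd 0 k z * (k z)⁻¹, -1, he.norm₁, he.norm₂, he.orth, p1.1, p2.1, p1.2, p2.2,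
      ds z hz' 0 _ h1, ds z hz' 1 _ h2, ?_, fun x x1 x2 x3 x4 x5 => ?_⟩
    · rw [neg_one_smul]; exact dr z hz' 0 _ h3
    · rw [← span_s z hz']
      have := he.mem_span_of_orthogonal (tet z) (ε := 1) (by norm_num) (cancel_s z hz' x x1)
        (cancel_r z hz' x x2) x3 x4 (by rwa [one_smul])
      rwa [one_smul, one_smul] at this)
  have mr := moutard_of_orthonormal hT hr hs hrr (fun z hz' => by rw [form_comm, hsr z hz']) hrp
    (fun z hz' => by
    obtain ⟨-, e₁, e₂, he, h1, h2, h3, h4⟩ := hz z hz'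
    have p1 := perp z hz' (-e₁) he.normal₁.neg
    have p2 := perp z hz' e₂ he.normal₂
    -- For r the frame is (-e₁, e₂), since dρ and dσ have opposite signs along the first principal
    -- direction.
    refine ⟨-e₁, e₂, _, _, pd 0 (fun z => (k z)⁻¹) z * k z, -1, by simp [form_expand, he.norm₁], he.norm₂,
      by simp [form_expand, he.orth], p1.2, p2.2, p1.1, p2.1,
      dr z hz' 0 _ h3, dr z hz' 1 _ h4, ?_, fun x x1 x2 x3 x4 x5 => ?_⟩
    · rw [neg_one_smul, neg_neg]; exact ds z hz' 0 _ h1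
    · rw [← span_r z hz']
      have := he.mem_span_of_orthogonal (tet z) (ε := -1) (by norm_num) (cancel_s z hz' x x2)
        (cancel_r z hz' x x1) (by simpa [form_expand] using x3) x4
        (by rwa [neg_one_smul, ← sub_eq_add_neg])
      rwa [neg_one_smul, neg_one_smul, ← sub_eq_add_neg, ← sub_eq_add_neg] at this)
  constructor
  · refine ⟨ψ, hψ, hx₀, s, hs, fun z hz' => ?_⟩
    obtain ⟨m1, m2, m3, m4⟩ := ms z hz'
    refine ⟨fun h0 => ?_, hss z hz', span_s z hz', m1, m2, m3, m4⟩
    have h1 : form (s z) (H.p - H.q) = (k z)⁻¹ * (-2) := by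
      rw [hsval, form_smul_left, (forms z).2.2.2.2.1]
    rw [h0, form_zero_left] at h1
    have := inv_ne_zero (hk0 z hz')
    apply this; linarith
  · refine ⟨ψ, hψ, hx₀, r, hr, fun z hz' => ?_⟩
    obtain ⟨m1, m2, m3, m4⟩ := mr z hz'
    refine ⟨fun h0 => ?_, hrr z hz', span_r z hz', m1, m2, m3, m4⟩
    have h1 : form (r z) (H.p + H.q) = k z * (-2) := by
      rw [hrval, form_smul_left, (forms z).2.2.2.2.2.1]
    rw [h0, form_zero_left] at h1
    exact hk0 z hz' (by linarith)

end IsFront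

end FlatFrontToOmega

/-! ### Infinity spheres -/

lemma touch_span_iff {a b : R42} :
    Touch (Submodule.span ℝ {a}) (Submodule.span ℝ {b}) ↔ form a b = 0 := by
  constructor
  · intro h
    exact h a (Submodule.mem_span_singleton_self _) b (Submodule.mem_span_singleton_self _)
  · intro h x hx y hy
    obtain ⟨r, rfl⟩ := Submodule.mem_span_singleton.1 hx
    obtain ⟨s, rfl⟩ := Submodule.mem_span_singleton.1 hy
    simp [form_expand, h]

namespace HyperbolicModel

variable (H : HyperbolicModel)

lemma form_add_add : form (H.p + H.q) (H.p + H.q) = 0 := by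
  simp [form_expand, H.pp, H.qq, H.pq, form_comm H.q H.p]

lemma form_sub_sub : form (H.p - H.q) (H.p - H.q) = 0 := by
  simp [form_expand, H.pp, H.qq, H.pq, form_comm H.q H.p]

lemma form_add_sub : form (H.p + H.q) (H.p - H.q) = -2 := by
  simp [form_expand, H.pp, H.qq, H.pq, form_comm H.q H.p]; norm_num

lemma add_ne_zero : H.p + H.q ≠ 0 := fun h => by
  have := H.form_add_sub; rw [h, form_zero_left] at this; norm_num at this

lemma sub_ne_zero : H.p - H.q ≠ 0 := fun h => by
  have := H.form_add_sub; rw [h, form_zero_right] at this; norm_num at this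

lemma isSphere_add : IsSphere (Submodule.span ℝ {H.p + H.q}) :=
  ⟨_, H.add_ne_zero, H.form_add_add, rfl⟩

lemma isSphere_sub : IsSphere (Submodule.span ℝ {H.p - H.q}) :=
  ⟨_, H.sub_ne_zero, H.form_sub_sub, rfl⟩

lemma span_add_ne_span_sub :
    Submodule.span ℝ {H.p + H.q} ≠ Submodule.span ℝ {H.p - H.q} := by
  intro h
  have h1 : H.p + H.q ∈ Submodule.span ℝ {H.p - H.q} :=
    h ▸ Submodule.mem_span_singleton_self _
  obtain ⟨a, ha⟩ := Submodule.mem_span_singleton.1 h1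
  have := H.form_add_sub
  rw [← ha, form_smul_left, H.form_sub_sub] at this
  norm_num at this

/-- A vector of `{p, q}^⊥` which is orthogonal to all null vectors of `{p, q}^⊥` vanishes. -/
lemma eq_zero_of_orthogonal_null {w : R42} (hp : form w H.p = 0) (hq : form w H.q = 0)
    (hw : ∀ v, v ≠ 0 → form v v = 0 → form v H.p = 0 → form v H.q = 0 → form v w = 0) : w = 0 := by
  have hpo : form H.p H.o = 0 := by rw [form_comm, H.op]
  -- null vectors `n o ± z` for `z` orthogonal to `p, q, o`
  have key : ∀ z, z ≠ 0 → form z H.p = 0 → form z H.q = 0 → form z H.o = 0 →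
      form H.o w = 0 ∧ form z w = 0 := by
    intro z hz hzp hzq hzo
    have hpos := form_pos_of_orthogonal H.pp H.oo hpo hzp hzo hz
    have hn := Real.sqrt_pos.2 hpos
    have hn2 := Real.mul_self_sqrt hpos.le
    have hnull : ∀ ε : ℝ, ε * ε = 1 → form (√(form z z) • H.o + ε • z) w = 0 := by
      intro ε hε
      apply hw
      · intro h0
        have := congrArg (form · H.o) h0
        simp only [form_expand, H.oo, hzo] at this
        linarith
      · simp only [form_expand, H.oo, hzo, form_comm H.o z]
        linear_combination (-1) * hn2 + form z z * hε
      · simp [form_expand, H.op, hzp]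
      · simp [form_expand, H.oq, hzq]
    have h1 := hnull 1 (by norm_num)
    have h2 := hnull (-1) (by norm_num)
    simp only [form_expand] at h1 h2
    have h3 : √(form z z) * form H.o w = 0 := by linarith
    exact ⟨(mul_eq_zero.1 h3).resolve_left hn.ne', by linarith⟩
  have how : form H.o w = 0 := by
    obtain ⟨z, hz, hz'⟩ := exists_ne_zero_orthogonal (by norm_num) ![H.p, H.q, H.o]
    exact (key z hz (hz' 0) (hz' 1) (hz' 2)).1
  by_contra hw0
  have hwo : form w H.o = 0 := by rw [form_comm, how]
  exact (form_pos_of_orthogonal H.pp H.oo hpo hp hwo hw0).ne' (key w hw0 hp hq hwo).2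

/-- If ⟨w⟩ is an infinity sphere, the part of w in {p,q}^⊥ is orthogonal to all null vectors there
and so vanishes. Thus w lies in the plane of p and q, whose only null lines are ⟨p+q⟩ and ⟨p-q⟩. -/
lemma areInfinitySpheres :
    H.AreInfinitySpheres (Submodule.span ℝ {H.p + H.q}) (Submodule.span ℝ {H.p - H.q}) := by
  refine ⟨H.span_add_ne_span_sub, fun Q => ⟨?_, ?_⟩⟩
  · rintro ⟨⟨w, hw0, hww, rfl⟩, hQ⟩
    have hz : w + form w H.p • H.p - form w H.q • H.q = 0 := by
      apply H.eq_zero_of_orthogonal_null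
      · simp [form_expand, H.pp, H.pq, form_comm H.q H.p]
      · simp [form_expand, H.qq, H.pq]
      · intro v hv hvv hvp hvq
        have := touch_span_iff.1 ((hQ v hv hvv hvp).2 hvq)
        simp [form_expand, this, hvp, hvq]
    have hw : w = (-form w H.p) • H.p + form w H.q • H.q := by
      rw [← _root_.sub_eq_zero, ← hz]; module
    have hpq : (form w H.q - form w H.p) * (form w H.q + form w H.p) = 0 := by
      have := hww
      rw [hw] at this
      simp only [form_expand, H.pp, H.qq, H.pq, form_comm H.q H.p] at this
      linear_combination this
    rcases mul_eq_zero.1 hpq with h0 | h0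
    · right
      have hne : -form w H.p ≠ 0 := by
        intro hn
        apply hw0
        rw [hw, show form w H.q = form w H.p by linarith, show form w H.p = 0 by linarith]; simp
      have : w = (-form w H.p) • (H.p - H.q) := by
        conv_lhs => rw [hw, show form w H.q = form w H.p by linarith]
        module
      rw [this, Submodule.span_singleton_smul_eq (IsUnit.mk0 _ hne)]
    · left
      have hne : -form w H.p ≠ 0 := by
        intro hn
        apply hw0
        rw [hw, show form w H.q = -form w H.p by linarith, show form w H.p = 0 by linarith]; simp
      have : w = (-form w H.p) • (H.p + H.q) := by
        conv_lhs => rw [hw, show form w H.q = -form w H.p by linarith]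
        module
      rw [this, Submodule.span_singleton_smul_eq (IsUnit.mk0 _ hne)]
  · rintro (rfl | rfl)
    · refine ⟨H.isSphere_add, fun v _ _ hvp => ?_⟩
      rw [touch_span_iff, form_add_right, hvp, zero_add]
    · refine ⟨H.isSphere_sub, fun v _ _ hvp => ?_⟩
      rw [touch_span_iff, form_sub_right, hvp, zero_sub, neg_eq_zero]

lemma parallel_add (a : ℝ) : (H.parallel a).p + (H.parallel a).q = Real.exp a • (H.p + H.q) := by
  simp only [parallel, ← Real.cosh_add_sinh]; module

lemma parallel_sub (a : ℝ) :
    (H.parallel a).p - (H.parallel a).q = Real.exp (-a) • (H.p - H.q) := by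
  simp only [parallel, ← Real.cosh_sub_sinh]; module

lemma areInfinitySpheres_parallel (a : ℝ) : (H.parallel a).AreInfinitySpheres
    (Submodule.span ℝ {H.p + H.q}) (Submodule.span ℝ {H.p - H.q}) := by
  have := (H.parallel a).areInfinitySpheres
  rwa [parallel_add, parallel_sub,
    Submodule.span_singleton_smul_eq (IsUnit.mk0 _ (Real.exp_pos _).ne'),
    Submodule.span_singleton_smul_eq (IsUnit.mk0 _ (Real.exp_pos _).ne')] at this

end HyperbolicModel

/-! ### Flat fronts are Ω-surfaces touching the infinity spheres -/

section

variable {M : Type*} [TopologicalSpace M] [ChartedSpace Plane M]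
  {H : HyperbolicModel} {f t : M → R42} [IsManifold 𝓘(ℝ, Plane) ∞ M]

/-- The Legendre lift of an umbilic-free flat front is an `Ω`-surface whose isothermic sphere
congruences touch the infinity spheres. -/
lemma IsFlatFront.isOmegaTouching (h : IsFlatFront H f t)
    (hu : UmbilicFree (legendreLift H f t)) :
    IsOmegaTouching (legendreLift H f t)
      (fun x => Submodule.span ℝ {(H.p + H.q) + (t x + f x)})
      (fun x => Submodule.span ℝ {(H.p - H.q) + (t x - f x)})
      (Submodule.span ℝ {H.p + H.q}) (Submodule.span ℝ {H.p - H.q}) := by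
  have hf := h.front
  have forms := fun x : M => form_touchingLift (hf.tetrad x)
  have iso := hf.isIsothermic h.flatAt hu
  refine ⟨⟨hf.isLegendre, fun x => ?_, fun x => ?_, iso.1, iso.2, fun x => ?_⟩, H.isSphere_add,
    H.isSphere_sub, fun x => ?_, fun x => ?_, ?_⟩
  · rw [Submodule.span_singleton_le_iff_mem]
    exact Submodule.mem_span_pair.2 ⟨1, 1, by module⟩
  · rw [Submodule.span_singleton_le_iff_mem]
    exact Submodule.mem_span_pair.2 ⟨-1, 1, by module⟩
  · obtain ⟨c₁, c₂, hli, hc₁, hc₂⟩ := hu x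
    obtain ⟨m, n, v₁, v₂, X₁, X₂, hm, hn, -, -, -, -, -, -, -, -, -, k1, k2⟩ :=
      hf.exists_principal (h.flatAt x) hli hc₁ hc₂
    obtain ⟨-, -, -, f4, f5, f6, f7⟩ := forms x
    set σ := (H.p + H.q) + (t x + f x)
    set ρ := (H.p - H.q) + (t x - f x)
    -- By `exists_principal` these are curvature spheres; their sum and difference are multiples of
    -- σ and ρ.
    refine ⟨m • σ + n • ρ, m • σ - n • ρ, ?_, k1, k2, ?_, ?_⟩
    · rw [LinearIndependent.pair_iff]
      intro a b hab
      have h1 := congrArg (form · (H.p - H.q)) hab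
      have h2 := congrArg (form · (H.p + H.q)) hab
      simp only [form_add_left, form_sub_left, form_smul_left, f4, f5, f6, f7,
        form_zero_left] at h1 h2
      have e1 : m * (a + b) = 0 := by linarith
      have e2 : n * (a - b) = 0 := by linarith
      have e3 := (mul_eq_zero.1 e1).resolve_left hm
      have e4 := (mul_eq_zero.1 e2).resolve_left hn
      constructor <;> linarith
    · rw [show m • σ + n • ρ + (m • σ - n • ρ) = (2 * m) • σ by module,
        Submodule.span_singleton_smul_eq (IsUnit.mk0 _ (by simpa using hm))]
    · rw [show m • σ + n • ρ - (m • σ - n • ρ) = (2 * n) • ρ by module,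
        Submodule.span_singleton_smul_eq (IsUnit.mk0 _ (by simpa using hn))]
  · exact touch_span_iff.2 (forms x).2.2.2.1
  · exact touch_span_iff.2 (forms x).2.2.2.2.2.2
  · rw [touch_span_iff, H.form_add_sub]; norm_num

end


/-! ### Nondegeneracy of the touching sphere congruences -/

section Nondegeneracy

variable {M : Type*} [TopologicalSpace M] [ChartedSpace Plane M]

/-- `s` and `r` are local lifts of `Sp` and `Sm` in the chart `ψ`, and `s` is a Moutard lift. -/
structure IsMoutardChart (Sp Sm : M → Submodule ℝ R42) (ψ : OpenPartialHomeomorph M Plane)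
    (T : Set Plane) (s r : Plane → R42) : Prop where
  atlas : ψ ∈ IsManifold.maximalAtlas 𝓘(ℝ, Plane) ∞ M
  isOpen : IsOpen T
  subset : T ⊆ ψ.target
  smooth_s : ContDiffOn ℝ ∞ s T
  smooth_r : ContDiffOn ℝ ∞ r T
  span_s : ∀ y ∈ T, Sp (ψ.symm y) = Submodule.span ℝ {s y}
  span_r : ∀ y ∈ T, Sm (ψ.symm y) = Submodule.span ℝ {r y}
  orth : ∀ y ∈ T, form (pd 0 s y) (pd 1 s y) = 0
  pos : ∀ y ∈ T, ∀ i, 0 < form (pd i s y) (pd i s y)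
  moutard : ∀ y ∈ T, pd 0 (pd 1 s) y ∈ Submodule.span ℝ {s y}

variable {F Sp Sm : M → Submodule ℝ R42}

/-- Moutard coordinates of the two congruences are not known to agree. Only those of S⁺ are kept,
and the lift of S⁻ is transported into them as a mere smooth lift. -/
lemma IsOmegaSurface.exists_moutardChart (h : IsOmegaSurface F Sp Sm) (x₀ : M) :
    ∃ ψ T s r, IsMoutardChart Sp Sm ψ T s r ∧ ∃ y ∈ T, ψ.symm y = x₀ := by
  obtain ⟨ψ, hψ, hx, s, hs, hsy⟩ := h.isothermic_p x₀
  obtain ⟨φ, hφ, hx', r, hr, hry⟩ := h.isothermic_m x₀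
  refine ⟨ψ, ψ.target ∩ ψ.symm ⁻¹' φ.source, s, (r ∘ φ) ∘ ψ.symm, ⟨hψ,
    ψ.symm.isOpen_inter_preimage φ.open_source, inter_subset_left, hs.mono inter_subset_left, ?_,
    fun y hy => (hsy y hy.1).2.2.1, fun y hy => ?_, fun y hy => (hsy y hy.1).2.2.2.1,
    fun y hy i => ?_, fun y hy => (hsy y hy.1).2.2.2.2.2.2⟩, ψ x₀, ⟨ψ.map_source hx, ?_⟩,
    ψ.left_inv hx⟩
  · exact (contDiffOn_comp_symm hψ (contMDiffOn_comp_chart hφ hr)).mono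
      fun y hy => ⟨hy.1, hy.2, φ.map_source hy.2⟩
  · have := (hry _ (φ.map_source hy.2)).2.2.1
    rwa [φ.left_inv hy.2] at this
  · fin_cases i
    · exact (hsy y hy.1).2.2.2.2.1
    · exact (hsy y hy.1).2.2.2.2.2.1
  · simpa [ψ.left_inv hx] using hx'

/-- A nonzero bivector has a nonzero coordinate. Near a point this gives a smooth way to compare
coefficients in the basis s, r of the contact element. -/
lemma exists_wedge_ne_zero {a b : R42} (h : LinearIndependent ℝ ![a, b]) :
    ∃ z w, wedge a b z w ≠ 0 := by
  by_contra! h0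
  have ha : a ≠ 0 := h.ne_zero 0
  obtain ⟨z, hz⟩ : ∃ z, form a z ≠ 0 := by
    by_contra! h1
    exact ha (eq_zero_of_form_eq_zero h1)
  have h1 : (-form b z) • a + form a z • b = 0 := eq_zero_of_form_eq_zero fun w => by
    have := h0 z w
    simp only [wedge] at this
    simp only [form_expand]
    linarith
  exact hz (LinearIndependent.pair_iff.1 h _ _ h1).2

/-- Uniqueness for a first order linear equation, infinitesimally. -/
lemma pd_eq_zero_of_mul_eq {T : Set Plane} (hT : IsOpen T) {h w K : Plane → ℝ}
    (hh : ContDiffOn ℝ ∞ h T) (hw : ContDiffOn ℝ ∞ w T) (hK : ContDiffOn ℝ ∞ K T) {i : Fin 2}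
    (heq : ∀ y ∈ T, pd i h y * w y = h y * K y) {y : Plane} (hy : y ∈ T) (hwy : w y ≠ 0)
    (hhy : h y = 0) : pd i h y = 0 ∧ pd i (pd i h) y = 0 := by
  have h1 : pd i h y = 0 := by
    have := heq y hy
    rw [hhy, zero_mul] at this
    exact (mul_eq_zero.1 this).resolve_right hwy
  have dat : ∀ {g : Plane → ℝ}, ContDiffOn ℝ ∞ g T → DifferentiableAt ℝ g y := fun hg =>
    (hg.contDiffAt (hT.mem_nhds hy)).differentiableAt (by simp)
  have h2 := pd_congr_of_eqOn hT (g := fun y => pd i h y * w y) (h := fun y => h y * K y) heq hy i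
  rw [pd_mul (dat (contDiffOn_pd hT hh i)) (dat hw), pd_mul (dat hh) (dat hK), h1, hhy] at h2
  refine ⟨h1, (mul_eq_zero.1 (?_ : pd i (pd i h) y * w y = 0)).resolve_right hwy⟩
  linarith

namespace IsMoutardChart

variable {ψ : OpenPartialHomeomorph M Plane} {T : Set Plane} {s r : Plane → R42}

/-- Rescaling c₁ ± c₂ to s and r puts the curvature spheres into the form m s ± n r, the halves in m
and n coming from c₁ = ((c₁ + c₂) + (c₁ - c₂))/2. -/
lemma harmonic (c : IsMoutardChart Sp Sm ψ T s r) (h : IsOmegaSurface F Sp Sm) {y : Plane}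
    (hy : y ∈ T) : LinearIndependent ℝ ![s y, r y] ∧ ∃ m n : ℝ, m ≠ 0 ∧ n ≠ 0 ∧
      IsCurvatureSphere F (ψ.symm y) (m • s y + n • r y) ∧
      IsCurvatureSphere F (ψ.symm y) (m • s y - n • r y) := by
  obtain ⟨c₁, c₂, hli, k₁, k₂, hp, hm⟩ := h.harmonic (ψ.symm y)
  rw [c.span_s y hy] at hp
  rw [c.span_r y hy] at hm
  obtain ⟨a, ha⟩ := Submodule.mem_span_singleton.1 (hp ▸ Submodule.mem_span_singleton_self (c₁ + c₂))
  obtain ⟨b, hb⟩ := Submodule.mem_span_singleton.1 (hm ▸ Submodule.mem_span_singleton_self (c₁ - c₂))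
  obtain ⟨a', ha'⟩ := Submodule.mem_span_singleton.1 (hp ▸ Submodule.mem_span_singleton_self (s y))
  obtain ⟨b', hb'⟩ := Submodule.mem_span_singleton.1 (hm ▸ Submodule.mem_span_singleton_self (r y))
  have hpair := LinearIndependent.pair_iff.1 hli
  have ha0 : a ≠ 0 := by
    rintro rfl
    rw [zero_smul] at ha
    have := (hpair 1 1 (by rw [one_smul, one_smul, ← ha])).1
    norm_num at this
  have hb0 : b ≠ 0 := by
    rintro rfl
    rw [zero_smul] at hb
    have := (hpair 1 (-1) (by rw [one_smul, neg_one_smul, ← sub_eq_add_neg, ← hb])).1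
    norm_num at this
  have ha0' : a' ≠ 0 := by
    rintro rfl
    rw [← ha', zero_smul, smul_zero] at ha
    have := (hpair 1 1 (by rw [one_smul, one_smul, ← ha])).1
    norm_num at this
  have hb0' : b' ≠ 0 := by
    rintro rfl
    rw [← hb', zero_smul, smul_zero] at hb
    have := (hpair 1 (-1) (by rw [one_smul, neg_one_smul, ← sub_eq_add_neg, ← hb])).1
    norm_num at this
  refine ⟨?_, a / 2, b / 2, by simpa using ha0, by simpa using hb0, ?_, ?_⟩
  · rw [LinearIndependent.pair_iff]
    intro u v huv
    rw [← ha', ← hb'] at huv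
    have h1 := hpair (u * a' + v * b') (u * a' - v * b') (by rw [← huv]; module)
    have h2 : u * a' = 0 := by linarith [h1.1, h1.2]
    have h3 : v * b' = 0 := by linarith [h1.1, h1.2]
    exact ⟨(mul_eq_zero.1 h2).resolve_right ha0', (mul_eq_zero.1 h3).resolve_right hb0'⟩
  · convert k₁ using 1
    calc _ = (1 / 2 : ℝ) • (a • s y + b • r y) := by module
      _ = c₁ := by rw [ha, hb]; module
  · convert k₂ using 1
    calc _ = (1 / 2 : ℝ) • (a • s y - b • r y) := by module
      _ = c₂ := by rw [ha, hb]; module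

lemma mem_s (c : IsMoutardChart Sp Sm ψ T s r) (h : IsOmegaSurface F Sp Sm) {y : Plane}
    (hy : y ∈ T) : s y ∈ F (ψ.symm y) :=
  h.enveloped_p _ (c.span_s y hy ▸ Submodule.mem_span_singleton_self _)

lemma mem_r (c : IsMoutardChart Sp Sm ψ T s r) (h : IsOmegaSurface F Sp Sm) {y : Plane}
    (hy : y ∈ T) : r y ∈ F (ψ.symm y) :=
  h.enveloped_m _ (c.span_r y hy ▸ Submodule.mem_span_singleton_self _)

lemma eq_span (c : IsMoutardChart Sp Sm ψ T s r) (h : IsOmegaSurface F Sp Sm) {y : Plane}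
    (hy : y ∈ T) : F (ψ.symm y) = Submodule.span ℝ {s y, r y} := by
  symm
  apply Submodule.eq_of_le_of_finrank_eq
  · rw [Submodule.span_le]
    rintro _ (rfl | rfl)
    exacts [c.mem_s h hy, c.mem_r h hy]
  · have := finrank_span_eq_card (c.harmonic h hy).1
    rw [Matrix.range_cons_cons_empty, Fintype.card_fin] at this
    rw [this, (h.legendre.contactElement _).1]

lemma isOpen_source (c : IsMoutardChart Sp Sm ψ T s r) : IsOpen (ψ.source ∩ ψ ⁻¹' T) :=
  ψ.isOpen_inter_preimage c.isOpen

lemma symm_mem_source (c : IsMoutardChart Sp Sm ψ T s r) {y : Plane} (hy : y ∈ T) :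
    ψ.symm y ∈ ψ.source ∩ ψ ⁻¹' T :=
  ⟨ψ.map_target (c.subset hy), by simpa [ψ.right_inv (c.subset hy)] using hy⟩

lemma isSection (c : IsMoutardChart Sp Sm ψ T s r) (h : IsOmegaSurface F Sp Sm) (a b : ℝ) :
    IsSection F (ψ.source ∩ ψ ⁻¹' T) ((fun y => a • s y + b • r y) ∘ ψ) := by
  refine ⟨contMDiffOn_comp_chart c.atlas
    ((c.smooth_s.const_smul a).add (c.smooth_r.const_smul b)), fun x hx => ?_⟩
  have h1 := c.mem_s h hx.2
  have h2 := c.mem_r h hx.2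
  rw [ψ.left_inv hx.1] at h1 h2
  exact Submodule.add_mem _ (Submodule.smul_mem _ _ h1) (Submodule.smul_mem _ _ h2)

lemma deriv1_lift (c : IsMoutardChart Sp Sm ψ T s r) (a b : ℝ) {y : Plane} (hy : y ∈ T)
    (e : Plane) : deriv1 ((fun y => a • s y + b • r y) ∘ ψ) (ψ.symm y) (chartVec ψ y e)
      = e 0 • (a • pd 0 s y + b • pd 0 r y) + e 1 • (a • pd 1 s y + b • pd 1 r y) := by
  have ds := (c.smooth_s.contDiffAt (c.isOpen.mem_nhds hy)).differentiableAt (by simp)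
  have dr := (c.smooth_r.contDiffAt (c.isOpen.mem_nhds hy)).differentiableAt (by simp)
  rw [deriv1_comp_chart c.atlas c.isOpen
    ((c.smooth_s.const_smul a).add (c.smooth_r.const_smul b)) (c.subset hy) hy, fderiv_eq_pd]
  have key : ∀ i, pd i (fun y => a • s y + b • r y) y = a • pd i s y + b • pd i r y := fun i => by
    have h1 := pd_add (g := fun y => a • s y) (h := fun y => b • r y) (ds.const_smul a)
      (dr.const_smul b) i
    rw [h1, pd, pd, fderiv_fun_const_smul ds, fderiv_fun_const_smul dr]
    rfl
  rw [key, key]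

lemma form_lift (c : IsMoutardChart Sp Sm ψ T s r) (h : IsOmegaSurface F Sp Sm) {y : Plane}
    (hy : y ∈ T) : form (s y) (s y) = 0 ∧ form (s y) (r y) = 0 ∧ form (r y) (r y) = 0 := by
  have := (h.legendre.contactElement (ψ.symm y)).2
  exact ⟨this _ (c.mem_s h hy) _ (c.mem_s h hy), this _ (c.mem_s h hy) _ (c.mem_r h hy),
    this _ (c.mem_r h hy) _ (c.mem_r h hy)⟩

lemma form_pd_s_r (c : IsMoutardChart Sp Sm ψ T s r) (h : IsOmegaSurface F Sp Sm) (i : Fin 2)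
    {y : Plane} (hy : y ∈ T) : form (pd i s y) (r y) = 0 := by
  have hc := h.legendre.contact _ c.isOpen_source _ _ (c.isSection h 1 0) (c.isSection h 0 1) _
    (c.symm_mem_source hy) (chartVec ψ y (EuclideanSpace.single i 1))
  rw [c.deriv1_lift 1 0 hy] at hc
  simp only [Function.comp_apply, ψ.right_inv (c.subset hy)] at hc
  fin_cases i <;> simpa using hc

lemma form_pd_s_s (c : IsMoutardChart Sp Sm ψ T s r) (h : IsOmegaSurface F Sp Sm) (i : Fin 2)
    {y : Plane} (hy : y ∈ T) : form (pd i s y) (s y) = 0 :=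
  form_pd_self c.isOpen c.smooth_s (fun _ hz => (c.form_lift h hz).1) hy i

lemma form_pd_of_mem (c : IsMoutardChart Sp Sm ψ T s r) (h : IsOmegaSurface F Sp Sm) (i : Fin 2)
    {y : Plane} (hy : y ∈ T) {v : R42} (hv : v ∈ F (ψ.symm y)) : form v (pd i s y) = 0 := by
  rw [c.eq_span h hy] at hv
  obtain ⟨a, b, rfl⟩ := Submodule.mem_span_pair.1 hv
  simp [form_expand, form_comm _ (pd i s y), c.form_pd_s_s h i hy, c.form_pd_s_r h i hy]

lemma form_pd_pd_r (c : IsMoutardChart Sp Sm ψ T s r) (h : IsOmegaSurface F Sp Sm) (i j : Fin 2)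
    {y : Plane} (hy : y ∈ T) :
    form (pd i (pd j s) y) (r y) = -form (pd j s y) (pd i r y) :=
  form_pd_eq_neg c.isOpen (contDiffOn_pd c.isOpen c.smooth_s j) c.smooth_r
    (fun _ hz => c.form_pd_s_r h j hz) hy i

lemma form_pd_pd_s (c : IsMoutardChart Sp Sm ψ T s r) (h : IsOmegaSurface F Sp Sm) (i j : Fin 2)
    {y : Plane} (hy : y ∈ T) :
    form (pd i (pd j s) y) (s y) = -form (pd j s y) (pd i s y) :=
  form_pd_eq_neg c.isOpen (contDiffOn_pd c.isOpen c.smooth_s j) c.smooth_s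
    (fun _ hz => c.form_pd_s_s h j hz) hy i

/-- Differentiate (s_u, r) = (s_v, r) = 0 and use that s_uv is a multiple of s, hence orthogonal to
r. This makes the Moutard coordinates of s curvature line coordinates. -/
lemma form_pd_orth (c : IsMoutardChart Sp Sm ψ T s r) (h : IsOmegaSurface F Sp Sm)
    {y : Plane} (hy : y ∈ T) :
    form (pd 0 s y) (pd 1 r y) = 0 ∧ form (pd 1 s y) (pd 0 r y) = 0 := by
  obtain ⟨a, ha⟩ := Submodule.mem_span_singleton.1 (c.moutard y hy)
  have hsm := c.smooth_s.contDiffAt (c.isOpen.mem_nhds hy)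
  have h0 : form (pd 0 (pd 1 s) y) (r y) = 0 := by
    rw [← ha, form_smul_left, (c.form_lift h hy).2.1, mul_zero]
  have h1 := c.form_pd_pd_r h 0 1 hy
  have h2 := c.form_pd_pd_r h 1 0 hy
  rw [pd_comm hsm 1 0] at h2
  constructor <;> linarith

/-- The differentials of the lifts are diagonal modulo `F`, with opposite eigenvalues. -/
lemma exists_eigenvalue (c : IsMoutardChart Sp Sm ψ T s r) (h : IsOmegaSurface F Sp Sm)
    {y : Plane} (hy : y ∈ T) : ∃ α : ℝ, α ≠ 0 ∧
      pd 0 r y - α • pd 0 s y ∈ F (ψ.symm y) ∧ pd 1 r y + α • pd 1 s y ∈ F (ψ.symm y) := by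
  obtain ⟨-, m, n, hm, hn, k₁, k₂⟩ := c.harmonic h hy
  obtain ⟨o1, o2⟩ := c.form_pd_orth h hy
  have o3 := c.orth y hy
  have g0 := c.pos y hy 0
  have g1 := c.pos y hy 1
  have dir : ∀ n, IsCurvatureSphere F (ψ.symm y) (m • s y + n • r y) → ∃ e : Plane, e ≠ 0 ∧
      e 0 • (m • pd 0 s y + n • pd 0 r y) + e 1 • (m • pd 1 s y + n • pd 1 r y)
        ∈ F (ψ.symm y) ∧
      (e 0 ≠ 0 → m * form (pd 0 s y) (pd 0 s y) + n * form (pd 0 s y) (pd 0 r y) = 0) ∧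
      (e 1 ≠ 0 → m * form (pd 1 s y) (pd 1 s y) + n * form (pd 1 s y) (pd 1 r y) = 0) := by
    rintro n ⟨-, -, X, hX, hk⟩
    obtain ⟨e, rfl⟩ := (chartVec_bijective c.atlas (c.subset hy)).2 X
    have := hk _ c.isOpen_source (c.symm_mem_source hy) _ (c.isSection h m n)
      (by simp [ψ.right_inv (c.subset hy)])
    rw [c.deriv1_lift m n hy] at this
    have p0 := c.form_pd_of_mem h 0 hy this
    have p1 := c.form_pd_of_mem h 1 hy this
    simp only [form_expand, form_comm (pd 0 r y), form_comm (pd 1 r y), o1, o2, o3,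
      form_comm (pd 1 s y) (pd 0 s y)] at p0 p1
    refine ⟨e, by rintro rfl; exact hX (map_zero _), this, fun he => ?_, fun he => ?_⟩
    · exact (mul_eq_zero.1 (by simpa using p0)).resolve_left he
    · exact (mul_eq_zero.1 (by simpa using p1)).resolve_left he
  obtain ⟨e, he, hF, h0, h1⟩ := dir n k₁
  obtain ⟨e', he', hF', h0', h1'⟩ := dir (-n) (by rwa [neg_smul, ← sub_eq_add_neg])
  have ne : ∀ e : Plane, e ≠ 0 → e 0 ≠ 0 ∨ e 1 ≠ 0 := by
    intro e he
    by_contra! h2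
    apply he
    ext i
    fin_cases i
    exacts [h2.1, h2.2]
  have mg0 := mul_ne_zero hm g0.ne'
  have mg1 := mul_ne_zero hm g1.ne'
  -- The directions e and e' belong to m s + n r and m s - n r. If both had a component along the
  -- same coordinate, adding their equations would give 2m|s_i|² = 0. So e and e' are the two
  -- coordinate directions, in some order.
  have ex0 : ¬ (e 0 ≠ 0 ∧ e' 0 ≠ 0) := fun ⟨a, b⟩ => mg0 (by linarith [h0 a, h0' b])
  have ex1 : ¬ (e 1 ≠ 0 ∧ e' 1 ≠ 0) := fun ⟨a, b⟩ => mg1 (by linarith [h1 a, h1' b])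
  have fin : ∀ (a k : ℝ) (v w : R42), a ≠ 0 → k ≠ 0 → a • (m • v + k • w) ∈ F (ψ.symm y) →
      w + (m / k) • v ∈ F (ψ.symm y) := by
    intro a k v w ha hk hmem
    have := Submodule.smul_mem _ (a * k)⁻¹ hmem
    convert this using 1
    rw [smul_smul, smul_add, smul_smul, smul_smul, add_comm]
    congr 2
    · field_simp
    · rw [← one_smul ℝ w]; simp only [smul_smul]; congr 1; field_simp
  rcases ne e he with e0 | e1
  · have e0' : e' 0 = 0 := by by_contra h2; exact ex0 ⟨e0, h2⟩
    have e1' : e' 1 ≠ 0 := (ne e' he').resolve_left (by simpa using e0')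
    have e1 : e 1 = 0 := by by_contra h2; exact ex1 ⟨h2, e1'⟩
    rw [e1, zero_smul, add_zero] at hF
    rw [e0', zero_smul, zero_add] at hF'
    refine ⟨-(m / n), neg_ne_zero.2 (div_ne_zero hm hn), ?_, ?_⟩
    · rw [neg_smul, sub_neg_eq_add]; exact fin _ _ _ _ e0 hn hF
    · rw [← div_neg]; exact fin _ _ _ _ e1' (neg_ne_zero.2 hn) hF'
  · have e1' : e' 1 = 0 := by by_contra h2; exact ex1 ⟨e1, h2⟩
    have e0' : e' 0 ≠ 0 := (ne e' he').resolve_right (by simpa using e1')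
    have e0 : e 0 = 0 := by by_contra h2; exact ex0 ⟨h2, e0'⟩
    rw [e0, zero_smul, zero_add] at hF
    rw [e1', zero_smul, add_zero] at hF'
    refine ⟨m / n, div_ne_zero hm hn, ?_, ?_⟩
    · rw [sub_eq_add_neg, ← neg_smul, ← div_neg]; exact fin _ _ _ _ e0' (neg_ne_zero.2 hn) hF'
    · exact fin _ _ _ _ e1 hn hF

/-- A sphere which is enveloped by the other congruence touches the lift `s` nowhere. -/
lemma form_ne_zero (c : IsMoutardChart Sp Sm ψ T s r) (h : IsOmegaSurface F Sp Sm) {qp qm : R42}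
    (hqm : form qm qm = 0) (hqp : form qp qp = 0) (hq : form qp qm ≠ 0)
    (hs : ∀ y ∈ T, form (s y) qp = 0) (hr : ∀ y ∈ T, form (r y) qm = 0) {y : Plane} (hy : y ∈ T) :
    form (s y) qm ≠ 0 := by
  intro hy0
  have hT := c.isOpen
  have ss := fun i => contDiffOn_pd hT c.smooth_s i
  have sr := fun i => contDiffOn_pd hT c.smooth_r i
  have cst : ∀ w : R42, ContDiffOn ℝ ∞ (fun _ : Plane => w) T := fun w => contDiffOn_const
  have dat : ∀ {g : Plane → R42}, ContDiffOn ℝ ∞ g T → ∀ z ∈ T, DifferentiableAt ℝ g z :=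
    fun hg z hz => (hg.contDiffAt (hT.mem_nhds hz)).differentiableAt (by simp)
  have pdc : ∀ {g : Plane → R42}, ContDiffOn ℝ ∞ g T → ∀ z ∈ T, ∀ i,
      pd i (fun z => form (g z) qm) z = form (pd i g z) qm := fun hg z hz i => by
    rw [pd_form (dat hg z hz) (dat (cst qm) z hz)]; simp [pd, form_zero_right]
  have gi : ∀ z ∈ T, ∃ β : Fin 2 → ℝ, (∀ i, β i ≠ 0) ∧ β 1 = -β 0 ∧
      ∀ i, pd i r z - β i • pd i s z ∈ F (ψ.symm z) := by
    intro z hz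
    obtain ⟨α, hα, m0, m1⟩ := c.exists_eigenvalue h hz
    refine ⟨![α, -α], fun i => ?_, by simp, fun i => ?_⟩
    · fin_cases i <;> simpa using hα
    · fin_cases i
      · simpa using m0
      · simpa using m1
  have eig : ∀ z ∈ T, ∃ β : Fin 2 → ℝ, (∀ i, β i ≠ 0) ∧ β 1 = -β 0 ∧
      (∀ i, form (pd i r z) (pd i s z) = β i * form (pd i s z) (pd i s z)) ∧
      ∀ i, pd i r z - β i • pd i s z ∈ F (ψ.symm z) := by
    intro z hz
    obtain ⟨β, h1, h2, h3⟩ := gi z hz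
    refine ⟨β, h1, h2, fun i => ?_, h3⟩
    have := c.form_pd_of_mem h i hz (h3 i)
    rw [form_sub_left, form_smul_left] at this
    linarith
  obtain ⟨z₁, z₂, hz⟩ := exists_wedge_ne_zero (c.harmonic h hy).1
  -- From r_i - β_i s_i ∈ F and (r, qm) = 0 it follows that the derivative of (s, qm) is a multiple
  -- of (s, qm) itself. Its vanishing at y thus forces the first and second derivatives in direction
  -- i to vanish.
  have key : ∀ i, form (pd i s y) qm = 0 ∧ form (pd i (pd i s) y) qm = 0 := by
    intro i
    -- The multiple |s_i|²(r_i - β_i s_i), written without β_i so that it is visibly smooth. Wedging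
    -- with r extracts its coefficient along s.
    let D : Plane → R42 := fun z => form (pd i s z) (pd i s z) • pd i r z
      - form (pd i r z) (pd i s z) • pd i s z
    have hD : ContDiffOn ℝ ∞ D T := ((contDiffOn_form (ss i) (ss i)).smul (sr i)).sub
      ((contDiffOn_form (sr i) (ss i)).smul (ss i))
    have w1 := fun {g h : Plane → R42} (hg : ContDiffOn ℝ ∞ g T) (hh : ContDiffOn ℝ ∞ h T) =>
      ((contDiffOn_form hg (cst z₁)).mul (contDiffOn_form hh (cst z₂))).sub
        ((contDiffOn_form hg (cst z₂)).mul (contDiffOn_form hh (cst z₁)))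
    have := pd_eq_zero_of_mul_eq hT (h := fun z => form (s z) qm) (i := i)
      (w := fun z => -form (pd i r z) (pd i s z) * wedge (s z) (r z) z₁ z₂)
      (K := fun z => wedge (D z) (r z) z₁ z₂)
      (contDiffOn_form c.smooth_s (cst qm))
      ((contDiffOn_form (sr i) (ss i)).neg.mul (w1 c.smooth_s c.smooth_r))
      (w1 hD c.smooth_r) (fun z hz => ?_) hy ?_ hy0
    · obtain ⟨h1, h2⟩ := this
      rw [pdc c.smooth_s y hy] at h1
      rw [pd_congr_of_eqOn hT (fun z hz => pdc c.smooth_s z hz i) hy, pdc (ss i) y hy] at h2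
      exact ⟨h1, h2⟩
    · obtain ⟨β, -, -, h3, h4⟩ := eig z hz
      have hDF : D z ∈ F (ψ.symm z) := by
        have := Submodule.smul_mem _ (form (pd i s z) (pd i s z)) (h4 i)
        convert this using 1
        simp only [D, h3 i]
        module
      have hDq : form (D z) qm = -form (pd i r z) (pd i s z) * form (pd i s z) qm := by
        have := form_pd_const hT c.smooth_r hr hz i
        simp only [D, form_expand, this]; ring
      rw [c.eq_span h hz] at hDF
      obtain ⟨a, b, hab⟩ := Submodule.mem_span_pair.1 hDF
      have hDq' : form (D z) qm = a * form (s z) qm := by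
        rw [← hab]; simp [form_expand, hr z hz]
      have hW : wedge (D z) (r z) z₁ z₂ = a * wedge (s z) (r z) z₁ z₂ := by
        rw [← hab]; simp only [wedge, form_expand]; ring
      rw [pdc c.smooth_s z hz, hW]
      linear_combination wedge (s z) (r z) z₁ z₂ * (hDq' - hDq)
    · obtain ⟨β, h1, -, h3, -⟩ := eig y hy
      refine mul_ne_zero (neg_ne_zero.2 ?_) hz
      rw [h3]
      exact mul_ne_zero (h1 i) (c.pos y hy i).ne'
  obtain ⟨f1, f2, f3⟩ := c.form_lift h hy
  have hs0 : s y ≠ 0 := (c.harmonic h hy).1.ne_zero 0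
  -- At y both s and r minus its qm-part are null, mutually orthogonal and orthogonal to the plane
  -- of qp and qm, so they are proportional. The auxiliary vector is a unit timelike vector of that
  -- plane.
  obtain ⟨a, ha⟩ := exists_smul_eq_of_null (p := qp + (-1 / (2 * form qp qm)) • qm) (s := s y)
    (z := r y - (form (r y) qp / form qp qm) • qm)
    (by simp only [form_expand, hqm, hqp, form_comm qm qp]; field_simp; ring) f1
    (by simp [form_expand, hqm, f3, hr y hy, form_comm qm (r y)])
    (by simp [form_expand, f2, hy0]) (by simp [form_expand, hs y hy, hy0])
    (by simp only [form_expand, hqm, hr y hy, form_comm qm qp]; field_simp; ring) hs0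
  have hr' : r y = a • s y + (form (r y) qp / form qp qm) • qm := by rw [← ha]; module
  -- In (s_ii, r) = -(s_i, r_i) the qm-part of r contributes nothing, as (s_ii, qm) = 0, and (s_ii,
  -- s) = -|s_i|². Hence both eigenvalues equal a, although they are nonzero and opposite.
  have hi : ∀ i, form (pd i r y) (pd i s y) = a * form (pd i s y) (pd i s y) := by
    intro i
    have h1 := c.form_pd_pd_r h i i hy
    have h2 := c.form_pd_pd_s h i i hy
    rw [hr', form_add_right, form_smul_right, form_smul_right, (key i).2, h2,
      form_comm (pd i s y) (pd i r y)] at h1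
    linarith
  obtain ⟨β, h1, h2, h3, -⟩ := eig y hy
  have hβ : ∀ i, β i = a := fun i =>
    mul_right_cancel₀ (c.pos y hy i).ne' ((h3 i).symm.trans (hi i))
  have := hβ 0
  have := hβ 1
  exact h1 0 (by linarith)

end IsMoutardChart

/-- Replacing c₂ by -c₂ exchanges c₁ + c₂ and c₁ - c₂. -/
lemma IsOmegaTouching.symm {Qp Qm : Submodule ℝ R42} (h : IsOmegaTouching F Sp Sm Qp Qm) :
    IsOmegaTouching F Sm Sp Qm Qp := by
  refine ⟨⟨h.omega.legendre, h.omega.enveloped_m, h.omega.enveloped_p, h.omega.isothermic_m,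
    h.omega.isothermic_p, fun x => ?_⟩, h.sphere_m, h.sphere_p, h.touch_m, h.touch_p, fun ht =>
    h.not_touch fun a ha b hb => by rw [form_comm]; exact ht b hb a ha⟩
  obtain ⟨c₁, c₂, hli, k₁, k₂, hp, hm⟩ := h.omega.harmonic x
  refine ⟨c₁, -c₂, ?_, k₁, ?_, by rw [hm, sub_eq_add_neg], by rw [hp, sub_neg_eq_add]⟩
  · rw [LinearIndependent.pair_iff] at hli ⊢
    intro a b hab
    have := hli a (-b) (by rw [← hab]; module)
    exact ⟨this.1, by linarith [this.2]⟩
  · have := k₂.smul (a := -1) (by norm_num)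
    rwa [neg_one_smul] at this

lemma IsOmegaTouching.form_ne_zero {Qp Qm : Submodule ℝ R42} (h : IsOmegaTouching F Sp Sm Qp Qm)
    {qp qm : R42} (hp : qp ∈ Qp) (hm : qm ∈ Qm) (hq : form qp qm ≠ 0) {x : M} {v : R42}
    (hv : v ∈ Sp x) (hv0 : v ≠ 0) : form v qm ≠ 0 := by
  obtain ⟨ψ, T, s, r, c, y, hy, rfl⟩ := h.omega.exists_moutardChart x
  have null : ∀ {Q : Submodule ℝ R42}, IsSphere Q → ∀ v ∈ Q, form v v = 0 := by
    rintro _ ⟨w, -, hw, rfl⟩ v hv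
    obtain ⟨a, rfl⟩ := Submodule.mem_span_singleton.1 hv
    simp [form_expand, hw]
  have := c.form_ne_zero h.omega (null h.sphere_m qm hm) (null h.sphere_p qp hp) hq
    (fun z hz => h.touch_p _ _ (c.span_s z hz ▸ Submodule.mem_span_singleton_self _) _ hp)
    (fun z hz => h.touch_m _ _ (c.span_r z hz ▸ Submodule.mem_span_singleton_self _) _ hm) hy
  rw [c.span_s y hy] at hv
  obtain ⟨a, rfl⟩ := Submodule.mem_span_singleton.1 hv
  rw [form_smul_left]
  exact mul_ne_zero (by rintro rfl; exact hv0 (zero_smul _ _)) this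

end Nondegeneracy


/-! ### From touching sphere congruences to flat fronts -/

lemma SeparateHarmonically.umbilicFree {M : Type*} [TopologicalSpace M] [ChartedSpace Plane M]
    {F Sp Sm : M → Submodule ℝ R42} (h : SeparateHarmonically F Sp Sm) : UmbilicFree F := by
  intro x
  obtain ⟨c₁, c₂, hli, h₁, h₂, -⟩ := h x
  exact ⟨c₁, c₂, hli, h₁, h₂⟩

/-- The tetrad determined by normalized null vectors. -/
lemma isTetrad_of_null {a b s r : R42} (haa : form a a = 0) (hbb : form b b = 0)
    (hab : form a b = -2) (hss : form s s = 0) (hrr : form r r = 0) (hsr : form s r = 0)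
    (hsa : form s a = 0) (hsb : form s b = -2) (hra : form r a = -2) (hrb : form r b = 0) :
    IsTetrad ((1 / 2 : ℝ) • (a + b)) ((1 / 2 : ℝ) • (a - b))
      ((1 / 2 : ℝ) • (s - r) - (1 / 2 : ℝ) • (a - b))
      ((1 / 2 : ℝ) • (s + r) - (1 / 2 : ℝ) • (a + b)) := by
  constructor <;>
  simp only [form_expand, haa, hbb, hab, hss, hrr, hsr, hsa, hsb, hra, hrb, form_comm b a,
    form_comm r s, form_comm a s, form_comm b s, form_comm a r, form_comm b r] <;> norm_num

section OmegaToFlatFront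

variable {M : Type*} [TopologicalSpace M] [ChartedSpace Plane M]
  {F Sp Sm : M → Submodule ℝ R42} {Qp Qm : Submodule ℝ R42}

/-- The normalized lift of a touching sphere congruence. -/
lemma IsOmegaTouching.exists_lift (h : IsOmegaTouching F Sp Sm Qp Qm) {qp qm : R42}
    (hp : qp ∈ Qp) (hm : qm ∈ Qm) (hq : form qp qm = -2) :
    ∃ σ : M → R42, ContMDiff 𝓘(ℝ, Plane) 𝓘(ℝ, R42) ∞ σ ∧
      ∀ x, Sp x = Submodule.span ℝ {σ x} ∧ form (σ x) qm = -2 := by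
  have hne := fun {x : M} {v : R42} => h.form_ne_zero hp hm (by rw [hq]; norm_num) (x := x) (v := v)
  have ex : ∀ x, ∃ v, Sp x = Submodule.span ℝ {v} ∧ form v qm = -2 := by
    intro x
    obtain ⟨ψ, T, s, r, c, y, hy, rfl⟩ := h.omega.exists_moutardChart x
    have hs0 : s y ≠ 0 := (c.harmonic h.omega hy).1.ne_zero 0
    have h1 := hne (c.span_s y hy ▸ Submodule.mem_span_singleton_self _) hs0
    refine ⟨(-2 / form (s y) qm) • s y, ?_, ?_⟩
    · rw [Submodule.span_singleton_smul_eq (IsUnit.mk0 _ (div_ne_zero (by norm_num) h1))]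
      exact c.span_s y hy
    · rw [form_smul_left]; field_simp
  choose σ hσ hσq using ex
  refine ⟨σ, fun x => ?_, fun x => ⟨hσ x, hσq x⟩⟩
  obtain ⟨ψ, T, s, r, c, y, hy, rfl⟩ := h.omega.exists_moutardChart x
  have hsq : ∀ z ∈ T, form (s z) qm ≠ 0 := fun z hz =>
    hne (c.span_s z hz ▸ Submodule.mem_span_singleton_self _)
      ((c.harmonic h.omega hz).1.ne_zero 0)
  -- The normalization singles out one vector of each line, so the pointwise choice coincides with
  -- this smooth local formula.
  have hsm : ContDiffOn ℝ ∞ (fun z => (-2 / form (s z) qm) • s z) T :=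
    (contDiffOn_const.div (contDiffOn_form c.smooth_s contDiffOn_const) hsq).smul c.smooth_s
  refine ((contMDiffOn_comp_chart c.atlas hsm).congr fun z hz => ?_).contMDiffAt
    (c.isOpen_source.mem_nhds (c.symm_mem_source hy))
  have h1 := c.span_s _ hz.2
  rw [ψ.left_inv hz.1] at h1
  obtain ⟨a, ha⟩ := Submodule.mem_span_singleton.1 (h1 ▸ hσ z ▸ Submodule.mem_span_singleton_self _ :
    σ z ∈ Submodule.span ℝ {s (ψ z)})
  have h2 := hσq z
  rw [← ha, form_smul_left] at h2
  rw [← ha, Function.comp_apply, ← h2, mul_div_cancel_right₀ _ (hsq _ hz.2)]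

lemma IsOmegaTouching.exists_normalized (h : IsOmegaTouching F Sp Sm Qp Qm) :
    ∃ a b : R42, Qp = Submodule.span ℝ {a} ∧ Qm = Submodule.span ℝ {b} ∧ form a a = 0 ∧
      form b b = 0 ∧ form a b = -2 := by
  obtain ⟨a, -, haa, rfl⟩ := h.sphere_p
  obtain ⟨b, -, hbb, rfl⟩ := h.sphere_m
  have hab : form a b ≠ 0 := fun h0 => h.not_touch (touch_span_iff.2 h0)
  refine ⟨a, (-2 / form a b) • b, rfl, ?_, haa, by simp [form_expand, hbb], ?_⟩
  · rw [Submodule.span_singleton_smul_eq (IsUnit.mk0 _ (div_ne_zero (by norm_num) hab))]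
  · rw [form_smul_right]; field_simp

variable [IsManifold 𝓘(ℝ, Plane) ∞ M]

/-- A Legendre map whose contact elements are spanned by `q + f` and `p + t` comes
from a front. -/
lemma IsLegendre.isFront {H : HyperbolicModel} {f t : M → R42}
    (h : IsLegendre (legendreLift H f t)) (hf : ContMDiff 𝓘(ℝ, Plane) 𝓘(ℝ, R42) ∞ f)
    (ht : ContMDiff 𝓘(ℝ, Plane) 𝓘(ℝ, R42) ∞ t) (T : ∀ x, IsTetrad H.p H.q (f x) (t x))
    (ho : ∀ x, form (f x) H.o < 0) : IsFront H f t := by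
  have hq : ∀ x, H.q + f x ∈ legendreLift H f t x := fun x => Submodule.subset_span (by simp)
  have hp : ∀ x, H.p + t x ∈ legendreLift H f t x := fun x => Submodule.subset_span (by simp)
  have df := fun x => hf.mdifferentiable (by simp) x
  have dt := fun x => ht.mdifferentiable (by simp) x
  refine ⟨hf, ht, fun x => ⟨(T x).fp, (T x).fq, (T x).ff, ho x⟩, fun x => (T x).tp,
    fun x => (T x).tq, fun x => (T x).tt, fun x => (T x).tf, fun x X => ?_, fun x X h1 h2 => ?_⟩
  · have := h.contact univ isOpen_univ (fun z => H.q + f z) (fun z => H.p + t z)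
      ⟨(contMDiff_const.add hf).contMDiffOn, fun z _ => hq z⟩
      ⟨(contMDiff_const.add ht).contMDiffOn, fun z _ => hp z⟩ x (mem_univ x) X
    rw [deriv1_const_add (df x), form_add_right,
      form_deriv1_const univ_mem (df x) (fun z _ => (T z).fp), zero_add] at this
    exact this
  · refine h.immersion x X fun U hU hx ρ hρ => ?_
    rw [deriv1_eq_of_eq_combination (df x) (dt x) (mdifferentiableAt_of_contMDiffOn hU hρ.1 hx)
      (hU.mem_nhds hx) (fun z hz => (T z).mem_span_iff.1 (hρ.2 z hz)) X, h1, h2, smul_zero,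
      smul_zero, sub_zero, zero_add]
    exact Submodule.sub_mem _ (Submodule.smul_mem _ _ (hq x)) (Submodule.smul_mem _ _ (hp x))

/-- The vectors p, q, f, t are obtained by solving a = p + q, b = p - q, σ = a + (t + f), ρ = b + (t
- f) for normalized generators a, b and lifts σ, ρ. -/
lemma IsOmegaTouching.exists_flatFront [ConnectedSpace M] (h : IsOmegaTouching F Sp Sm Qp Qm) :
    ∃ (H : HyperbolicModel) (f t : M → R42), IsFlatFront H f t ∧ F = legendreLift H f t ∧
      Qp = Submodule.span ℝ {H.p + H.q} ∧ Qm = Submodule.span ℝ {H.p - H.q} ∧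
      (∀ x, Sp x = Submodule.span ℝ {(H.p + H.q) + (t x + f x)}) ∧
      (∀ x, Sm x = Submodule.span ℝ {(H.p - H.q) + (t x - f x)}) := by
  obtain ⟨a, b, hQp, hQm, haa, hbb, hab⟩ := h.exists_normalized
  have ha : a ∈ Qp := hQp ▸ Submodule.mem_span_singleton_self _
  have hb : b ∈ Qm := hQm ▸ Submodule.mem_span_singleton_self _
  obtain ⟨σ, sσ, hσ⟩ := h.exists_lift ha hb hab
  obtain ⟨ρ, sρ, hρ⟩ := h.symm.exists_lift hb ha (by rw [form_comm, hab])
  have mσ : ∀ x, σ x ∈ Sp x := fun x => (hσ x).1 ▸ Submodule.mem_span_singleton_self _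
  have mρ : ∀ x, ρ x ∈ Sm x := fun x => (hρ x).1 ▸ Submodule.mem_span_singleton_self _
  have fσ := fun x => h.omega.enveloped_p x (mσ x)
  have fρ := fun x => h.omega.enveloped_m x (mρ x)
  have null := fun x => (h.omega.legendre.contactElement x).2
  set p : R42 := (1 / 2 : ℝ) • (a + b) with hp
  set q : R42 := (1 / 2 : ℝ) • (a - b) with hq
  let f : M → R42 := fun x => (1 / 2 : ℝ) • (σ x - ρ x) - q
  let t : M → R42 := fun x => (1 / 2 : ℝ) • (σ x + ρ x) - p
  have T : ∀ x, IsTetrad p q (f x) (t x) := fun x =>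
    isTetrad_of_null haa hbb hab (null x _ (fσ x) _ (fσ x)) (null x _ (fρ x) _ (fρ x))
      (null x _ (fσ x) _ (fρ x)) (h.touch_p x _ (mσ x) _ ha) (hσ x).2 (hρ x).2
      (h.touch_m x _ (mρ x) _ hb)
  have hcs : ∀ c : ℝ, ContMDiff 𝓘(ℝ, R42) 𝓘(ℝ, R42) ∞ (fun v : R42 => c • v) := fun c =>
    (contDiff_const_smul c).contMDiff
  have sf : ContMDiff 𝓘(ℝ, Plane) 𝓘(ℝ, R42) ∞ f :=
    ((hcs _).comp (sσ.sub sρ)).sub contMDiff_const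
  have st : ContMDiff 𝓘(ℝ, Plane) 𝓘(ℝ, R42) ∞ t :=
    ((hcs _).comp (sσ.add sρ)).sub contMDiff_const
  obtain ⟨x₀⟩ : Nonempty M := inferInstance
  let H : HyperbolicModel := ⟨p, q, f x₀, (T x₀).pp, (T x₀).qq, (T x₀).pq, (T x₀).fp, (T x₀).fq,
    (T x₀).ff⟩
  -- The sheet is that of f(x₀). Orthogonality of f(z) to p and f(x₀) would make f(z) spacelike, so
  -- (f, f(x₀)) has no zero and by connectedness stays negative.
  have hcont : Continuous fun x => form (f x) (f x₀) :=
    (formCLM (f x₀)).continuous.comp sf.continuous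
  have ho : ∀ x, form (f x) H.o < 0 := by
    intro x
    by_contra! hx
    obtain ⟨z, hz⟩ := intermediate_value_univ x₀ x hcont
      ⟨by simp only [(T x₀).ff]; norm_num, hx⟩
    have hz0 : f z ≠ 0 := fun h0 => by
      have := (T z).ff
      rw [h0, form_zero_left] at this
      norm_num at this
    have := form_pos_of_orthogonal (T z).pp (T x₀).ff (by rw [form_comm, (T x₀).fp]) (T z).fp hz hz0
    rw [(T z).ff] at this
    norm_num at this
  have eσ : ∀ x, (p + q) + (t x + f x) = σ x := fun x => by simp only [t, f]; module
  have eρ : ∀ x, (p - q) + (t x - f x) = ρ x := fun x => by simp only [t, f]; module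
  have hF : F = legendreLift H f t := by
    funext x
    symm
    apply Submodule.eq_of_le_of_finrank_eq
    · rw [legendreLift, Submodule.span_le]
      have e1 : q + f x = (1 / 2 : ℝ) • (σ x - ρ x) := by simp only [f]; abel
      have e2 : p + t x = (1 / 2 : ℝ) • (σ x + ρ x) := by simp only [t]; abel
      rintro _ (rfl | rfl)
      · exact e1 ▸ Submodule.smul_mem _ _ (Submodule.sub_mem _ (fσ x) (fρ x))
      · exact e2 ▸ Submodule.smul_mem _ _ (Submodule.add_mem _ (fσ x) (fρ x))
    · rw [(h.omega.legendre.contactElement x).1]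
      exact (T x).isContactElement.1
  have hfront : IsFront H f t := (hF ▸ h.omega.legendre).isFront sf st T ho
  have hSp : ∀ x, Sp x = Submodule.span ℝ {(H.p + H.q) + (t x + f x)} := fun x => by
    rw [(hσ x).1]; exact congrArg (fun v => Submodule.span ℝ {v}) (eσ x).symm
  have hSm : ∀ x, Sm x = Submodule.span ℝ {(H.p - H.q) + (t x - f x)} := fun x => by
    rw [(hρ x).1]; exact congrArg (fun v => Submodule.span ℝ {v}) (eρ x).symm
  have harm : SeparateHarmonically (legendreLift H f t) Sp Sm := hF ▸ h.omega.harmonic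
  refine ⟨H, f, t, hfront.isFlatFront (fun x => ?_) harm.umbilicFree, hF, ?_, ?_, hSp, hSm⟩
  · obtain ⟨c₁, c₂, -, h₁, h₂, h₃, h₄⟩ := harm x
    exact hfront.flatAt_of_harmonic h₁ h₂ ((hSp x).symm.trans h₃) ((hSm x).symm.trans h₄)
  · rw [hQp]; congr 2; simp only [H, hp, hq]; module
  · rw [hQm]; congr 2; simp only [H, hp, hq]; module

end OmegaToFlatFront

/-! ### Uniqueness up to parallel transformation -/

/-- The factors by which p + q and p - q may change have product 1, because (p+q, p-q) = -2 for
every hyperbolic model. -/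
lemma exists_exp_of_mul_eq_one {l m : ℝ} (h : l * m = 1) :
    ∃ a ε : ℝ, (ε = 1 ∨ ε = -1) ∧ l = ε * Real.exp a ∧ m = ε * Real.exp (-a) := by
  have hl : l ≠ 0 := left_ne_zero_of_mul_eq_one h
  have hm : m = l⁻¹ := eq_inv_of_mul_eq_one_right h
  rcases lt_or_gt_of_ne hl with h0 | h0
  · refine ⟨Real.log (-l), -1, Or.inr rfl, ?_, ?_⟩
    · rw [Real.exp_log (by linarith)]; ring
    · rw [Real.exp_neg, Real.exp_log (by linarith), hm, inv_neg]; ring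
  · refine ⟨Real.log l, 1, Or.inl rfl, ?_, ?_⟩
    · rw [Real.exp_log h0, one_mul]
    · rw [Real.exp_neg, Real.exp_log h0, hm, one_mul]

/-- Hyperbolic spaces with the same infinity spheres are related by parallel transformation. -/
lemma HyperbolicModel.exists_parallel {H H' : HyperbolicModel}
    (h : H'.AreInfinitySpheres (Submodule.span ℝ {H.p + H.q}) (Submodule.span ℝ {H.p - H.q})) :
    ∃ a ε δ : ℝ, (ε = 1 ∨ ε = -1) ∧ (δ = 1 ∨ δ = -1) ∧
      H'.p = ε • (H.parallel a).p ∧ H'.q = δ • (H.parallel a).q := by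
  have hp := (h.2 _).1 ((H'.areInfinitySpheres.2 _).2 (Or.inl rfl))
  have hm := (h.2 _).1 ((H'.areInfinitySpheres.2 _).2 (Or.inr rfl))
  have hne := H'.span_add_ne_span_sub
  have hpm := H'.form_add_sub
  have hpm₀ := H.form_add_sub
  have half : ∀ {K : HyperbolicModel} {u v : R42}, K.p + K.q = u → K.p - K.q = v →
      K.p = (1 / 2 : ℝ) • (u + v) ∧ K.q = (1 / 2 : ℝ) • (u - v) := by
    rintro K _ _ rfl rfl
    constructor <;> module
  rcases hp with hp | hp <;> rcases hm with hm | hm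
  · exact absurd (hp.trans hm.symm) hne
  · obtain ⟨l, hl⟩ := Submodule.mem_span_singleton.1 (hp ▸ Submodule.mem_span_singleton_self _)
    obtain ⟨m, hm⟩ := Submodule.mem_span_singleton.1 (hm ▸ Submodule.mem_span_singleton_self _)
    rw [← hl, ← hm, form_smul_left, form_smul_right, hpm₀] at hpm
    obtain ⟨a, ε, hε, rfl, rfl⟩ := exists_exp_of_mul_eq_one (l := l) (m := m) (by linarith)
    rw [mul_smul, ← H.parallel_add] at hl
    rw [mul_smul, ← H.parallel_sub] at hm
    obtain ⟨h1, h2⟩ := half hl.symm hm.symm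
    refine ⟨a, ε, ε, hε, hε, ?_, ?_⟩
    · rw [h1]; module
    · rw [h2]; module
  · obtain ⟨l, hl⟩ := Submodule.mem_span_singleton.1 (hp ▸ Submodule.mem_span_singleton_self _)
    obtain ⟨m, hm⟩ := Submodule.mem_span_singleton.1 (hm ▸ Submodule.mem_span_singleton_self _)
    rw [← hl, ← hm, form_smul_left, form_smul_right, form_comm, hpm₀] at hpm
    obtain ⟨a, ε, hε, rfl, rfl⟩ := exists_exp_of_mul_eq_one (l := m) (m := l) (by linarith)
    rw [mul_smul, ← H.parallel_sub] at hl
    rw [mul_smul, ← H.parallel_add] at hm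
    obtain ⟨h1, h2⟩ := half hl.symm hm.symm
    -- Here p' + q' is proportional to p - q: the orientations are exchanged, which reverses the
    -- relative sign of q'.
    refine ⟨a, ε, -ε, hε, by rcases hε with rfl | rfl <;> simp, ?_, ?_⟩
    · rw [h1]; module
    · rw [h2]; module
  · exact absurd (hp.trans hm.symm) hne

section Uniqueness

variable {M : Type*} [TopologicalSpace M] [ChartedSpace Plane M]

/-- Fronts with the same Legendre lift with respect to point sphere complexes which agree up to
orientation agree up to orientation. -/
lemma IsFront.eq_of_legendreLift_eq {H H' : HyperbolicModel} {f t f' t' : M → R42}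
    (h : IsFront H f t) (h' : IsFront H' f' t') (hF : legendreLift H f t = legendreLift H' f' t')
    {ε δ : ℝ} (hε : ε = 1 ∨ ε = -1) (hδ : δ = 1 ∨ δ = -1) (hp : H'.p = ε • H.p)
    (hq : H'.q = δ • H.q) (x : M) : f' x = δ • f x ∧ t' x = ε • t x := by
  have hp' : H.p = ε • H'.p := by rw [hp, smul_smul]; rcases hε with rfl | rfl <;> simp
  have hq' : H.q = δ • H'.q := by rw [hq, smul_smul]; rcases hδ with rfl | rfl <;> simp
  have T := h.tetrad x
  have T' := h'.tetrad x
  have eq : ∀ v w, v ∈ legendreLift H f t x → w ∈ legendreLift H f t x →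
      form v H.q = form w H.q → form v H.p = form w H.p → v = w := fun v w hv hw h1 h2 =>
    sub_eq_zero.1 (h.eq_zero_of_mem_lift (Submodule.sub_mem _ hv hw)
      (by rw [form_sub_left, h1, sub_self]) (by rw [form_sub_left, h2, sub_self]))
  constructor
  · have := eq (H'.q + f' x) (δ • (H.q + f x))
      (hF ▸ Submodule.subset_span (by simp))
      (Submodule.smul_mem _ _ (Submodule.subset_span (by simp)))
      (by rw [form_smul_left, form_add_left H.q, T.qq, T.fq]
          rw [hq']; simp [form_expand, T'.qq, T'.fq])
      (by rw [form_smul_left, form_add_left H.q, form_comm H.q, T.pq, T.fp]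
          rw [hp']; simp [form_expand, form_comm H'.q, T'.pq, T'.fp])
    rw [hq, smul_add] at this
    exact add_left_cancel this
  · have := eq (H'.p + t' x) (ε • (H.p + t x))
      (hF ▸ Submodule.subset_span (by simp))
      (Submodule.smul_mem _ _ (Submodule.subset_span (by simp)))
      (by rw [form_smul_left, form_add_left H.p, T.pq, T.tq]
          rw [hq']; simp [form_expand, T'.pq, T'.tq])
      (by rw [form_smul_left, form_add_left H.p, T.pp, T.tp]
          rw [hp']; simp [form_expand, T'.pp, T'.tp])
    rw [hp, smul_add] at this
    exact add_left_cancel this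

/-- After a parallel transformation the models agree up to signs, and the common lift then
determines the front up to the same signs. For δ = -1 the map f' = -f_a lies on the opposite sheet,
which is excluded if the spaces coincide. -/
lemma IsFront.exists_parallel [IsManifold 𝓘(ℝ, Plane) ∞ M] [Nonempty M] {H H' : HyperbolicModel}
    {f t f' t' : M → R42} (h : IsFront H f t) (h' : IsFront H' f' t')
    (hF : legendreLift H f t = legendreLift H' f' t')
    (hQ : H'.AreInfinitySpheres (Submodule.span ℝ {H.p + H.q}) (Submodule.span ℝ {H.p - H.q})) :
    ∃ a ε δ : ℝ, (ε = 1 ∨ ε = -1) ∧ (δ = 1 ∨ δ = -1) ∧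
      H'.p = ε • (H.parallel a).p ∧ H'.q = δ • (H.parallel a).q ∧
      (∀ x, f' x = δ • parallelFront f t a x) ∧ (∀ x, t' x = ε • parallelNormal f t a x) ∧
      (H'.space = H.space → δ = 1) := by
  obtain ⟨a, ε, δ, hε, hδ, hp, hq⟩ := HyperbolicModel.exists_parallel hQ
  have ha := h.parallel a
  have eq := ha.eq_of_legendreLift_eq h' ((legendreLift_parallel a).trans hF) hε hδ hp hq
  refine ⟨a, ε, δ, hε, hδ, hp, hq, fun x => (eq x).1, fun x => (eq x).2, fun hs => ?_⟩
  refine hδ.resolve_right ?_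
  rintro rfl
  obtain ⟨x⟩ := ‹Nonempty M›
  have h1 := h'.mem_space x
  have h2 := ha.mem_space x
  rw [hs, (eq x).1, neg_one_smul] at h1
  rw [H.space_parallel] at h2
  have h3 := h1.2.2.2
  rw [form_neg_left] at h3
  linarith [h2.2.2.2]

end Uniqueness

end LieSphere

/-! ### The main theorem -/

theorem mainTheorem1 {M : Type*} [TopologicalSpace M] [ChartedSpace Plane M]
    [IsManifold 𝓘(ℝ, Plane) ∞ M] [ConnectedSpace M] :
    -- characterization of the Legendre lifts of (umbilic-free) flat fronts
    (∀ F : M → Submodule ℝ R42,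
      (UmbilicFree F ∧ ∃ (H : HyperbolicModel) (f t : M → R42),
          IsFlatFront H f t ∧ F = legendreLift H f t) ↔
        ∃ (Sp Sm : M → Submodule ℝ R42) (Qp Qm : Submodule ℝ R42),
          IsOmegaTouching F Sp Sm Qp Qm) ∧
    -- from a flat front to the sphere congruences and the infinity spheres
    (∀ (H : HyperbolicModel) (f t : M → R42), IsFlatFront H f t →
      UmbilicFree (legendreLift H f t) →
        IsOmegaTouching (legendreLift H f t)
          (fun x => Submodule.span ℝ {(H.p + H.q) + (t x + f x)})
          (fun x => Submodule.span ℝ {(H.p - H.q) + (t x - f x)})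
          (Submodule.span ℝ {H.p + H.q}) (Submodule.span ℝ {H.p - H.q}) ∧
        H.AreInfinitySpheres (Submodule.span ℝ {H.p + H.q}) (Submodule.span ℝ {H.p - H.q})) ∧
    -- from the fixed spheres to the flat front, uniquely up to parallel transformation
    (∀ (F Sp Sm : M → Submodule ℝ R42) (Qp Qm : Submodule ℝ R42),
      IsOmegaTouching F Sp Sm Qp Qm →
        ∃ (H : HyperbolicModel) (f t : M → R42),
          IsFlatFront H f t ∧ F = legendreLift H f t ∧
          Qp = Submodule.span ℝ {H.p + H.q} ∧ Qm = Submodule.span ℝ {H.p - H.q} ∧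
          H.AreInfinitySpheres Qp Qm ∧
          (∀ x, Sp x = Submodule.span ℝ {(H.p + H.q) + (t x + f x)}) ∧
          (∀ x, Sm x = Submodule.span ℝ {(H.p - H.q) + (t x - f x)}) ∧
          (∀ a : ℝ, (H.parallel a).space = H.space ∧
            (H.parallel a).AreInfinitySpheres Qp Qm ∧
            IsFlatFront (H.parallel a) (parallelFront f t a) (parallelNormal f t a) ∧
            F = legendreLift (H.parallel a) (parallelFront f t a) (parallelNormal f t a)) ∧
          (∀ (H' : HyperbolicModel) (f' t' : M → R42),
            IsFlatFront H' f' t' → F = legendreLift H' f' t' → H'.AreInfinitySpheres Qp Qm →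
              ∃ a ε δ : ℝ, (ε = 1 ∨ ε = -1) ∧ (δ = 1 ∨ δ = -1) ∧
                H'.p = ε • (H.parallel a).p ∧ H'.q = δ • (H.parallel a).q ∧
                (∀ x, f' x = δ • parallelFront f t a x) ∧
                (∀ x, t' x = ε • parallelNormal f t a x) ∧
                (H'.space = H.space → δ = 1))) := by
  refine ⟨fun F => ⟨?_, ?_⟩, fun H f t h hu => ⟨h.isOmegaTouching hu, H.areInfinitySpheres⟩,
    fun F Sp Sm Qp Qm h => ?_⟩
  · rintro ⟨hu, H, f, t, h, rfl⟩
    exact ⟨_, _, _, _, h.isOmegaTouching hu⟩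
  · rintro ⟨Sp, Sm, Qp, Qm, h⟩
    obtain ⟨H, f, t, hf, hF, -⟩ := h.exists_flatFront
    exact ⟨h.omega.harmonic.umbilicFree, H, f, t, hf, hF⟩
  · obtain ⟨H, f, t, hf, rfl, rfl, rfl, hSp, hSm⟩ := h.exists_flatFront
    exact ⟨H, f, t, hf, rfl, rfl, rfl, H.areInfinitySpheres, hSp, hSm,
      fun a => ⟨H.space_parallel a, H.areInfinitySpheres_parallel a, hf.parallel a,
        (legendreLift_parallel a).symm⟩,
      fun H' f' t' hf' hF hQ => hf.front.exists_parallel hf'.front hF hQ⟩
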